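/- Let $m_1,m_2,m_3,m_4\ge 3$. Let $G_0$ be a group of type $\mathcal D_5$, that is, the group with generators $x,y,t_1,t_2,t_3$ and relations $$t_1^{2^{m_1}}=t_2^{2^{m_2}}=t_3^{2^{m_3}}=1,\quad x^2=t_2,\quad y^2=t_3,\quad t_1,t_2,t_3\text{ central},\quad x^{-1}y^{-1}xy=t_1^{2^{m_1-1}},$$ and let $G=G_0\times\langle t_4\rangle$ with $\langle t_4\rangle$ cyclic of order $2^{m_4}$. Write $\mathcal Z(G)$ for the centre and $G'$ for the commutator subgroup of $G$. Let $e$ be the exponent of $G$ and $\zeta$ a primitive $e$-th root of unity. The $\mathbb Q$-class of $g\in G$ is the set of all conjugates of the elements $g^r$, where $r\ge 0$ is such that $\zeta\mapsto\zeta^r$ defines an element of $\mathrm{Gal}(\mathbb Q(\zeta)/\mathbb Q)$; it is said to involve $w$ if it is the $\mathbb Q$-class of $aw$ for some $a\in\mathcal Z(G)$. Let $N_0$ be the number of cyclic subgroups of $G/G'$, let $N_1$ be the number of cyclic subgroups of $\mathcal Z(G)$, let $N_2,N_3,N_4$ be the numbers of $\mathbb Q$-classes of $G$ involving $x$, $y$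 and $xy$, respectively, and put $N=N_1+N_2+N_3+N_4$. 1. If $c(a,b,c,d)$ denotes the number of cyclic subgroups of $C_{2^a}\times C_{2^b}\times C_{2^c}\times C_{2^d}$, then $$\begin{aligned}N_0&=c(m_1-1,m_2+1,m_3+1,m_4),\qquad N_1=c(m_1,m_2,m_3,m_4),\\ N_2&=c(m_1-1,m_2+1,m_3,m_4)-c(m_1-1,m_2,m_3,m_4),\\ N_3&=c(m_1-1,m_2,m_3+1,m_4)-c(m_1-1,m_2,m_3,m_4),\\ N_4&=c(m_1-1,\max(m_2,m_3)+1,\min(m_2,m_3),m_4)-c(m_1-1,m_2,m_3,m_4).\end{aligned}$$ 2. The group algebra $\mathbb QG$ is the direct sum of $N_0$ fields and $N-N_0$ quaternion algebras (each over a field extension of $\mathbb Q$); in particular $N_0\le N$. Also $2N_0\ge 136$. 3. Let $K$ be a finite field of odd order $q$. Then $KG$ is a direct sum of finitely many simple algebras, and the number of simple components in any such (Wedderburn) decomposition is at least $2N-136$. 4. If moreover $q\equiv 3\pmod 8$, then $KG$ is the direct sum of exactly $2N-136$ simple algebras; more precisely, $KG$ is the direct sum of $2N_0-136$ fields and $2(N-N_0)$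 quaternion algebras (over field extensions of $K$), each of which is a ring of $2\times 2$ matrices over its centre. -/

import Mathlib

open scoped Quaternion

universe u v

/-- The five generators of a group of type `D₅`. -/
inductive D5Gen : Type
  | x
  | y
  | t₁
  | t₂
  | t₃

/-- The defining relations of a group of type `D₅`:
`t₁, t₂, t₃` are central, `t₁ ^ 2 ^ m₁ = t₂ ^ 2 ^ m₂ = t₃ ^ 2 ^ m₃ = 1`, `x² = t₂`, `y² = t₃` and
`(x, y) = x⁻¹ y⁻¹ x y = t₁ ^ 2 ^ (m₁ - 1)`. -/
def d5Rels (m₁ m₂ m₃ : ℕ) : Set (FreeGroup D5Gen) :=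
  let x := FreeGroup.of D5Gen.x
  let y := FreeGroup.of D5Gen.y
  let t₁ := FreeGroup.of D5Gen.t₁
  let t₂ := FreeGroup.of D5Gen.t₂
  let t₃ := FreeGroup.of D5Gen.t₃
  {t₁ ^ 2 ^ m₁, t₂ ^ 2 ^ m₂, t₃ ^ 2 ^ m₃, x ^ 2 * t₂⁻¹, y ^ 2 * t₃⁻¹,
    x⁻¹ * y⁻¹ * x * y * (t₁ ^ 2 ^ (m₁ - 1))⁻¹} ∪
  {w | ∃ t ∈ ({t₁, t₂, t₃} : Set (FreeGroup D5Gen)), ∃ g : D5Gen,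
    w = t * FreeGroup.of g * t⁻¹ * (FreeGroup.of g)⁻¹}

/-- The group of type `D₅` with parameters `m₁, m₂, m₃`. -/
abbrev D5Group (m₁ m₂ m₃ : ℕ) : Type := PresentedGroup (d5Rels m₁ m₂ m₃)

/-- The number of cyclic subgroups of `G`. -/
noncomputable def numCyclicSubgroups (G : Type u) [Group G] : ℕ :=
  Nat.card {H : Subgroup G // IsCyclic H}

/-- The number of cyclic subgroups of `C_{2^a} × C_{2^b} × C_{2^c} × C_{2^d}`. -/
noncomputable def rankFourCount (a b c d : ℕ) : ℕ :=
  numCyclicSubgroups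
    (Multiplicative (ZMod (2 ^ a)) × Multiplicative (ZMod (2 ^ b)) ×
      Multiplicative (ZMod (2 ^ c)) × Multiplicative (ZMod (2 ^ d)))

/-- The `K`-class of `g` (as a union of conjugacy classes of `G`): with `ζ` a primitive root of
unity of order the exponent of `G`, it consists of the conjugates of the powers `g ^ r` for which
`ζ ↦ ζ ^ r` comes from an element of the Galois group of `K(ζ)` over `K`. -/
def kClass (K : Type v) [Field K] {G : Type u} [Group G] (g : G) : Set G :=
  {h | ∃ (σ : CyclotomicField (Monoid.exponent G) K ≃ₐ[K] CyclotomicField (Monoid.exponent G) K)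
      (r : ℕ), (∀ ζ, IsPrimitiveRoot ζ (Monoid.exponent G) → σ ζ = ζ ^ r) ∧ IsConj (g ^ r) h}

/-- The number of `K`-classes of `G` involving `w`, that is, the number of `K`-classes of the
elements `a * w` with `a` central. -/
noncomputable def numKClassesInvolving (K : Type v) [Field K] {G : Type u} [Group G] (w : G) : ℕ :=
  {C : Set G | ∃ a ∈ Subgroup.center G, C = kClass K (a * w)}.ncard

/-- `A` is the direct sum of `n` simple `K`-algebras, i.e. its Wedderburn decomposition has `n`
simple components. -/
def HasSimpleComponents (K : Type v) [Field K] (A : Type u) [Ring A] [Algebra K A] (n : ℕ) :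
    Prop :=
  ∃ (B : Fin n → Type u) (_ : ∀ i, Ring (B i)) (_ : ∀ i, Algebra K (B i)),
    (∀ i, IsSimpleRing (B i)) ∧ Nonempty (A ≃ₐ[K] (∀ i, B i))

/-- For `K` of characteristic different from `2`: the `K`-algebra `A` is the direct sum of `n`
fields and `k` quaternion algebras, the `j`-th of which is the algebra
`⟨i, j | i² = a, j² = b, i j = - j i⟩` with `a, b ≠ 0` over some field extension of `K`. -/
def IsSumFieldsQuaternions (K : Type v) [Field K] (A : Type u) [Ring A]
    [Algebra K A] (n k : ℕ) : Prop :=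
  ∃ (E : Fin n → Type u) (_ : ∀ i, Field (E i)) (_ : ∀ i, Algebra K (E i))
    (Z : Fin k → Type u) (_ : ∀ j, Field (Z j)) (_ : ∀ j, Algebra K (Z j))
    (a b : ∀ j, Z j),
    (∀ j, a j ≠ 0 ∧ b j ≠ 0) ∧
    Nonempty (A ≃ₐ[K] (∀ i, E i) × (∀ j, ℍ[Z j, a j, b j]))

/-- For `K` of characteristic different from `2`: the `K`-algebra `A` is the direct sum of `n`
fields and `k` quaternion algebras, each of which is a ring of `2 × 2` matrices over its centre. -/
def IsSumFieldsSplitQuaternions (K : Type v) [Field K] (A : Type u) [Ring A]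
    [Algebra K A] (n k : ℕ) : Prop :=
  ∃ (E : Fin n → Type u) (_ : ∀ i, Field (E i)) (_ : ∀ i, Algebra K (E i))
    (Z : Fin k → Type u) (_ : ∀ j, Field (Z j)) (_ : ∀ j, Algebra K (Z j))
    (a b : ∀ j, Z j),
    (∀ j, a j ≠ 0 ∧ b j ≠ 0) ∧
    (∀ j, Nonempty (ℍ[Z j, a j, b j] ≃ₐ[Z j] Matrix (Fin 2) (Fin 2) (Z j))) ∧
    Nonempty (A ≃ₐ[K] (∀ i, E i) × (∀ j, ℍ[Z j, a j, b j]))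

/-! ### Counting images -/

/-! Put z = t₁^(2^(m₁-1)). Then G' = {1, z}, z is central, and G/Z(G) is a Klein four-group
generated by the images of x and y. If K has characteristic different from 2, the idempotents (1 ±
z)/2 split KG into K[G/G'] and a part on which z = -1. With S = K[Z(G)]/(z + 1), the relations x² =
t₂, y² = t₃, xy = yxz = -yx turn the second part into the quaternion algebra over S with parameters
t₂, t₃ (`exists_hom_quaternion`, `nonempty_algEquiv_prod`).

Both K[G/G'] and S are reduced, hence products of fields. Their factors correspond to Galois orbits
of characters: all characters of G/G', respectively the characters of Z(G) with χ(z) = -1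
(`card_maximalSpectrum`). A Galois automorphism acts on characters by raising them to a power, so
everything reduces to counting orbits of power maps on finite abelian 2-groups.

Over ℚ all odd powers occur, and orbits are cyclic subgroups. This gives N₀ fields and
c(m₁,m₂,m₃,m₄) - c(m₁-1,m₂,m₃,m₄) quaternion algebras. The latter number is N - N₀: the conjugacy
class of a noncentral element is a coset of G', so N₂, N₃, N₄ count the cyclic subgroups of G/G'
with a generator in one of the three nontrivial cosets of Z(G)/G'. Hence N₀ = c(m₁-1,m₂,m₃,m₄) + N₂
+ N₃ + N₄ (`cyclicCount_parity_sum`), whereas N₁ = c(m₁,m₂,m₃,m₄).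

Over a field with q elements only the powers q^i occur. The units modulo 8 are not cyclic, so the
generators of a cyclic group of order at least 8 form at least two orbits. For q ≡ 3 mod 8 they form
exactly two, and the generators of a group of order at most 4 form one. The exceptional cyclic
subgroups of order at most 4 number 136, those of C₄⁴. They occur only for G/G': a character with
χ(z) = -1 has order at least 8, because z is a fourth power in the centre. Quaternion algebras over
finite fields of odd order split, and the number of simple components is an invariant because it is
determined by the number of central idempotents. -/

theorem ncard_image_eq_of_forall_iff {α β γ : Type*} {f : α → β} {g : α → γ} {U : Set α}
    (h : ∀ a ∈ U, ∀ b ∈ U, (f a = f b ↔ g a = g b)) : (f '' U).ncard = (g '' U).ncard := by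
  refine Set.ncard_congr (fun s hs => g hs.choose) (fun s hs => ⟨_, hs.choose_spec.1, rfl⟩) ?_ ?_
  · intro s t hs ht hst
    rw [← hs.choose_spec.2, ← ht.choose_spec.2]
    exact (h _ hs.choose_spec.1 _ ht.choose_spec.1).2 hst
  · rintro _ ⟨a, ha, rfl⟩
    have hs : f a ∈ f '' U := ⟨a, ha, rfl⟩
    exact ⟨f a, hs, (h _ hs.choose_spec.1 _ ha).1 hs.choose_spec.2⟩

/-- The number of cyclic subgroups with a generator in `U`. -/
noncomputable def cyclicCount {A : Type*} [Group A] (U : Set A) : ℕ :=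
  (Subgroup.zpowers '' U).ncard

/-- The powers of `a` with exponent in `R`. -/
def powClass {A : Type*} [Group A] (R : Set ℕ) (a : A) : Set A := (fun r => a ^ r) '' R

/-- The number of sets of powers with exponents in `R` of elements of `U`. -/
noncomputable def powClassCount {A : Type*} [Group A] (R : Set ℕ) (U : Set A) : ℕ :=
  (powClass R '' U).ncard

section

variable {A B : Type*} [Group A] [Group B]

theorem numCyclicSubgroups_eq_cyclicCount :
    numCyclicSubgroups A = cyclicCount (Set.univ : Set A) := by
  rw [numCyclicSubgroups, cyclicCount, ← Nat.card_coe_set_eq]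
  refine Nat.card_congr (Equiv.subtypeEquivRight fun H => ?_)
  rw [Subgroup.isCyclic_iff_exists_zpowers_eq_top]
  simp

theorem cyclicCount_image (f : A →* B) (hf : Function.Injective f) (U : Set A) :
    cyclicCount (f '' U) = cyclicCount U := by
  rw [cyclicCount, cyclicCount, Set.image_image]
  refine ncard_image_eq_of_forall_iff fun a _ b _ => ?_
  rw [← MonoidHom.map_zpowers, ← MonoidHom.map_zpowers]
  exact (Subgroup.map_injective hf).eq_iff

theorem powClass_map (f : A →* B) (R : Set ℕ) (a : A) : powClass R (f a) = f '' powClass R a := by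
  simp [powClass, Set.image_image]

theorem powClassCount_image (f : A →* B) (hf : Function.Injective f) (R : Set ℕ) (U : Set A) :
    powClassCount R (f '' U) = powClassCount R U := by
  rw [powClassCount, powClassCount, Set.image_image]
  refine ncard_image_eq_of_forall_iff fun a _ b _ => ?_
  rw [powClass_map, powClass_map]
  exact hf.image_injective.eq_iff

theorem numCyclicSubgroups_eq_cyclicCount_range (f : A →* B) (hf : Function.Injective f) :
    numCyclicSubgroups A = cyclicCount (Set.range f) := by
  rw [numCyclicSubgroups_eq_cyclicCount, ← Set.image_univ, cyclicCount_image f hf]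

theorem numCyclicSubgroups_congr (f : A ≃* B) : numCyclicSubgroups A = numCyclicSubgroups B := by
  rw [numCyclicSubgroups_eq_cyclicCount_range f.toMonoidHom f.injective,
    numCyclicSubgroups_eq_cyclicCount]
  congr 1
  exact f.surjective.range_eq

theorem self_mem_powClass {R : Set ℕ} (hR : 1 ∈ R) (a : A) : a ∈ powClass R a := ⟨1, hR, pow_one a⟩

/-- Because the exponent 1 is allowed, a class contains its base point and determines the cyclic
subgroup. Power classes therefore refine the partition by generated subgroup, and the counts below
are compared fibre by fibre over the cyclic subgroups. -/
theorem closure_powClass {R : Set ℕ} (hR : 1 ∈ R) (a : A) :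
    Subgroup.closure (powClass R a) = Subgroup.zpowers a := by
  apply le_antisymm
  · rw [Subgroup.closure_le]
    rintro _ ⟨r, -, rfl⟩
    exact Subgroup.npow_mem_zpowers a r
  · rw [Subgroup.zpowers_le]
    exact Subgroup.subset_closure (self_mem_powClass hR a)

theorem zpowers_eq_of_powClass_eq {R : Set ℕ} (hR : 1 ∈ R) {a b : A}
    (h : powClass R a = powClass R b) : Subgroup.zpowers a = Subgroup.zpowers b := by
  rw [← closure_powClass hR, h, closure_powClass hR]

theorem eq_one_of_pow_odd_of_pow_two {a : A} {s k : ℕ} (hs : Odd s) (h : a ^ s = 1)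
    (hk : a ^ 2 ^ k = 1) : a = 1 := by
  have h1 := orderOf_dvd_of_pow_eq_one h
  have h2 := orderOf_dvd_of_pow_eq_one hk
  have : Nat.Coprime s (2 ^ k) := (Nat.coprime_two_right.2 hs).pow_right k
  rw [← orderOf_eq_one_iff]
  exact Nat.dvd_one.1 (this ▸ Nat.dvd_gcd h1 h2)

theorem exists_odd_pow_of_zpowers_eq {a b : A} {k : ℕ} (hk : a ^ 2 ^ k = 1)
    (h : Subgroup.zpowers a = Subgroup.zpowers b) : ∃ r, Odd r ∧ b = a ^ r := by
  have hfin : IsOfFinOrder a := isOfFinOrder_iff_pow_eq_one.2 ⟨2 ^ k, by positivity, hk⟩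
  have hb : b ∈ Subgroup.zpowers a := h ▸ Subgroup.mem_zpowers b
  obtain ⟨s, hs⟩ := (hfin.mem_powers_iff_mem_zpowers.2 hb)
  have hs : a ^ s = b := hs
  have hfb : IsOfFinOrder b := hs ▸ hfin.pow
  have ha : a ∈ Subgroup.zpowers b := h ▸ Subgroup.mem_zpowers a
  obtain ⟨t, ht⟩ := (hfb.mem_powers_iff_mem_zpowers.2 ha)
  have ht : b ^ t = a := ht
  rcases Nat.even_or_odd s with he | ho
  -- For even s the identity a = a^(st) gives a^(st-1) = 1 with an odd exponent, so a is trivial and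
  -- the exponent 1 serves. The case st = 0 is treated apart because the subtraction would truncate.
  · rcases Nat.eq_zero_or_pos (s * t) with h0 | hpos
    · have : a = 1 := by rw [← ht, ← hs, ← pow_mul, h0, pow_zero]
      subst this
      exact ⟨1, odd_one, by simpa using hs.symm⟩
    · have h1 : a ^ (s * t - 1) = 1 := by
        have : a ^ (s * t - 1) * a = a := by
          rw [← pow_succ, Nat.sub_add_cancel hpos, pow_mul, hs, ht]
        exact mul_eq_right.1 this
      have hodd : Odd (s * t - 1) := Nat.Even.sub_odd hpos (he.mul_right t) odd_one
      have := eq_one_of_pow_odd_of_pow_two hodd h1 hk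
      subst this
      exact ⟨1, odd_one, by simpa using hs.symm⟩
  · exact ⟨s, ho, hs.symm⟩

theorem zpowers_pow_odd {a : A} {k r : ℕ} (hk : a ^ 2 ^ k = 1) (hr : Odd r) :
    Subgroup.zpowers (a ^ r) = Subgroup.zpowers a := by
  apply le_antisymm
  · rw [Subgroup.zpowers_le]
    exact Subgroup.npow_mem_zpowers a r
  · rw [Subgroup.zpowers_le]
    obtain ⟨m, hm⟩ := exists_pow_eq_self_of_coprime (x := a) (n := r)
      (((Nat.coprime_two_right.2 hr).pow_right k).coprime_dvd_right (orderOf_dvd_of_pow_eq_one hk))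
    have := Subgroup.npow_mem_zpowers (a ^ r) m
    rwa [hm] at this

theorem powClass_odd_subset {a b : A} {r : ℕ} (hr : Odd r) (h : b = a ^ r) :
    powClass {r | Odd r} b ⊆ powClass {r | Odd r} a := by
  rintro _ ⟨s, hs, rfl⟩
  exact ⟨r * s, hr.mul hs, by simp only [h, pow_mul]⟩

theorem powClass_odd_eq_iff {a b : A} {k : ℕ} (ha : a ^ 2 ^ k = 1) (hb : b ^ 2 ^ k = 1) :
    powClass {r | Odd r} a = powClass {r | Odd r} b ↔
      Subgroup.zpowers a = Subgroup.zpowers b := by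
  refine ⟨zpowers_eq_of_powClass_eq odd_one, fun h => ?_⟩
  obtain ⟨r, hr, hr'⟩ := exists_odd_pow_of_zpowers_eq ha h
  obtain ⟨s, hs, hs'⟩ := exists_odd_pow_of_zpowers_eq hb h.symm
  exact (powClass_odd_subset hs hs').antisymm (powClass_odd_subset hr hr')

/-- In a 2-group the odd powers of an element are exactly the generators of the subgroup it
generates. This is the orbit count over ℚ. -/
theorem powClassCount_odd {U : Set A} {k : ℕ} (hU : ∀ a ∈ U, a ^ 2 ^ k = 1) :
    powClassCount {r | Odd r} U = cyclicCount U :=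
  ncard_image_eq_of_forall_iff fun _ ha _ hb => powClass_odd_eq_iff (hU _ ha) (hU _ hb)

theorem cyclicCount_union [Finite A] {U V : Set A}
    (h : ∀ a ∈ U, ∀ b ∈ V, Subgroup.zpowers a ≠ Subgroup.zpowers b) :
    cyclicCount (U ∪ V) = cyclicCount U + cyclicCount V := by
  rw [cyclicCount, Set.image_union, Set.ncard_union_eq _ (Set.toFinite _) (Set.toFinite _)]
  · rfl
  · rw [Set.disjoint_left]
    rintro _ ⟨a, ha, rfl⟩ ⟨b, hb, hab⟩
    exact h a ha b hb hab.symm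

theorem powClassCount_union [Finite A] {R : Set ℕ} (hR : 1 ∈ R) {U V : Set A}
    (h : ∀ a ∈ U, ∀ b ∈ V, Subgroup.zpowers a ≠ Subgroup.zpowers b) :
    powClassCount R (U ∪ V) = powClassCount R U + powClassCount R V := by
  rw [powClassCount, Set.image_union, Set.ncard_union_eq _ (Set.toFinite _) (Set.toFinite _)]
  · rfl
  · rw [Set.disjoint_left]
    rintro _ ⟨a, ha, rfl⟩ ⟨b, hb, hab⟩
    exact h a ha b hb (zpowers_eq_of_powClass_eq hR hab.symm)

theorem cyclicCount_eq_ncard_closure {R : Set ℕ} (hR : 1 ∈ R) (U : Set A) :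
    Subgroup.zpowers '' U = Subgroup.closure '' (powClass R '' U) := by
  rw [Set.image_image]
  simp_rw [closure_powClass hR]

theorem cyclicCount_le_powClassCount [Finite A] {R : Set ℕ} (hR : 1 ∈ R) (U : Set A) :
    cyclicCount U ≤ powClassCount R U := by
  rw [cyclicCount, cyclicCount_eq_ncard_closure hR]
  exact Set.ncard_image_le (Set.toFinite _)

open Classical in
theorem two_mul_cyclicCount_le_powClassCount [Finite A] {R : Set ℕ} (hR : 1 ∈ R) {U : Set A}
    (h : ∀ a ∈ U, ∃ b ∈ U, Subgroup.zpowers a = Subgroup.zpowers b ∧ powClass R a ≠ powClass R b) :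
    2 * cyclicCount U ≤ powClassCount R U := by
  have hfin : (powClass R '' U).Finite := Set.toFinite _
  rw [cyclicCount, cyclicCount_eq_ncard_closure hR, powClassCount]
  have := Finset.mul_card_image_le_card (f := (Subgroup.closure : Set A → Subgroup A))
    hfin.toFinset 2 ?_
  · rwa [← hfin.coe_toFinset, ← Finset.coe_image, Set.ncard_coe_finset, Set.ncard_coe_finset]
  · intro H hH
    simp only [Finset.mem_image, Set.Finite.mem_toFinset] at hH
    obtain ⟨_, ⟨a, ha, rfl⟩, rfl⟩ := hH
    obtain ⟨b, hb, hab, hne⟩ := h a ha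
    apply Finset.one_lt_card.2
    refine ⟨powClass R a, ?_, powClass R b, ?_, hne⟩
    · simpa using ⟨a, ha, rfl⟩
    · simp only [Finset.mem_filter, Set.Finite.mem_toFinset]
      exact ⟨⟨b, hb, rfl⟩, by rw [closure_powClass hR, closure_powClass hR, hab]⟩

open Classical in
theorem powClassCount_le_two_mul_cyclicCount [Finite A] {R : Set ℕ} (hR : 1 ∈ R) {U : Set A}
    (h : ∀ a ∈ U, ∃ b, ∀ c ∈ U, Subgroup.zpowers c = Subgroup.zpowers a →
      powClass R c = powClass R a ∨ powClass R c = powClass R b) :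
    powClassCount R U ≤ 2 * cyclicCount U := by
  have hfin : (powClass R '' U).Finite := Set.toFinite _
  rw [cyclicCount, cyclicCount_eq_ncard_closure hR, powClassCount]
  have := Finset.card_le_mul_card_image (f := (Subgroup.closure : Set A → Subgroup A))
    hfin.toFinset 2 ?_
  · rwa [← hfin.coe_toFinset, ← Finset.coe_image, Set.ncard_coe_finset, Set.ncard_coe_finset]
  · intro H hH
    simp only [Finset.mem_image, Set.Finite.mem_toFinset] at hH
    obtain ⟨_, ⟨a, ha, rfl⟩, rfl⟩ := hH
    obtain ⟨b, hb⟩ := h a ha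
    refine (Finset.card_le_card (t := {powClass R a, powClass R b}) ?_).trans Finset.card_le_two
    intro C hC
    simp only [Finset.mem_filter, Set.Finite.mem_toFinset] at hC
    obtain ⟨⟨c, hc, rfl⟩, hcl⟩ := hC
    rw [closure_powClass hR, closure_powClass hR] at hcl
    simpa using hb c hc hcl

/-! ### Powers of an odd number modulo powers of two -/

/-- The square of a number congruent to 3 mod 8 is 9 mod 16, and each further squaring moves the
lowest binary digit in which the power differs from 1 up by one place. These powers of q correct a
congruence by a single binary digit. -/
theorem pow_two_pow_modEq {q : ℕ} (hq : q % 8 = 3) (k : ℕ) :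
    q ^ 2 ^ (k + 1) ≡ 1 + 2 ^ (k + 3) [MOD 2 ^ (k + 4)] := by
  induction k with
  | zero =>
    obtain ⟨m, rfl⟩ : ∃ m, q = 8 * m + 3 := ⟨q / 8, by omega⟩
    change (8 * m + 3) ^ 2 % 16 = 9 % 16
    ring_nf
    omega
  | succ k ih =>
    obtain ⟨c, hc⟩ := (Nat.modEq_iff_dvd.1 ih.symm)
    push_cast at hc
    rw [← Int.natCast_modEq_iff, Int.modEq_comm, Int.modEq_iff_dvd]
    push_cast
    rw [pow_succ 2 (k + 1), pow_mul, sub_eq_iff_eq_add.1 hc]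
    refine ⟨2 ^ (k + 1) + c ^ 2 * 2 ^ (k + 3) + c + c * 2 ^ (k + 3), by ring⟩

/-- A Hensel-type lifting: if the congruence modulo 2^(k+3) fails modulo 2^(k+4), the error is an
odd multiple of 2^(k+3). Multiplication by q^(2^(k+1)) ≡ 1 + 2^(k+3) adds another odd multiple, s
being odd, and the two cancel. So whether an odd s lies in the coset of c under the powers of q is
decided modulo 8. -/
theorem exists_mul_pow_modEq {q s c : ℕ} (hq : q % 8 = 3) (hs : Odd s)
    (h : ∃ i, c * q ^ i ≡ s [MOD 8]) (k : ℕ) : ∃ i, c * q ^ i ≡ s [MOD 2 ^ k] := by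
  suffices H : ∀ k, ∃ i, c * q ^ i ≡ s [MOD 2 ^ (k + 3)] by
    obtain ⟨i, hi⟩ := H k
    exact ⟨i, hi.of_dvd (pow_dvd_pow 2 (by omega))⟩
  intro k
  induction k with
  | zero => exact h
  | succ k ih =>
    obtain ⟨i, hi⟩ := ih
    by_cases hi' : c * q ^ i ≡ s [MOD 2 ^ (k + 4)]
    · exact ⟨i, hi'⟩
    · refine ⟨i + 2 ^ (k + 1), ?_⟩
      obtain ⟨d, hd⟩ := (Nat.modEq_iff_dvd.1 hi.symm)
      obtain ⟨e, he⟩ := (Nat.modEq_iff_dvd.1 (pow_two_pow_modEq hq k).symm)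
      obtain ⟨j, hj⟩ : Odd d := by
        rw [← Int.not_even_iff_odd]
        rintro ⟨j, rfl⟩
        refine hi' ((Nat.modEq_iff_dvd.2 ⟨j, ?_⟩).symm)
        rw [hd]; push_cast; ring
      obtain ⟨l, rfl⟩ := hs
      rw [← Int.natCast_modEq_iff, Int.modEq_comm, Int.modEq_iff_dvd]
      push_cast at hd he ⊢
      rw [pow_add (q : ℤ), ← mul_assoc, sub_eq_iff_eq_add.1 hd, sub_eq_iff_eq_add.1 he, hj]
      exact ⟨1 + l + j + (2 * j + 1) * 2 ^ (k + 2) +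
        e * (2 * l + 1 + 2 ^ (k + 3) * (2 * j + 1)), by ring⟩

/-- Odd squares are 1 modulo 8, so the powers of q only meet the residues 1 and q among the four odd
ones. The residue 3 is missed unless q is 3 modulo 8, and then 5 is missed. -/
theorem exists_odd_forall_pow_not_modEq {q : ℕ} (hq : Odd q) :
    ∃ r, Odd r ∧ ∀ i, ¬ r ≡ q ^ i [MOD 8] := by
  have key : ∀ i, q ^ i % 8 = 1 ∨ q ^ i % 8 = q % 8 := by
    intro i
    induction i with
    | zero => left; rfl
    | succ i ih =>
      have h8 : q % 8 = 1 ∨ q % 8 = 3 ∨ q % 8 = 5 ∨ q % 8 = 7 := by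
        have := Nat.odd_iff.1 hq; omega
      rw [pow_succ, Nat.mul_mod]
      rcases ih with h | h <;> rcases h8 with h' | h' | h' | h' <;> rw [h, h'] <;> simp
  rcases eq_or_ne (q % 8) 3 with h | h
  · exact ⟨5, by decide, fun i hi => by
      have := key i; unfold Nat.ModEq at hi; omega⟩
  · exact ⟨3, by decide, fun i hi => by
      have := key i; unfold Nat.ModEq at hi; omega⟩

/-! ### Classes of powers by powers of an odd number -/

/-- The set of powers of `q`. -/
def powersOf (q : ℕ) : Set ℕ := Set.range fun i : ℕ => q ^ i

theorem one_mem_powersOf (q : ℕ) : 1 ∈ powersOf q := ⟨0, pow_zero q⟩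

theorem powClass_powersOf_subset {q : ℕ} {a b : A} (h : b ∈ powClass (powersOf q) a) :
    powClass (powersOf q) b ⊆ powClass (powersOf q) a := by
  obtain ⟨_, ⟨i, rfl⟩, rfl⟩ := h
  rintro _ ⟨_, ⟨j, rfl⟩, rfl⟩
  exact ⟨q ^ (i + j), ⟨i + j, rfl⟩, by simp only [pow_add, pow_mul]⟩

theorem powClass_powersOf_eq [Finite A] {q k : ℕ} (hq : Odd q) {a b : A} (hk : a ^ 2 ^ k = 1)
    (h : b ∈ powClass (powersOf q) a) : powClass (powersOf q) b = powClass (powersOf q) a := by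
  refine (powClass_powersOf_subset h).antisymm (powClass_powersOf_subset ?_)
  obtain ⟨_, ⟨i, rfl⟩, rfl⟩ := h
  have hcop : Nat.Coprime (q ^ i) (2 ^ k) := ((Nat.coprime_two_right.2 hq).pow_left i).pow_right k
  -- By Euler's theorem q^(i(φ(2^k)-1)) is an inverse of q^i modulo 2^k. Thus the powers of q act as
  -- a group and the classes are its orbits.
  refine ⟨q ^ (i * (Nat.totient (2 ^ k) - 1)), ⟨_, rfl⟩, ?_⟩
  have hpos : 0 < Nat.totient (2 ^ k) := Nat.totient_pos.2 (by positivity)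
  change (a ^ q ^ i) ^ _ = a
  rw [pow_mul q, ← pow_mul, ← pow_succ', Nat.sub_add_cancel hpos]
  conv_rhs => rw [← pow_one a]
  exact pow_eq_pow_iff_modEq.2 ((Nat.ModEq.pow_totient hcop).of_dvd (orderOf_dvd_of_pow_eq_one hk))

/-- An odd r that is no power of q modulo 8 gives a second generator a^r of the same subgroup; as 8
divides the order of a, it lies in another orbit. -/
theorem two_mul_cyclicCount_le [Finite A] {q k : ℕ} (hq : Odd q) {U : Set A}
    (hk : ∀ a ∈ U, a ^ 2 ^ k = 1) (hU : ∀ a ∈ U, ∀ r, Odd r → a ^ r ∈ U)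
    (h8 : ∀ a ∈ U, 8 ∣ orderOf a) : 2 * cyclicCount U ≤ powClassCount (powersOf q) U := by
  obtain ⟨r, hr, hri⟩ := exists_odd_forall_pow_not_modEq hq
  refine two_mul_cyclicCount_le_powClassCount (one_mem_powersOf q) fun a ha =>
    ⟨a ^ r, hU a ha r hr, (zpowers_pow_odd (hk a ha) hr).symm, fun h => ?_⟩
  have : a ^ r ∈ powClass (powersOf q) a := h ▸ self_mem_powClass (one_mem_powersOf q) _
  obtain ⟨_, ⟨i, rfl⟩, hi⟩ := this
  exact hri i ((pow_eq_pow_iff_modEq.1 hi.symm).of_dvd (h8 a ha))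

/-- For q ≡ 3 mod 8 the residues 1, q, 5, 5q run through all odd classes modulo 8. By lifting, every
odd exponent is a power of q or 5 times one, so each cyclic subgroup carries at most the orbits of a
and a^5. -/
theorem le_two_mul_cyclicCount [Finite A] {q k : ℕ} (hq : q % 8 = 3) {U : Set A}
    (hk : ∀ a ∈ U, a ^ 2 ^ k = 1) : powClassCount (powersOf q) U ≤ 2 * cyclicCount U := by
  have hodd : Odd q := Nat.odd_iff.2 (by omega)
  refine powClassCount_le_two_mul_cyclicCount (one_mem_powersOf q) fun a ha =>
    ⟨a ^ 5, fun c hc hca => ?_⟩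
  obtain ⟨s, hs, rfl⟩ := exists_odd_pow_of_zpowers_eq (hk a ha) hca.symm
  have h8 : s % 8 = 1 ∨ s % 8 = 3 ∨ s % 8 = 5 ∨ s % 8 = 7 := by
    have := Nat.odd_iff.1 hs; omega
  have main : (∃ i, 1 * q ^ i ≡ s [MOD 8]) ∨ ∃ i, 5 * q ^ i ≡ s [MOD 8] := by
    simp only [Nat.ModEq]
    rcases h8 with h | h | h | h
    · exact Or.inl ⟨0, by simp [h]⟩
    · exact Or.inl ⟨1, by rw [pow_one]; omega⟩
    · exact Or.inr ⟨0, by simp [h]⟩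
    · exact Or.inr ⟨1, by rw [pow_one]; omega⟩
  rcases main with h | h
  · left
    obtain ⟨i, hi⟩ := exists_mul_pow_modEq hq hs h k
    apply powClass_powersOf_eq hodd (hk a ha)
    refine ⟨_, ⟨i, rfl⟩, pow_eq_pow_iff_modEq.2 ?_⟩
    rw [one_mul] at hi
    exact hi.of_dvd (orderOf_dvd_of_pow_eq_one (hk a ha))
  · right
    obtain ⟨i, hi⟩ := exists_mul_pow_modEq hq hs h k
    apply powClass_powersOf_eq (k := k) hodd
    · rw [← pow_mul, mul_comm, pow_mul, hk a ha, one_pow]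
    refine ⟨_, ⟨i, rfl⟩, ?_⟩
    change (a ^ 5) ^ q ^ i = _
    rw [← pow_mul]
    exact pow_eq_pow_iff_modEq.2 (hi.of_dvd (orderOf_dvd_of_pow_eq_one (hk a ha)))

/-- The only generators are a and its inverse, and q ≡ -1 mod 4 interchanges them. -/
theorem powClassCount_eq_cyclicCount_of_pow_four [Finite A] {q : ℕ} (hq : q % 8 = 3) {U : Set A}
    (h4 : ∀ a ∈ U, a ^ 4 = 1) : powClassCount (powersOf q) U = cyclicCount U := by
  have hodd : Odd q := Nat.odd_iff.2 (by omega)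
  refine ncard_image_eq_of_forall_iff fun a ha b hb =>
    ⟨zpowers_eq_of_powClass_eq (one_mem_powersOf q), fun h => ?_⟩
  have ha4 : a ^ 2 ^ 2 = 1 := h4 a ha
  obtain ⟨s, hs, rfl⟩ := exists_odd_pow_of_zpowers_eq ha4 h
  refine (powClass_powersOf_eq hodd ha4 ?_).symm
  have : s % 4 = 1 ∨ s % 4 = 3 := by
    have := Nat.odd_iff.1 hs; omega
  rcases this with h | h
  · refine ⟨_, ⟨0, rfl⟩, pow_eq_pow_iff_modEq.2 (Nat.ModEq.of_dvd
      (orderOf_dvd_of_pow_eq_one (h4 a ha)) ?_)⟩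
    simp [Nat.ModEq, h]
  · refine ⟨_, ⟨1, rfl⟩, pow_eq_pow_iff_modEq.2 (Nat.ModEq.of_dvd
      (orderOf_dvd_of_pow_eq_one (h4 a ha)) ?_)⟩
    simp only [Nat.ModEq, pow_one]; omega

theorem zpowers_ne_of_pow_four {a b : A} (ha : a ^ 4 = 1) (hb : ¬ b ^ 4 = 1) :
    Subgroup.zpowers a ≠ Subgroup.zpowers b := by
  intro h
  obtain ⟨s, hs⟩ := Subgroup.mem_zpowers_iff.1 (h ▸ Subgroup.mem_zpowers b : b ∈ _)
  apply hb
  rw [← hs, ← zpow_natCast, ← zpow_mul, mul_comm, zpow_mul, zpow_natCast, ha, one_zpow]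

theorem eight_dvd_orderOf {a : A} {k : ℕ} (hk : a ^ 2 ^ k = 1) (h : ¬ a ^ 4 = 1) :
    8 ∣ orderOf a := by
  obtain ⟨j, -, hj⟩ := (Nat.dvd_prime_pow Nat.prime_two).1 (orderOf_dvd_of_pow_eq_one hk)
  rcases le_or_gt 3 j with h3 | h3
  · exact hj ▸ pow_dvd_pow 2 h3
  · exact absurd (orderOf_dvd_iff_pow_eq_one.1 (hj ▸ pow_dvd_pow 2 (show j ≤ 2 by omega))) h

/-- Cyclic subgroups of order at least 8 carry two orbits or more, the others at least one. The
added term makes up for the second orbit that subgroups of order at most 4 may lack. -/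
theorem two_mul_numCyclicSubgroups_le [Finite A] {q k : ℕ} (hq : Odd q)
    (hk : ∀ a : A, a ^ 2 ^ k = 1) :
    2 * numCyclicSubgroups A ≤
      powClassCount (powersOf q) (Set.univ : Set A) + cyclicCount {a : A | a ^ 4 = 1} := by
  have hne : ∀ a ∈ {a : A | a ^ 4 = 1}, ∀ b ∈ {a : A | a ^ 4 = 1}ᶜ,
      Subgroup.zpowers a ≠ Subgroup.zpowers b := fun a ha b hb => zpowers_ne_of_pow_four ha hb
  rw [numCyclicSubgroups_eq_cyclicCount, ← Set.union_compl_self {a : A | a ^ 4 = 1},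
    cyclicCount_union hne, powClassCount_union (one_mem_powersOf q) hne]
  have h1 := cyclicCount_le_powClassCount (one_mem_powersOf q) {a : A | a ^ 4 = 1}
  have h2 := two_mul_cyclicCount_le (A := A) hq (U := {a : A | a ^ 4 = 1}ᶜ) (fun a _ => hk a)
    (fun a ha r hr h => ha (eq_one_of_pow_odd_of_pow_two (k := k) hr
      (by rw [← pow_mul, mul_comm, pow_mul]; exact h) (by rw [← pow_mul, mul_comm, pow_mul, hk, one_pow])))
    (fun a ha => eight_dvd_orderOf (hk a) ha)
  omega

theorem two_mul_numCyclicSubgroups_eq [Finite A] {q k : ℕ} (hq : q % 8 = 3)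
    (hk : ∀ a : A, a ^ 2 ^ k = 1) :
    2 * numCyclicSubgroups A =
      powClassCount (powersOf q) (Set.univ : Set A) + cyclicCount {a : A | a ^ 4 = 1} := by
  refine (two_mul_numCyclicSubgroups_le (Nat.odd_iff.2 (by omega)) hk).antisymm ?_
  have hne : ∀ a ∈ {a : A | a ^ 4 = 1}, ∀ b ∈ {a : A | a ^ 4 = 1}ᶜ,
      Subgroup.zpowers a ≠ Subgroup.zpowers b := fun a ha b hb => zpowers_ne_of_pow_four ha hb
  rw [numCyclicSubgroups_eq_cyclicCount, ← Set.union_compl_self {a : A | a ^ 4 = 1},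
    cyclicCount_union hne, powClassCount_union (one_mem_powersOf q) hne]
  have h1 := powClassCount_eq_cyclicCount_of_pow_four (A := A) hq (U := {a : A | a ^ 4 = 1})
    fun a ha => ha
  have h2 := le_two_mul_cyclicCount (A := A) hq (U := {a : A | a ^ 4 = 1}ᶜ) (fun a _ => hk a)
  omega

end

/-! ### Products of four cyclic `2`-groups -/

/-- The embedding of the cyclic group of order `2 ^ m` into the one of order `2 ^ n`. -/
noncomputable def zmodIncl {m n : ℕ} (h : m ≤ n) : ZMod (2 ^ m) →+ ZMod (2 ^ n) :=
  ZMod.lift (2 ^ m) ⟨zmultiplesHom (ZMod (2 ^ n)) (2 ^ (n - m)), by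
    have : ((2 ^ n : ℕ) : ZMod (2 ^ n)) = 0 := ZMod.natCast_self _
    push_cast at this
    simp only [zmultiplesHom_apply, zsmul_eq_mul]
    push_cast
    rw [← pow_add, Nat.add_sub_cancel' h, this]⟩

theorem zmodIncl_natCast {m n : ℕ} (h : m ≤ n) (k : ℕ) :
    zmodIncl h (k : ZMod (2 ^ m)) = ((k * 2 ^ (n - m) : ℕ) : ZMod (2 ^ n)) := by
  have := ZMod.lift_coe (2 ^ m) ⟨zmultiplesHom (ZMod (2 ^ n)) (2 ^ (n - m)), by
    have : ((2 ^ n : ℕ) : ZMod (2 ^ n)) = 0 := ZMod.natCast_self _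
    push_cast at this
    simp only [zmultiplesHom_apply, zsmul_eq_mul]
    push_cast
    rw [← pow_add, Nat.add_sub_cancel' h, this]⟩ (k : ℤ)
  simp only [Int.cast_natCast, zmultiplesHom_apply, zsmul_eq_mul] at this
  rw [zmodIncl, this]
  push_cast
  rfl

theorem zmodIncl_injective {m n : ℕ} (h : m ≤ n) : Function.Injective (zmodIncl h) := by
  rw [injective_iff_map_eq_zero]
  intro a ha
  obtain ⟨k, rfl⟩ : ∃ k : ℕ, (k : ZMod (2 ^ m)) = a := ⟨a.val, ZMod.natCast_zmod_val a⟩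
  rw [zmodIncl_natCast, ZMod.natCast_eq_zero_iff, ← Nat.add_sub_cancel' h, pow_add,
    Nat.add_sub_cancel_left, mul_dvd_mul_iff_right (by positivity)] at ha
  exact (ZMod.natCast_eq_zero_iff _ _).2 ha

theorem exists_zmodIncl_iff {m n : ℕ} (h : m ≤ n) (a : ZMod (2 ^ n)) :
    (∃ b, zmodIncl h b = a) ↔ 2 ^ m • a = 0 := by
  constructor
  · rintro ⟨b, rfl⟩
    rw [← map_nsmul]
    simp
  · intro ha
    obtain ⟨k, rfl⟩ : ∃ k : ℕ, (k : ZMod (2 ^ n)) = a := ⟨a.val, ZMod.natCast_zmod_val a⟩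
    rw [nsmul_eq_mul, ← Nat.cast_mul, ZMod.natCast_eq_zero_iff] at ha
    have : 2 ^ (n - m) ∣ k := by
      rw [← mul_dvd_mul_iff_left (show 2 ^ m ≠ 0 by positivity), ← pow_add,
        Nat.add_sub_cancel' h]
      exact ha
    obtain ⟨l, rfl⟩ := this
    exact ⟨(l : ZMod (2 ^ m)), by rw [zmodIncl_natCast, mul_comm]⟩

/-- Reduction of the cyclic group of order `2 ^ (m + 1)` modulo two. -/
def zmodParity (m : ℕ) : ZMod (2 ^ (m + 1)) →+* ZMod 2 :=
  ZMod.castHom (dvd_pow_self 2 (Nat.succ_ne_zero m)) (ZMod 2)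

theorem exists_zmodIncl_iff_parity {m : ℕ} (a : ZMod (2 ^ (m + 1))) :
    (∃ b, zmodIncl (Nat.le_succ m) b = a) ↔ zmodParity m a = 0 := by
  obtain ⟨k, rfl⟩ : ∃ k : ℕ, (k : ZMod (2 ^ (m + 1))) = a := ⟨a.val, ZMod.natCast_zmod_val a⟩
  rw [exists_zmodIncl_iff, map_natCast, nsmul_eq_mul, ← Nat.cast_mul, ZMod.natCast_eq_zero_iff,
    ZMod.natCast_eq_zero_iff, pow_succ, mul_dvd_mul_iff_left (by positivity)]

/-- The product of four cyclic groups of order `2 ^ a`, `2 ^ b`, `2 ^ c`, `2 ^ d`. -/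
abbrev RankFour (a b c d : ℕ) : Type :=
  Multiplicative (ZMod (2 ^ a)) × Multiplicative (ZMod (2 ^ b)) ×
    Multiplicative (ZMod (2 ^ c)) × Multiplicative (ZMod (2 ^ d))

theorem rankFour_pow_eq_one {a b c d k : ℕ} (ha : a ≤ k) (hb : b ≤ k) (hc : c ≤ k) (hd : d ≤ k)
    (u : RankFour a b c d) : u ^ 2 ^ k = 1 := by
  have key : ∀ {j : ℕ}, j ≤ k → ∀ v : Multiplicative (ZMod (2 ^ j)), v ^ 2 ^ k = 1 := by
    intro j hj v
    apply Multiplicative.toAdd.injective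
    rw [toAdd_pow, toAdd_one, nsmul_eq_mul, (ZMod.natCast_eq_zero_iff _ _).2 (pow_dvd_pow 2 hj),
      zero_mul]
  obtain ⟨u₁, u₂, u₃, u₄⟩ := u
  simp only [Prod.pow_mk, key ha, key hb, key hc, key hd]
  rfl

/-- Elements of order 4 pair off as a and a³ generating the same subgroup, while an element with
square 1 is the only generator of its subgroup. -/
theorem two_mul_numCyclicSubgroups_of_pow_four {A : Type*} [Group A] [Finite A]
    (h : ∀ a : A, a ^ 4 = 1) :
    2 * numCyclicSubgroups A = Nat.card A + {a : A | a * a = 1}.ncard := by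
  -- With the single exponent 1 the power classes are singletons, so the general orbit comparison
  -- counts elements.
  have hone : (1 : ℕ) ∈ ({1} : Set ℕ) := rfl
  have hcls : ∀ a : A, powClass {1} a = {a} := fun a => by simp [powClass]
  have hcount : ∀ U : Set A, powClassCount {1} U = U.ncard := fun U => by
    rw [powClassCount, Set.ncard_image_of_injective]
    intro a b hab
    simpa [hcls] using hab
  have hpow : ∀ a : A, a ^ 2 ^ 2 = 1 := h
  have hz : ∀ a b : A, Subgroup.zpowers a = Subgroup.zpowers b → b = a ∨ b = a ^ 3 := by
    intro a b hab
    obtain ⟨s, hs, rfl⟩ := exists_odd_pow_of_zpowers_eq (hpow a) hab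
    have : s % 4 = 1 ∨ s % 4 = 3 := by
      have := Nat.odd_iff.1 hs; omega
    have h4 : a ^ s = a ^ (s % 4) := pow_eq_pow_mod s (h a)
    rcases this with h | h <;> rw [h4, h] <;> simp
  have h1 : cyclicCount {a : A | a * a = 1} = {a : A | a * a = 1}.ncard := by
    rw [← hcount]
    refine ncard_image_eq_of_forall_iff fun a ha b hb => ⟨fun hab => ?_, fun hab => by
      rw [hcls, hcls, Set.singleton_eq_singleton_iff] at hab; rw [hab]⟩
    rcases hz a b hab with rfl | rfl
    · rfl
    · rw [pow_succ, pow_two, ha.out, one_mul]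
  have h2 : 2 * cyclicCount {a : A | a * a = 1}ᶜ = ({a : A | a * a = 1}ᶜ : Set A).ncard := by
    rw [← hcount]
    apply le_antisymm
    · refine two_mul_cyclicCount_le_powClassCount hone fun a ha =>
        ⟨a ^ 3, fun h3 => ha ?_, (zpowers_pow_odd (hpow a) (by decide)).symm, fun h3 => ha ?_⟩
      · have h3 : a ^ 3 * a ^ 3 = 1 := h3
        rw [← pow_add, pow_eq_pow_mod 6 (h a)] at h3
        change a * a = 1
        rw [← h3, ← pow_two]
      · rw [hcls, hcls, Set.singleton_eq_singleton_iff] at h3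
        change a * a = 1
        rw [pow_succ, pow_two] at h3
        exact mul_eq_right.1 h3.symm
    · refine powClassCount_le_two_mul_cyclicCount hone fun a ha => ⟨a ^ 3, fun c hc hca => ?_⟩
      rcases hz a c hca.symm with rfl | rfl
      · exact Or.inl rfl
      · exact Or.inr rfl
  rw [numCyclicSubgroups_eq_cyclicCount, ← Set.union_compl_self {a : A | a * a = 1},
    cyclicCount_union, mul_add, h2, h1, two_mul, add_assoc, Set.ncard_add_ncard_compl, add_comm]
  intro a ha b hb hab
  apply hb
  obtain ⟨s, hs⟩ := Subgroup.mem_zpowers_iff.1 (hab ▸ Subgroup.mem_zpowers b : b ∈ _)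
  change b * b = 1
  have ha : a * a = 1 := ha
  rw [← hs, ← zpow_add, ← two_mul, zpow_mul, zpow_two, ha, one_zpow]

/-- Of the 256 elements, 16 have square 1, and (256 + 16)/2 = 136. -/
theorem numCyclicSubgroups_rankFour_two : numCyclicSubgroups (RankFour 2 2 2 2) = 136 := by
  have h := two_mul_numCyclicSubgroups_of_pow_four (A := RankFour 2 2 2 2)
    (rankFour_pow_eq_one (k := 2) le_rfl le_rfl le_rfl le_rfl)
  have h1 : Nat.card (RankFour 2 2 2 2) = 256 := by
    simp only [Nat.card_prod, Nat.card_congr Multiplicative.toAdd, Nat.card_zmod]; norm_num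
  have h2 : {a : RankFour 2 2 2 2 | a * a = 1}.ncard = 16 := by
    -- The modulus 2 ^ 2 is replaced by the definitionally equal literal 4, for which the
    -- enumeration can be evaluated.
    have : {a : Multiplicative (ZMod 4) × Multiplicative (ZMod 4) × Multiplicative (ZMod 4) ×
        Multiplicative (ZMod 4) | a * a = 1}.ncard = 16 := by
      rw [Set.ncard_eq_toFinset_card']
      decide +kernel
    exact this
  omega

/-- The product of four homomorphisms of additive groups, written multiplicatively. -/
def rankFourMap {a b c d a' b' c' d' : ℕ} (f₁ : ZMod (2 ^ a) →+ ZMod (2 ^ a'))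
    (f₂ : ZMod (2 ^ b) →+ ZMod (2 ^ b')) (f₃ : ZMod (2 ^ c) →+ ZMod (2 ^ c'))
    (f₄ : ZMod (2 ^ d) →+ ZMod (2 ^ d')) : RankFour a b c d →* RankFour a' b' c' d' :=
  (f₁.toMultiplicative).prodMap ((f₂.toMultiplicative).prodMap
    ((f₃.toMultiplicative).prodMap (f₄.toMultiplicative)))

theorem rankFourMap_injective {a b c d a' b' c' d' : ℕ} {f₁ : ZMod (2 ^ a) →+ ZMod (2 ^ a')}
    {f₂ : ZMod (2 ^ b) →+ ZMod (2 ^ b')} {f₃ : ZMod (2 ^ c) →+ ZMod (2 ^ c')}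
    {f₄ : ZMod (2 ^ d) →+ ZMod (2 ^ d')} (h₁ : Function.Injective f₁) (h₂ : Function.Injective f₂)
    (h₃ : Function.Injective f₃) (h₄ : Function.Injective f₄) :
    Function.Injective (rankFourMap f₁ f₂ f₃ f₄) :=
  h₁.prodMap (h₂.prodMap (h₃.prodMap h₄))

theorem mem_range_rankFourMap {a b c d a' b' c' d' : ℕ} {f₁ : ZMod (2 ^ a) →+ ZMod (2 ^ a')}
    {f₂ : ZMod (2 ^ b) →+ ZMod (2 ^ b')} {f₃ : ZMod (2 ^ c) →+ ZMod (2 ^ c')}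
    {f₄ : ZMod (2 ^ d) →+ ZMod (2 ^ d')} {u : RankFour a' b' c' d'} :
    u ∈ Set.range (rankFourMap f₁ f₂ f₃ f₄) ↔ (∃ v, f₁ v = u.1.toAdd) ∧
      (∃ v, f₂ v = u.2.1.toAdd) ∧ (∃ v, f₃ v = u.2.2.1.toAdd) ∧ ∃ v, f₄ v = u.2.2.2.toAdd := by
  constructor
  · rintro ⟨⟨v₁, v₂, v₃, v₄⟩, rfl⟩
    exact ⟨⟨v₁, rfl⟩, ⟨v₂, rfl⟩, ⟨v₃, rfl⟩, ⟨v₄, rfl⟩⟩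
  · obtain ⟨u₁, u₂, u₃, u₄⟩ := u
    rintro ⟨⟨v₁, h₁⟩, ⟨v₂, h₂⟩, ⟨v₃, h₃⟩, ⟨v₄, h₄⟩⟩
    exact ⟨(.ofAdd v₁, .ofAdd v₂, .ofAdd v₃, .ofAdd v₄), by
      simp only [rankFourMap, MonoidHom.coe_prodMap, Prod.map_apply]
      exact Prod.ext h₁ (Prod.ext h₂ (Prod.ext h₃ h₄))⟩

/-- When every factor has order at least 4, the solutions of u⁴ = 1 form a copy of C₄⁴, whatever the
exponents are. -/
theorem cyclicCount_rankFour_pow_four {a b c d : ℕ} (ha : 2 ≤ a) (hb : 2 ≤ b) (hc : 2 ≤ c)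
    (hd : 2 ≤ d) : cyclicCount {u : RankFour a b c d | u ^ 4 = 1} = 136 := by
  rw [← numCyclicSubgroups_rankFour_two, numCyclicSubgroups_eq_cyclicCount_range
    (rankFourMap (zmodIncl ha) (zmodIncl hb) (zmodIncl hc) (zmodIncl hd))
    (rankFourMap_injective (zmodIncl_injective _) (zmodIncl_injective _) (zmodIncl_injective _)
      (zmodIncl_injective _))]
  congr 1
  ext u
  rw [mem_range_rankFourMap, exists_zmodIncl_iff, exists_zmodIncl_iff, exists_zmodIncl_iff,
    exists_zmodIncl_iff]
  simp only [Set.mem_ofPred_eq, Prod.ext_iff]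
  rfl

theorem rankFourCount_eq (a b c d : ℕ) :
    rankFourCount a b c d = numCyclicSubgroups (RankFour a b c d) := rfl

theorem cyclicCount_parity_both (a m₂ m₃ d : ℕ) :
    cyclicCount {u : RankFour a (m₂ + 1) (m₃ + 1) d |
      zmodParity m₂ u.2.1.toAdd = 0 ∧ zmodParity m₃ u.2.2.1.toAdd = 0} =
      rankFourCount a m₂ m₃ d := by
  rw [rankFourCount_eq, numCyclicSubgroups_eq_cyclicCount_range
    (rankFourMap (AddMonoidHom.id _) (zmodIncl (Nat.le_succ m₂)) (zmodIncl (Nat.le_succ m₃))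
      (AddMonoidHom.id _)) (rankFourMap_injective Function.injective_id (zmodIncl_injective _)
        (zmodIncl_injective _) Function.injective_id)]
  congr 1
  ext u
  rw [mem_range_rankFourMap, exists_zmodIncl_iff_parity, exists_zmodIncl_iff_parity]
  simp

theorem cyclicCount_parity_right (a m₂ m₃ d : ℕ) :
    cyclicCount {u : RankFour a (m₂ + 1) (m₃ + 1) d | zmodParity m₃ u.2.2.1.toAdd = 0} =
      rankFourCount a (m₂ + 1) m₃ d := by
  rw [rankFourCount_eq, numCyclicSubgroups_eq_cyclicCount_range
    (rankFourMap (AddMonoidHom.id _) (AddMonoidHom.id _) (zmodIncl (Nat.le_succ m₃))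
      (AddMonoidHom.id _)) (rankFourMap_injective Function.injective_id Function.injective_id
        (zmodIncl_injective _) Function.injective_id)]
  congr 1
  ext u
  rw [mem_range_rankFourMap, exists_zmodIncl_iff_parity]
  simp

theorem cyclicCount_parity_left (a m₂ m₃ d : ℕ) :
    cyclicCount {u : RankFour a (m₂ + 1) (m₃ + 1) d | zmodParity m₂ u.2.1.toAdd = 0} =
      rankFourCount a m₂ (m₃ + 1) d := by
  rw [rankFourCount_eq, numCyclicSubgroups_eq_cyclicCount_range
    (rankFourMap (AddMonoidHom.id _) (zmodIncl (Nat.le_succ m₂)) (AddMonoidHom.id _)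
      (AddMonoidHom.id _)) (rankFourMap_injective Function.injective_id (zmodIncl_injective _)
        Function.injective_id Function.injective_id)]
  congr 1
  ext u
  rw [mem_range_rankFourMap, exists_zmodIncl_iff_parity]
  simp

/-- The homomorphism `(u, v) ↦ (u, u + 2 v)`, whose image is given by a parity condition. -/
noncomputable def diagonalShift {m₂ m₃ : ℕ} (h : m₃ ≤ m₂) :
    ZMod (2 ^ (m₂ + 1)) × ZMod (2 ^ m₃) →+ ZMod (2 ^ (m₂ + 1)) × ZMod (2 ^ (m₃ + 1)) :=
  (AddMonoidHom.fst _ _).prod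
    (((ZMod.castHom (pow_dvd_pow 2 (Nat.succ_le_succ h)) (ZMod (2 ^ (m₃ + 1)))).toAddMonoidHom.comp
      (AddMonoidHom.fst _ _)) + (zmodIncl (Nat.le_succ m₃)).comp (AddMonoidHom.snd _ _))

theorem diagonalShift_injective {m₂ m₃ : ℕ} (h : m₃ ≤ m₂) :
    Function.Injective (diagonalShift h) := by
  rintro ⟨u, v⟩ ⟨u', v'⟩ he
  simp only [diagonalShift, AddMonoidHom.prod_apply, Prod.mk.injEq, AddMonoidHom.add_apply,
    AddMonoidHom.comp_apply, AddMonoidHom.coe_fst, AddMonoidHom.coe_snd] at he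
  obtain ⟨rfl, he⟩ := he
  rw [add_right_inj] at he
  rw [zmodIncl_injective _ he]

theorem exists_diagonalShift_iff {m₂ m₃ : ℕ} (h : m₃ ≤ m₂) (u : ZMod (2 ^ (m₂ + 1)))
    (v : ZMod (2 ^ (m₃ + 1))) :
    (∃ w, diagonalShift h w = (u, v)) ↔ zmodParity m₂ u = zmodParity m₃ v := by
  have hp : zmodParity m₃ (ZMod.castHom (pow_dvd_pow 2 (Nat.succ_le_succ h))
      (ZMod (2 ^ (m₃ + 1))) u) = zmodParity m₂ u := by
    rw [← RingHom.comp_apply]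
    congr 1
    exact Subsingleton.elim _ _
  constructor
  · rintro ⟨⟨u', v'⟩, he⟩
    simp only [diagonalShift, AddMonoidHom.prod_apply, Prod.mk.injEq, AddMonoidHom.add_apply,
      AddMonoidHom.comp_apply, AddMonoidHom.coe_fst, AddMonoidHom.coe_snd] at he
    obtain ⟨rfl, rfl⟩ := he
    rw [map_add, (exists_zmodIncl_iff_parity _).1 ⟨v', rfl⟩, add_zero]
    exact hp.symm
  · intro he
    obtain ⟨w, hw⟩ := (exists_zmodIncl_iff_parity (v - ZMod.castHom (pow_dvd_pow 2
      (Nat.succ_le_succ h)) (ZMod (2 ^ (m₃ + 1))) u)).2 (by rw [map_sub, hp, he, sub_self])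
    refine ⟨(u, w), ?_⟩
    simp only [diagonalShift, AddMonoidHom.prod_apply, Prod.mk.injEq, AddMonoidHom.add_apply,
      AddMonoidHom.comp_apply, AddMonoidHom.coe_fst, AddMonoidHom.coe_snd, true_and]
    rw [hw]
    exact add_sub_cancel _ _

/-- The pairs of equal parity form the direct product of the groups generated by (1, 1) and (0, 2).
The first has order 2^(m₂+1) because m₃ ≤ m₂, and the second has order 2^m₃. -/
theorem cyclicCount_parity_eq_of_le {m₂ m₃ : ℕ} (a d : ℕ) (h : m₃ ≤ m₂) :
    cyclicCount {u : RankFour a (m₂ + 1) (m₃ + 1) d |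
      zmodParity m₂ u.2.1.toAdd = zmodParity m₃ u.2.2.1.toAdd} =
      rankFourCount a (m₂ + 1) m₃ d := by
  let F : RankFour a (m₂ + 1) m₃ d → RankFour a (m₂ + 1) (m₃ + 1) d := fun u =>
    (u.1, .ofAdd (diagonalShift h (u.2.1.toAdd, u.2.2.1.toAdd)).1,
      .ofAdd (diagonalShift h (u.2.1.toAdd, u.2.2.1.toAdd)).2, u.2.2.2)
  let f : RankFour a (m₂ + 1) m₃ d →* RankFour a (m₂ + 1) (m₃ + 1) d := MonoidHom.mk' F
    fun u v => by
      have := map_add (diagonalShift h) (u.2.1.toAdd, u.2.2.1.toAdd) (v.2.1.toAdd, v.2.2.1.toAdd)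
      refine Prod.ext rfl (Prod.ext ?_ (Prod.ext ?_ rfl))
      · exact congrArg (fun w => Multiplicative.ofAdd w.1) this
      · exact congrArg (fun w => Multiplicative.ofAdd w.2) this
  have hf : Function.Injective f := by
    rintro ⟨u₁, u₂, u₃, u₄⟩ ⟨v₁, v₂, v₃, v₄⟩ he
    have h1 : u₁ = v₁ := congrArg (fun w => w.1) he
    have h4 : u₄ = v₄ := congrArg (fun w => w.2.2.2) he
    have h23 := diagonalShift_injective h (a₁ := (u₂.toAdd, u₃.toAdd)) (a₂ := (v₂.toAdd, v₃.toAdd))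
      (Prod.ext (congrArg (fun w => w.2.1.toAdd) he) (congrArg (fun w => w.2.2.1.toAdd) he))
    have h2 : u₂ = v₂ := congrArg Prod.fst h23
    have h3 : u₃ = v₃ := congrArg Prod.snd h23
    rw [h1, h2, h3, h4]
  rw [rankFourCount_eq, numCyclicSubgroups_eq_cyclicCount_range f hf]
  congr 1
  ext u
  rw [Set.mem_ofPred_eq, ← exists_diagonalShift_iff h]
  constructor
  · rintro ⟨w, hw⟩
    exact ⟨(u.1, .ofAdd w.1, .ofAdd w.2, u.2.2.2), Prod.ext rfl (Prod.ext
      (congrArg Prod.fst hw :) (Prod.ext (congrArg Prod.snd hw :) rfl))⟩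
  · rintro ⟨w, rfl⟩
    exact ⟨(w.2.1.toAdd, w.2.2.1.toAdd), rfl⟩

/-- Interchange of the two middle factors. -/
def rankFourSwap (a b c d : ℕ) : RankFour a b c d ≃* RankFour a c b d where
  toFun u := (u.1, u.2.2.1, u.2.1, u.2.2.2)
  invFun u := (u.1, u.2.2.1, u.2.1, u.2.2.2)
  left_inv _ := rfl
  right_inv _ := rfl
  map_mul' _ _ := rfl

theorem cyclicCount_parity_eq (a m₂ m₃ d : ℕ) :
    cyclicCount {u : RankFour a (m₂ + 1) (m₃ + 1) d |
      zmodParity m₂ u.2.1.toAdd = zmodParity m₃ u.2.2.1.toAdd} =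
      rankFourCount a (max m₂ m₃ + 1) (min m₂ m₃) d := by
  rcases le_total m₃ m₂ with h | h
  · rw [max_eq_left h, min_eq_right h, cyclicCount_parity_eq_of_le a d h]
  · rw [max_eq_right h, min_eq_left h, ← cyclicCount_parity_eq_of_le a d h,
      ← cyclicCount_image (rankFourSwap a (m₂ + 1) (m₃ + 1) d).toMonoidHom
        (rankFourSwap a (m₂ + 1) (m₃ + 1) d).injective]
    congr 1
    ext u
    constructor
    · rintro ⟨w, hw, rfl⟩
      exact Eq.symm hw
    · intro hu
      exact ⟨(u.1, u.2.2.1, u.2.1, u.2.2.2), Eq.symm hu, rfl⟩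

/-! ### A model of the groups of type `D₅` -/

/-- Triples `(t, x, y)` standing for `t₁ ^ t * x ^ x * y ^ y`. -/
@[ext]
structure D5Model (n₁ m₂ m₃ : ℕ) where
  t : ZMod (2 ^ (n₁ + 1))
  x : ZMod (2 ^ (m₂ + 1))
  y : ZMod (2 ^ (m₃ + 1))

/-- The embedding of the group of order two into a cyclic `2`-group. -/
noncomputable def zmodHalf (n : ℕ) : ZMod 2 →+ ZMod (2 ^ (n + 1)) :=
  zmodIncl (m := 1) (Nat.le_add_left 1 n)

theorem zmodHalf_injective (n : ℕ) : Function.Injective (zmodHalf n) := zmodIncl_injective _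

theorem zmodHalf_one (n : ℕ) : zmodHalf n 1 = 2 ^ n := by
  have := zmodIncl_natCast (Nat.le_add_left 1 n) 1
  simp only [Nat.cast_one, one_mul, Nat.add_sub_cancel, Nat.cast_pow, Nat.cast_ofNat] at this
  exact this

namespace D5Model

variable {n₁ m₂ m₃ : ℕ}

/-- Moving y^b past x^a costs the factor z^(ab), and z = t₁^(2^n₁) has order two, so only the
parities of a and b matter. The correction is bilinear, which yields associativity. Here n₁ stands
for m₁ - 1, so no truncated subtraction enters. -/
noncomputable instance : Mul (D5Model n₁ m₂ m₃) where
  mul g h := ⟨g.t + h.t + zmodHalf n₁ (zmodParity m₃ g.y * zmodParity m₂ h.x), g.x + h.x, g.y + h.y⟩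

instance : One (D5Model n₁ m₂ m₃) where
  one := ⟨0, 0, 0⟩

noncomputable instance : Inv (D5Model n₁ m₂ m₃) where
  inv g := ⟨-g.t + zmodHalf n₁ (zmodParity m₃ g.y * zmodParity m₂ g.x), -g.x, -g.y⟩

@[simp] theorem mul_t (g h : D5Model n₁ m₂ m₃) :
    (g * h).t = g.t + h.t + zmodHalf n₁ (zmodParity m₃ g.y * zmodParity m₂ h.x) := rfl
@[simp] theorem mul_x (g h : D5Model n₁ m₂ m₃) : (g * h).x = g.x + h.x := rfl
@[simp] theorem mul_y (g h : D5Model n₁ m₂ m₃) : (g * h).y = g.y + h.y := rfl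
@[simp] theorem one_t : (1 : D5Model n₁ m₂ m₃).t = 0 := rfl
@[simp] theorem one_x : (1 : D5Model n₁ m₂ m₃).x = 0 := rfl
@[simp] theorem one_y : (1 : D5Model n₁ m₂ m₃).y = 0 := rfl
@[simp] theorem inv_t (g : D5Model n₁ m₂ m₃) :
    g⁻¹.t = -g.t + zmodHalf n₁ (zmodParity m₃ g.y * zmodParity m₂ g.x) := rfl
@[simp] theorem inv_x (g : D5Model n₁ m₂ m₃) : g⁻¹.x = -g.x := rfl
@[simp] theorem inv_y (g : D5Model n₁ m₂ m₃) : g⁻¹.y = -g.y := rfl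

noncomputable instance : Group (D5Model n₁ m₂ m₃) :=
  Group.ofLeftAxioms
    (fun g h k => by
      ext
      · simp only [mul_t, mul_x, mul_y, map_add, add_mul, mul_add]; abel
      · simp [add_assoc]
      · simp [add_assoc])
    (fun g => by ext <;> simp)
    (fun g => by
      ext
      · simp only [mul_t, inv_t, inv_y, map_neg, neg_mul, one_t]; abel
      · simp
      · simp)

theorem pow_eq_of_x (g : D5Model n₁ m₂ m₃) (hg : g.y = 0) (k : ℕ) :
    g ^ k = ⟨k • g.t, k • g.x, 0⟩ := by
  induction k with
  | zero => ext <;> simp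
  | succ k ih => rw [pow_succ, ih]; ext <;> simp [add_mul, hg]

theorem pow_eq_of_y (g : D5Model n₁ m₂ m₃) (hg : g.x = 0) (k : ℕ) :
    g ^ k = ⟨k • g.t, 0, k • g.y⟩ := by
  induction k with
  | zero => ext <;> simp
  | succ k ih => rw [pow_succ, ih]; ext <;> simp [add_mul, hg]

/-- Commuting with y tests the parity of the exponent of x, and commuting with x that of y. -/
theorem mem_center_iff (g : D5Model n₁ m₂ m₃) :
    g ∈ Subgroup.center (D5Model n₁ m₂ m₃) ↔ zmodParity m₂ g.x = 0 ∧ zmodParity m₃ g.y = 0 := by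
  rw [Subgroup.mem_center_iff]
  constructor
  · intro h
    constructor
    · have := congrArg D5Model.t (h ⟨0, 0, 1⟩)
      simp only [mul_t, map_one, map_zero, one_mul, mul_zero, zero_add, add_zero] at this
      exact zmodHalf_injective n₁ (by rw [map_zero]; exact add_eq_left.1 this)
    · have := congrArg D5Model.t (h ⟨0, 1, 0⟩)
      simp only [mul_t, map_one, map_zero, mul_one, zero_mul, zero_add, add_zero] at this
      exact zmodHalf_injective n₁ (by rw [map_zero]; exact add_eq_left.1 this.symm)
  · rintro ⟨h₂, h₃⟩ k
    ext
    · simp [h₂, h₃, add_comm]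
    · simp [add_comm]
    · simp [add_comm]

/-- The homomorphism from the presented group to the model, on generators. -/
def genImage (n₁ m₂ m₃ : ℕ) : D5Gen → D5Model n₁ m₂ m₃
  | .x => ⟨0, 1, 0⟩
  | .y => ⟨0, 0, 1⟩
  | .t₁ => ⟨1, 0, 0⟩
  | .t₂ => ⟨0, 2, 0⟩
  | .t₃ => ⟨0, 0, 2⟩

theorem natCast_two_pow_eq_zero (m : ℕ) : (2 : ZMod (2 ^ m)) ^ m = 0 := by
  have := ZMod.natCast_self (2 ^ m)
  push_cast at this
  exact this

theorem genImage_central (t : D5Gen) (ht : t = .t₁ ∨ t = .t₂ ∨ t = .t₃) :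
    genImage n₁ m₂ m₃ t ∈ Subgroup.center (D5Model n₁ m₂ m₃) := by
  have h2 : ∀ m, zmodParity m 2 = 0 := fun m => map_ofNat (zmodParity m) 2
  rw [mem_center_iff]
  rcases ht with rfl | rfl | rfl <;> simp [genImage, h2]

theorem lift_genImage_eq_one (r : FreeGroup D5Gen) (hr : r ∈ d5Rels (n₁ + 1) m₂ m₃) :
    FreeGroup.lift (genImage n₁ m₂ m₃) r = 1 := by
  have hc : ∀ t g, (t = D5Gen.t₁ ∨ t = .t₂ ∨ t = .t₃) → FreeGroup.lift (genImage n₁ m₂ m₃)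
      (FreeGroup.of t * FreeGroup.of g * (FreeGroup.of t)⁻¹ * (FreeGroup.of g)⁻¹) = 1 := by
    intro t g ht
    have := Subgroup.mem_center_iff.1 (genImage_central (n₁ := n₁) (m₂ := m₂) (m₃ := m₃) t ht)
      (genImage n₁ m₂ m₃ g)
    simp only [map_mul, map_inv, FreeGroup.lift_apply_of]
    rw [← this]
    group
  rcases hr with hr | ⟨t, ht, g, rfl⟩
  · simp only [Set.mem_insert_iff, Set.mem_singleton_iff] at hr
    rcases hr with rfl | rfl | rfl | rfl | rfl | rfl
    · rw [map_pow, FreeGroup.lift_apply_of, pow_eq_of_x _ rfl]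
      ext <;> simp [genImage]
    · rw [map_pow, FreeGroup.lift_apply_of, pow_eq_of_x _ rfl]
      ext <;> simp [genImage, ← pow_succ, natCast_two_pow_eq_zero]
    · rw [map_pow, FreeGroup.lift_apply_of, pow_eq_of_y _ rfl]
      ext <;> simp [genImage, ← pow_succ, natCast_two_pow_eq_zero]
    · rw [map_mul, map_inv, map_pow, FreeGroup.lift_apply_of, FreeGroup.lift_apply_of,
        mul_inv_eq_one, pow_eq_of_x _ rfl]
      ext <;> simp [genImage]
    · rw [map_mul, map_inv, map_pow, FreeGroup.lift_apply_of, FreeGroup.lift_apply_of,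
        mul_inv_eq_one, pow_eq_of_y _ rfl]
      ext <;> simp [genImage]
    · simp only [map_mul, map_inv, map_pow, FreeGroup.lift_apply_of]
      rw [mul_inv_eq_one, mul_assoc, ← mul_inv_rev, inv_mul_eq_iff_eq_mul, pow_eq_of_x _ rfl]
      have h := zmodHalf_one n₁
      have h0 : zmodHalf n₁ 1 + zmodHalf n₁ 1 = 0 := by
        rw [← map_add]; exact map_zero _
      ext <;> simp [genImage, ← h, h0]
  · simp only [Set.mem_insert_iff, Set.mem_singleton_iff] at ht
    rcases ht with rfl | rfl | rfl <;> exact hc _ g (by simp)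

/-- The homomorphism from the presented group to the model. -/
noncomputable def ofPresented (n₁ m₂ m₃ : ℕ) : D5Group (n₁ + 1) m₂ m₃ →* D5Model n₁ m₂ m₃ :=
  PresentedGroup.toGroup lift_genImage_eq_one

theorem ofPresented_of (g : D5Gen) :
    ofPresented n₁ m₂ m₃ (PresentedGroup.of g) = genImage n₁ m₂ m₃ g :=
  PresentedGroup.toGroup.of _

end D5Model

/-! ### Normal forms in the presented group -/

/-- Since Y X = T^(-N) X Y with T central, the products T^a X^b Y^c are stable under left
multiplication by the generators and their inverses. This bounds the presented group from above; the
model bounds it from below. -/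
theorem exists_normalForm_of_mul_closed {Γ : Type*} [Group Γ] {X Y T : Γ} {N : ℕ}
    (hT : ∀ g, T * g = g * T) (hXY : X⁻¹ * Y⁻¹ * X * Y = T ^ N)
    {s : Set Γ} (hs : ∀ g ∈ s, g = X ∨ g = Y ∨ g = T ∨ g = X ^ 2 ∨ g = Y ^ 2)
    (htop : Subgroup.closure s = ⊤) (g : Γ) : ∃ a b c : ℤ, g = T ^ a * X ^ b * Y ^ c := by
  have hTc : ∀ (a : ℤ) (g : Γ), g * T ^ a = T ^ a * g := fun a g =>
    (Commute.zpow_left (hT g : Commute T g) a).eq.symm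
  have hz : X * Y = Y * X * T ^ N := by
    rw [← hXY]; group
  have hY : ∀ b : ℤ, Y * X ^ b = T ^ (-(N * b)) * X ^ b * Y := by
    intro b
    have h1 : SemiconjBy Y X (T ^ (-(N : ℤ)) * X) := by
      change Y * X = T ^ (-(N : ℤ)) * X * Y
      rw [mul_assoc, hz, ← zpow_natCast T N, hTc, ← mul_assoc, ← zpow_add, neg_add_cancel, zpow_zero,
        one_mul]
    have h2 := (h1.zpow_right b).eq
    rwa [Commute.mul_zpow (hTc _ X).symm, ← zpow_mul, neg_mul] at h2
  have hY' : ∀ b : ℤ, Y⁻¹ * X ^ b = T ^ (N * b) * X ^ b * Y⁻¹ := by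
    intro b
    have h1 := hY b
    rw [inv_mul_eq_iff_eq_mul, ← mul_assoc, ← mul_assoc, hTc, mul_assoc (T ^ _) Y, h1, ← mul_assoc,
      ← mul_assoc, ← zpow_add, add_neg_cancel, zpow_zero, one_mul, mul_assoc, mul_inv_cancel,
      mul_one]
  have stepX : ∀ (n : ℤ) (h : Γ), (∃ a b c : ℤ, h = T ^ a * X ^ b * Y ^ c) →
      ∃ a b c : ℤ, X ^ n * h = T ^ a * X ^ b * Y ^ c := by
    rintro n _ ⟨a, b, c, rfl⟩
    refine ⟨a, n + b, c, ?_⟩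
    rw [← mul_assoc, ← mul_assoc, hTc, mul_assoc (T ^ a), ← zpow_add]
  have stepT : ∀ (n : ℤ) (h : Γ), (∃ a b c : ℤ, h = T ^ a * X ^ b * Y ^ c) →
      ∃ a b c : ℤ, T ^ n * h = T ^ a * X ^ b * Y ^ c := by
    rintro n _ ⟨a, b, c, rfl⟩
    refine ⟨n + a, b, c, ?_⟩
    rw [← mul_assoc, ← mul_assoc, ← zpow_add]
  have stepY : ∀ h : Γ, (∃ a b c : ℤ, h = T ^ a * X ^ b * Y ^ c) →
      ∃ a b c : ℤ, Y * h = T ^ a * X ^ b * Y ^ c := by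
    rintro _ ⟨a, b, c, rfl⟩
    refine ⟨a + -(N * b), b, 1 + c, ?_⟩
    rw [← mul_assoc, ← mul_assoc, hTc, mul_assoc (T ^ a), hY, ← mul_assoc, ← mul_assoc, ← zpow_add,
      mul_assoc (_ * _), ← zpow_one_add]
  have stepY' : ∀ h : Γ, (∃ a b c : ℤ, h = T ^ a * X ^ b * Y ^ c) →
      ∃ a b c : ℤ, Y⁻¹ * h = T ^ a * X ^ b * Y ^ c := by
    rintro _ ⟨a, b, c, rfl⟩
    refine ⟨a + N * b, b, -1 + c, ?_⟩
    rw [← mul_assoc, ← mul_assoc, hTc, mul_assoc (T ^ a), hY', ← mul_assoc, ← mul_assoc, ← zpow_add,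
      mul_assoc (_ * _), zpow_add Y, zpow_neg_one]
  have hg : g ∈ Subgroup.closure s := htop ▸ Subgroup.mem_top g
  induction hg using Subgroup.closure_induction_left with
  | one => exact ⟨0, 0, 0, by simp⟩
  | mul_left r hr h _ ih =>
    rcases hs r hr with rfl | rfl | rfl | rfl | rfl
    · simpa using stepX 1 h ih
    · exact stepY h ih
    · simpa using stepT 1 h ih
    · exact_mod_cast stepX 2 h ih
    · rw [pow_two, mul_assoc]; exact stepY _ (stepY h ih)
  | inv_mul_cancel r hr h _ ih =>
    rcases hs r hr with rfl | rfl | rfl | rfl | rfl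
    · simpa using stepX (-1) h ih
    · exact stepY' h ih
    · simpa using stepT (-1) h ih
    · simpa [zpow_neg] using stepX (-2) h ih
    · rw [pow_two, mul_inv_rev, mul_assoc]; exact stepY' _ (stepY' h ih)

namespace D5Model

variable {n₁ m₂ m₃ : ℕ}

section Relations

variable (n₁ m₂ m₃)

/-- The generators of the presented group. -/
abbrev gen (g : D5Gen) : D5Group (n₁ + 1) m₂ m₃ := PresentedGroup.of g

theorem mk_eq_one {r : FreeGroup D5Gen} (hr : r ∈ d5Rels (n₁ + 1) m₂ m₃) :
    PresentedGroup.mk (d5Rels (n₁ + 1) m₂ m₃) r = 1 :=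
  PresentedGroup.one_of_mem hr

theorem gen_t₁_pow : gen n₁ m₂ m₃ .t₁ ^ 2 ^ (n₁ + 1) = 1 :=
  mk_eq_one n₁ m₂ m₃ (r := FreeGroup.of D5Gen.t₁ ^ 2 ^ (n₁ + 1)) (Or.inl (by simp))

theorem gen_t₂_pow : gen n₁ m₂ m₃ .t₂ ^ 2 ^ m₂ = 1 :=
  mk_eq_one n₁ m₂ m₃ (r := FreeGroup.of D5Gen.t₂ ^ 2 ^ m₂) (Or.inl (by simp))

theorem gen_t₃_pow : gen n₁ m₂ m₃ .t₃ ^ 2 ^ m₃ = 1 :=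
  mk_eq_one n₁ m₂ m₃ (r := FreeGroup.of D5Gen.t₃ ^ 2 ^ m₃) (Or.inl (by simp))

theorem gen_x_sq : gen n₁ m₂ m₃ .x ^ 2 = gen n₁ m₂ m₃ .t₂ :=
  mul_inv_eq_one.1 (mk_eq_one n₁ m₂ m₃ (r := FreeGroup.of D5Gen.x ^ 2 * (FreeGroup.of D5Gen.t₂)⁻¹)
    (Or.inl (by simp)))

theorem gen_y_sq : gen n₁ m₂ m₃ .y ^ 2 = gen n₁ m₂ m₃ .t₃ :=
  mul_inv_eq_one.1 (mk_eq_one n₁ m₂ m₃ (r := FreeGroup.of D5Gen.y ^ 2 * (FreeGroup.of D5Gen.t₃)⁻¹)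
    (Or.inl (by simp)))

theorem gen_commutator : (gen n₁ m₂ m₃ .x)⁻¹ * (gen n₁ m₂ m₃ .y)⁻¹ * gen n₁ m₂ m₃ .x *
    gen n₁ m₂ m₃ .y = gen n₁ m₂ m₃ .t₁ ^ 2 ^ n₁ :=
  mul_inv_eq_one.1 (mk_eq_one n₁ m₂ m₃ (r := (FreeGroup.of D5Gen.x)⁻¹ * (FreeGroup.of D5Gen.y)⁻¹ *
    FreeGroup.of D5Gen.x * FreeGroup.of D5Gen.y * (FreeGroup.of D5Gen.t₁ ^ 2 ^ n₁)⁻¹)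
    (Or.inl (by simp)))

theorem gen_t₁_comm (g : D5Group (n₁ + 1) m₂ m₃) :
    gen n₁ m₂ m₃ .t₁ * g = g * gen n₁ m₂ m₃ .t₁ := by
  have key : ∀ g : D5Gen, gen n₁ m₂ m₃ .t₁ * gen n₁ m₂ m₃ g =
      gen n₁ m₂ m₃ g * gen n₁ m₂ m₃ .t₁ := fun g =>
    mul_inv_eq_iff_eq_mul.1 (mul_inv_eq_one.1 (mk_eq_one n₁ m₂ m₃
      (r := FreeGroup.of D5Gen.t₁ * FreeGroup.of g * (FreeGroup.of D5Gen.t₁)⁻¹ *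
        (FreeGroup.of g)⁻¹) (Or.inr ⟨_, by simp, g, rfl⟩)))
  have hle : Subgroup.closure (Set.range (PresentedGroup.of (rels := d5Rels (n₁ + 1) m₂ m₃))) ≤
      Subgroup.centralizer {gen n₁ m₂ m₃ .t₁} := by
    rw [Subgroup.closure_le]
    rintro _ ⟨g, rfl⟩
    exact Subgroup.mem_centralizer_singleton_iff.2 (key g).symm
  rw [PresentedGroup.closure_range_of] at hle
  exact (Subgroup.mem_centralizer_singleton_iff.1 (hle (Subgroup.mem_top g))).symm

end Relations

/-- The normal form t₁^a x^b y^c is sent to the triple (a, b, c). If that is trivial, the exponents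
are multiples of 2^(n₁+1), 2^(m₂+1), 2^(m₃+1), and these powers of the generators are already
trivial in the presented group. -/
theorem ofPresented_injective : Function.Injective (ofPresented n₁ m₂ m₃) := by
  rw [injective_iff_map_eq_one]
  intro g hg
  obtain ⟨a, b, c, rfl⟩ := exists_normalForm_of_mul_closed (gen_t₁_comm n₁ m₂ m₃)
    (gen_commutator n₁ m₂ m₃) (s := Set.range PresentedGroup.of)
    (by
      rintro _ ⟨g, rfl⟩
      cases g
      · exact Or.inl rfl
      · exact Or.inr (Or.inl rfl)
      · exact Or.inr (Or.inr (Or.inl rfl))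
      · exact Or.inr (Or.inr (Or.inr (Or.inl (gen_x_sq n₁ m₂ m₃).symm)))
      · exact Or.inr (Or.inr (Or.inr (Or.inr (gen_y_sq n₁ m₂ m₃).symm))))
    (PresentedGroup.closure_range_of _) g
  have hT : gen n₁ m₂ m₃ .t₁ ^ 2 ^ (n₁ + 1) = 1 := gen_t₁_pow n₁ m₂ m₃
  have hX : gen n₁ m₂ m₃ .x ^ 2 ^ (m₂ + 1) = 1 := by
    rw [pow_succ', pow_mul, gen_x_sq, gen_t₂_pow]
  have hY : gen n₁ m₂ m₃ .y ^ 2 ^ (m₃ + 1) = 1 := by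
    rw [pow_succ', pow_mul, gen_y_sq, gen_t₃_pow]
  have red : ∀ {w : D5Group (n₁ + 1) m₂ m₃} {m : ℕ} (a : ℤ), w ^ 2 ^ m = 1 →
      ∃ k : ℕ, w ^ a = w ^ k := by
    intro w m a hw
    obtain ⟨k, hk⟩ := (isOfFinOrder_iff_pow_eq_one.2 ⟨2 ^ m, by positivity,
      hw⟩).mem_powers_iff_mem_zpowers.2 (Subgroup.zpow_mem_zpowers w a)
    exact ⟨k, hk.symm⟩
  obtain ⟨a, ha⟩ := red a hT
  obtain ⟨b, hb⟩ := red b hX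
  obtain ⟨c, hc⟩ := red c hY
  rw [ha, hb, hc] at hg ⊢
  rw [map_mul, map_mul, map_pow, map_pow, map_pow, ofPresented_of, ofPresented_of, ofPresented_of,
    pow_eq_of_x _ rfl, pow_eq_of_x _ rfl, pow_eq_of_y _ rfl] at hg
  have h1 := congrArg D5Model.t hg
  have h2 := congrArg D5Model.x hg
  have h3 := congrArg D5Model.y hg
  simp only [genImage, mul_t, mul_x, mul_y, one_t, one_x, one_y, nsmul_eq_mul, mul_zero, mul_one,
    map_zero, zero_mul, zero_add, add_zero, ZMod.natCast_eq_zero_iff] at h1 h2 h3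
  obtain ⟨a, rfl⟩ := h1
  obtain ⟨b, rfl⟩ := h2
  obtain ⟨c, rfl⟩ := h3
  rw [pow_mul, pow_mul, pow_mul, hT, hX, hY]
  simp

theorem eq_mul_pow (g : D5Model n₁ m₂ m₃) :
    g = genImage n₁ m₂ m₃ .t₁ ^ g.t.val * genImage n₁ m₂ m₃ .x ^ g.x.val *
      genImage n₁ m₂ m₃ .y ^ g.y.val := by
  rw [pow_eq_of_x _ rfl, pow_eq_of_x _ rfl, pow_eq_of_y _ rfl]
  ext <;> simp [genImage]

theorem ofPresented_surjective : Function.Surjective (ofPresented n₁ m₂ m₃) := by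
  intro g
  refine ⟨gen n₁ m₂ m₃ .t₁ ^ g.t.val * gen n₁ m₂ m₃ .x ^ g.x.val * gen n₁ m₂ m₃ .y ^ g.y.val, ?_⟩
  conv_rhs => rw [eq_mul_pow g]
  simp only [map_mul, map_pow, ofPresented_of]

/-- The presented group is isomorphic to the model. -/
noncomputable def presentedEquiv (n₁ m₂ m₃ : ℕ) : D5Group (n₁ + 1) m₂ m₃ ≃* D5Model n₁ m₂ m₃ :=
  MulEquiv.ofBijective (ofPresented n₁ m₂ m₃) ⟨ofPresented_injective, ofPresented_surjective⟩

theorem presentedEquiv_of (g : D5Gen) :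
    presentedEquiv n₁ m₂ m₃ (PresentedGroup.of g) = genImage n₁ m₂ m₃ g := ofPresented_of g

end D5Model

/-! ### Groups with a commutator subgroup of order two -/

section

variable {G : Type*} [Group G] {B : Type*} [CommGroup B] {π : G →* B} {z : G}

/-- A noncentral g has a conjugate different from g, and their quotient lies in the kernel {1, z}.
So that conjugate is zg, and the class of g is its full coset modulo the kernel. -/
theorem isConj_iff_map_eq (hker : ∀ g, π g = 1 ↔ g = 1 ∨ g = z) {g h : G}
    (hg : g ∉ Subgroup.center G) : IsConj g h ↔ π h = π g := by
  constructor
  · intro hc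
    obtain ⟨c, rfl⟩ := isConj_iff.1 hc
    rw [map_mul, map_mul, map_inv, mul_comm, inv_mul_cancel_left]
  · intro hgh
    have h1 : π (h * g⁻¹) = 1 := by rw [map_mul, map_inv, hgh, mul_inv_cancel]
    rcases (hker _).1 h1 with h2 | h2
    · rw [mul_inv_eq_one.1 h2]
    · rw [Subgroup.mem_center_iff] at hg
      push Not at hg
      obtain ⟨k, hk⟩ := hg
      refine isConj_iff.2 ⟨k, ?_⟩
      have h3 : π (k * g * k⁻¹ * g⁻¹) = 1 := by
        rw [map_mul, map_mul, map_mul, map_inv, map_inv, mul_comm (π k), mul_inv_cancel_right,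
          mul_inv_cancel]
      rcases (hker _).1 h3 with h4 | h4
      · exact absurd (mul_inv_eq_iff_eq_mul.1 (mul_inv_eq_one.1 h4)) hk
      · exact mul_right_cancel (h4.trans h2.symm)

/-- A surjection to a commutative group whose kernel consists of commutators is the
abelianization. -/
noncomputable def abelianizationEquiv (hπ : Function.Surjective π)
    (hker : ∀ g, π g = 1 ↔ g = 1 ∨ g = z) (hz : z ∈ commutator G) : Abelianization G ≃* B :=
  MulEquiv.ofBijective (Abelianization.lift π) (by
    refine ⟨(injective_iff_map_eq_one _).2 fun a ha => ?_, fun b => ?_⟩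
    · obtain ⟨g, rfl⟩ := QuotientGroup.mk_surjective a
      rcases (hker g).1 ha with rfl | rfl
      · rfl
      · exact (QuotientGroup.eq_one_iff _).2 hz
    · obtain ⟨g, rfl⟩ := hπ b
      exact ⟨Abelianization.of g, Abelianization.lift_apply_of π g⟩)

theorem abelianization_of_eq_one_iff (hker : ∀ g, π g = 1 ↔ g = 1 ∨ g = z)
    (hz : z ∈ commutator G) (g : G) : Abelianization.of g = 1 ↔ g = 1 ∨ g = z := by
  rw [← hker]
  constructor
  · intro h
    rw [← Abelianization.lift_apply_of π g, h, map_one]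
  · intro h
    rcases (hker g).1 h with rfl | rfl
    · rfl
    · exact (QuotientGroup.eq_one_iff _).2 hz

theorem pow_odd_not_mem_center {k : ℕ} (hk : ∀ g : G, g ^ 2 ^ k = 1) {g : G}
    (hg : g ∉ Subgroup.center G) {r : ℕ} (hr : Odd r) : g ^ r ∉ Subgroup.center G := by
  intro h
  apply hg
  have := zpowers_pow_odd (hk g) hr
  exact (Subgroup.zpowers_le.2 h) (this ▸ Subgroup.mem_zpowers g)

theorem exists_galois_of_coprime {K : Type*} [Field K] {n r : ℕ} [NeZero (n : K)]
    (hirr : Irreducible (Polynomial.cyclotomic n K)) (hr : r.Coprime n) :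
    ∃ σ : CyclotomicField n K ≃ₐ[K] CyclotomicField n K,
      ∀ ζ : CyclotomicField n K, ζ ^ n = 1 → σ ζ = ζ ^ r := by
  have : NeZero n := .of_neZero_natCast K
  set μ := IsCyclotomicExtension.zeta n K (CyclotomicField n K)
  have hμ : IsPrimitiveRoot μ n := IsCyclotomicExtension.zeta_spec n K _
  let σ := (IsCyclotomicExtension.autEquivPow (CyclotomicField n K) hirr).symm
    (ZMod.unitOfCoprime r hr)
  have hσ : σ μ = μ ^ r := by
    have h1 := hμ.autToPow_spec K σ
    have h2 : hμ.autToPow K σ = ZMod.unitOfCoprime r hr :=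
      (IsCyclotomicExtension.autEquivPow (CyclotomicField n K) hirr).apply_symm_apply _
    rw [← h1, h2, ZMod.coe_unitOfCoprime, ZMod.val_natCast]
    exact (pow_eq_pow_mod r hμ.pow_eq_one).symm
  refine ⟨σ, fun ζ hζ => ?_⟩
  obtain ⟨i, -, rfl⟩ := hμ.eq_pow_of_pow_eq_one hζ
  rw [map_pow, hσ, ← pow_mul, ← pow_mul, mul_comm]

theorem coprime_of_galois {K L : Type*} [Field K] [Field L] [Algebra K L] {n r : ℕ} {ζ : L}
    (hζ : IsPrimitiveRoot ζ n) (hn : n ≠ 0) {σ : L ≃ₐ[K] L} (h : σ ζ = ζ ^ r) : r.Coprime n := by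
  rw [← hζ.pow_iff_coprime (Nat.pos_of_ne_zero hn), ← h]
  exact hζ.map_of_injective σ.injective

theorem mem_kClass_iff {K : Type*} [Field K] [NeZero (Monoid.exponent G : K)]
    (hirr : Irreducible (Polynomial.cyclotomic (Monoid.exponent G) K)) {g h : G} :
    h ∈ kClass K g ↔ ∃ r, r.Coprime (Monoid.exponent G) ∧ IsConj (g ^ r) h := by
  have : NeZero (Monoid.exponent G) := .of_neZero_natCast K
  constructor
  · rintro ⟨σ, r, hσ, hc⟩
    have hμ := IsCyclotomicExtension.zeta_spec (Monoid.exponent G) K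
      (CyclotomicField (Monoid.exponent G) K)
    exact ⟨r, coprime_of_galois hμ (NeZero.ne _) (hσ _ hμ), hc⟩
  · rintro ⟨r, hr, hc⟩
    obtain ⟨σ, hσ⟩ := exists_galois_of_coprime hirr hr
    exact ⟨σ, r, fun ζ hζ => hσ ζ hζ.pow_eq_one, hc⟩

/-- The exponent is a positive power of two, so being prime to it means being odd; for exponent 1
even r would be admitted too. -/
theorem mem_kClass_rat_iff {j : ℕ} (hexp : Monoid.exponent G = 2 ^ (j + 1)) {g h : G} :
    h ∈ kClass ℚ g ↔ ∃ r, Odd r ∧ IsConj (g ^ r) h := by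
  have hpos : 0 < Monoid.exponent G := by rw [hexp]; positivity
  have : NeZero ((Monoid.exponent G : ℕ) : ℚ) := ⟨Nat.cast_ne_zero.2 hpos.ne'⟩
  rw [mem_kClass_iff (Polynomial.cyclotomic.irreducible_rat hpos)]
  simp_rw [hexp, Nat.coprime_pow_right_iff (Nat.succ_pos j), Nat.coprime_two_right]

/-- For noncentral g the ℚ-class is the full preimage of the set of odd powers of π(g). Preimages
under a surjection determine the set, and odd-power classes correspond to cyclic subgroups. -/
theorem numKClassesInvolving_rat (hπ : Function.Surjective π)
    (hker : ∀ g, π g = 1 ↔ g = 1 ∨ g = z) {k j : ℕ} (hk : ∀ g : G, g ^ 2 ^ k = 1)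
    (hexp : Monoid.exponent G = 2 ^ (j + 1)) {w : G} (hw : w ∉ Subgroup.center G) :
    numKClassesInvolving ℚ w =
      cyclicCount (π '' {g | ∃ a ∈ Subgroup.center G, g = a * w}) := by
  have hclass : ∀ a ∈ Subgroup.center G,
      kClass ℚ (a * w) = π ⁻¹' powClass {r | Odd r} (π (a * w)) := by
    intro a ha
    have haw : a * w ∉ Subgroup.center G := fun h => hw ((Subgroup.mul_mem_cancel_left _ ha).1 h)
    ext h
    rw [mem_kClass_rat_iff hexp]
    refine exists_congr fun r => and_congr_right fun hr => ?_
    rw [isConj_iff_map_eq hker (pow_odd_not_mem_center hk haw hr), map_pow]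
    exact eq_comm
  rw [← powClassCount_odd (k := k)]
  · rw [powClassCount, numKClassesInvolving, ← Set.ncard_image_of_injective _ hπ.preimage_injective]
    congr 1
    ext C
    simp only [Set.mem_image, exists_exists_and_eq_and]
    constructor
    · rintro ⟨a, ha, rfl⟩
      exact ⟨a * w, ⟨a, ha, rfl⟩, (hclass a ha).symm⟩
    · rintro ⟨_, ⟨a, ha, rfl⟩, rfl⟩
      exact ⟨a, ha, (hclass a ha).symm⟩
  · rintro _ ⟨g, -, rfl⟩
    rw [← map_pow, hk, map_one]

end

/-! ### Structure of the direct product of the model with a cyclic group -/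

theorem castHom_eq_zero_iff {n : ℕ} (a : ZMod (2 ^ (n + 1))) :
    ZMod.castHom (pow_dvd_pow 2 (Nat.le_succ n)) (ZMod (2 ^ n)) a = 0 ↔
      ∃ b : ZMod 2, zmodHalf n b = a := by
  refine Iff.trans ?_ (exists_zmodIncl_iff (Nat.le_add_left 1 n) a).symm
  obtain ⟨k, rfl⟩ : ∃ k : ℕ, (k : ZMod (2 ^ (n + 1))) = a := ⟨a.val, ZMod.natCast_zmod_val a⟩
  rw [map_natCast, nsmul_eq_mul, ← Nat.cast_mul, ZMod.natCast_eq_zero_iff,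
    ZMod.natCast_eq_zero_iff, pow_one, pow_succ', mul_dvd_mul_iff_left two_ne_zero]

theorem castHom_zmodHalf {n : ℕ} (b : ZMod 2) :
    ZMod.castHom (pow_dvd_pow 2 (Nat.le_succ n)) (ZMod (2 ^ n)) (zmodHalf n b) = 0 :=
  (castHom_eq_zero_iff _).2 ⟨b, rfl⟩

namespace D5Model

variable {n₁ m₂ m₃ : ℕ} (m₄ : ℕ)

/-- The direct product of the model with a cyclic group of order `2 ^ m₄`. -/
abbrev Ext (n₁ m₂ m₃ m₄ : ℕ) : Type := D5Model n₁ m₂ m₃ × Multiplicative (ZMod (2 ^ m₄))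

/-- The quotient map by the commutator subgroup. -/
noncomputable def toRankFour (n₁ m₂ m₃ m₄ : ℕ) : Ext n₁ m₂ m₃ m₄ →*
    RankFour n₁ (m₂ + 1) (m₃ + 1) m₄ :=
  MonoidHom.mk' (fun g => (.ofAdd (ZMod.castHom (pow_dvd_pow 2 (Nat.le_succ n₁)) (ZMod (2 ^ n₁)) g.1.t),
    .ofAdd g.1.x, .ofAdd g.1.y, g.2)) fun g h => by
      simp only [Prod.fst_mul, Prod.snd_mul, mul_t, mul_x, mul_y, map_add, castHom_zmodHalf,
        add_zero, ofAdd_add, Prod.mk_mul_mk]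

/-- The nontrivial commutator. -/
noncomputable def extZ (n₁ m₂ m₃ m₄ : ℕ) : Ext n₁ m₂ m₃ m₄ := (⟨zmodHalf n₁ 1, 0, 0⟩, 1)

theorem toRankFour_surjective : Function.Surjective (toRankFour n₁ m₂ m₃ m₄) := by
  rintro ⟨a, b, c, d⟩
  obtain ⟨t, ht⟩ := ZMod.castHom_surjective (pow_dvd_pow 2 (Nat.le_succ n₁)) a.toAdd
  exact ⟨(⟨t, b.toAdd, c.toAdd⟩, d), Prod.ext (congrArg Multiplicative.ofAdd ht) rfl⟩

theorem toRankFour_eq_one_iff (g : Ext n₁ m₂ m₃ m₄) :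
    toRankFour n₁ m₂ m₃ m₄ g = 1 ↔ g = 1 ∨ g = extZ n₁ m₂ m₃ m₄ := by
  constructor
  · intro h
    have h1 : ZMod.castHom (pow_dvd_pow 2 (Nat.le_succ n₁)) (ZMod (2 ^ n₁)) g.1.t = 0 :=
      congrArg (fun u => u.1.toAdd) h
    have h2 : g.1.x = 0 := congrArg (fun u => u.2.1.toAdd) h
    have h3 : g.1.y = 0 := congrArg (fun u => u.2.2.1.toAdd) h
    have h4 : g.2 = 1 := congrArg (fun u => u.2.2.2) h
    obtain ⟨b, hb⟩ := (castHom_eq_zero_iff _).1 h1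
    have : b = 0 ∨ b = 1 := (by decide : ∀ b : ZMod 2, b = 0 ∨ b = 1) b
    rcases this with rfl | rfl
    · left
      refine Prod.ext (D5Model.ext ?_ h2 h3) h4
      rw [← hb, map_zero]; rfl
    · right
      exact Prod.ext (D5Model.ext hb.symm h2 h3) h4
  · rintro (rfl | rfl)
    · exact map_one _
    · exact Prod.ext (congrArg Multiplicative.ofAdd (castHom_zmodHalf 1)) rfl

theorem extZ_eq (n₁ m₂ m₃ m₄ : ℕ) : extZ n₁ m₂ m₃ m₄ =
    ((⟨0, 1, 0⟩, 1) : Ext n₁ m₂ m₃ m₄)⁻¹ * ((⟨0, 0, 1⟩, 1) : Ext n₁ m₂ m₃ m₄)⁻¹ *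
      (⟨0, 1, 0⟩, 1) * (⟨0, 0, 1⟩, 1) := by
  rw [mul_assoc, ← mul_inv_rev, eq_inv_mul_iff_mul_eq]
  refine Prod.ext (D5Model.ext ?_ ?_ ?_) ?_
  · simp only [extZ, Prod.fst_mul, mul_t, mul_y, map_zero, map_one]
    have h1 : zmodHalf n₁ 1 + zmodHalf n₁ 1 = 0 := by
      rw [← map_add]; exact map_zero _
    simp [h1]
  · simp [extZ]
  · simp [extZ]
  · simp [extZ]

theorem extZ_ne_one : extZ n₁ m₂ m₃ m₄ ≠ 1 := by
  intro h
  have h1 : zmodHalf n₁ 1 = 0 := congrArg (fun g => g.1.t) h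
  rw [← map_zero (zmodHalf n₁)] at h1
  exact absurd (zmodHalf_injective n₁ h1) (by decide)

variable {m₄}

theorem mem_center_ext_iff (g : Ext n₁ m₂ m₃ m₄) :
    g ∈ Subgroup.center (Ext n₁ m₂ m₃ m₄) ↔
      zmodParity m₂ g.1.x = 0 ∧ zmodParity m₃ g.1.y = 0 := by
  rw [← mem_center_iff, Subgroup.mem_center_iff, Subgroup.mem_center_iff]
  constructor
  · intro h k
    exact congrArg Prod.fst (h (k, 1))
  · intro h k
    exact Prod.ext (h k.1) (mul_comm _ _)

/-- The parametrization of the centre. -/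
noncomputable def centerHom (n₁ m₂ m₃ m₄ : ℕ) : RankFour (n₁ + 1) m₂ m₃ m₄ →* Ext n₁ m₂ m₃ m₄ :=
  MonoidHom.mk' (fun u => (⟨u.1.toAdd, zmodIncl (Nat.le_succ m₂) u.2.1.toAdd,
    zmodIncl (Nat.le_succ m₃) u.2.2.1.toAdd⟩, u.2.2.2)) fun u v => by
      have h : zmodParity m₃ (zmodIncl (Nat.le_succ m₃) u.2.2.1.toAdd) = 0 :=
        (exists_zmodIncl_iff_parity _).1 ⟨_, rfl⟩
      refine Prod.ext (D5Model.ext ?_ ?_ ?_) rfl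
      · simp only [Prod.fst_mul, Prod.mk_mul_mk, mul_t, h, zero_mul, map_zero,
          add_zero, toAdd_mul]
      · simp
      · simp

theorem centerHom_injective : Function.Injective (centerHom n₁ m₂ m₃ m₄) := by
  rintro ⟨u₁, u₂, u₃, u₄⟩ ⟨v₁, v₂, v₃, v₄⟩ h
  have h1 : u₁ = v₁ := congrArg (fun g => g.1.t) h
  have h2 : u₂ = v₂ := zmodIncl_injective (Nat.le_succ m₂) (congrArg (fun g => g.1.x) h)
  have h3 : u₃ = v₃ := zmodIncl_injective (Nat.le_succ m₃) (congrArg (fun g => g.1.y) h)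
  have h4 : u₄ = v₄ := congrArg Prod.snd h
  rw [h1, h2, h3, h4]

theorem range_centerHom :
    (centerHom n₁ m₂ m₃ m₄).range = Subgroup.center (Ext n₁ m₂ m₃ m₄) := by
  ext g
  rw [mem_center_ext_iff, ← exists_zmodIncl_iff_parity, ← exists_zmodIncl_iff_parity]
  constructor
  · rintro ⟨u, rfl⟩
    exact ⟨⟨u.2.1.toAdd, rfl⟩, ⟨u.2.2.1.toAdd, rfl⟩⟩
  · rintro ⟨⟨b, hb⟩, ⟨c, hc⟩⟩
    exact ⟨(.ofAdd g.1.t, .ofAdd b, .ofAdd c, g.2), Prod.ext (D5Model.ext rfl hb hc) rfl⟩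

/-- The centre of the extended model is a product of four cyclic groups. -/
noncomputable def centerEquiv (n₁ m₂ m₃ m₄ : ℕ) :
    RankFour (n₁ + 1) m₂ m₃ m₄ ≃* Subgroup.center (Ext n₁ m₂ m₃ m₄) :=
  (MonoidHom.ofInjective centerHom_injective).trans (MulEquiv.subgroupCongr range_centerHom)

theorem coe_centerEquiv (u : RankFour (n₁ + 1) m₂ m₃ m₄) :
    (centerEquiv n₁ m₂ m₃ m₄ u : Ext n₁ m₂ m₃ m₄) = centerHom n₁ m₂ m₃ m₄ u := rfl

/-- The model as a set. -/
def equivProd (n₁ m₂ m₃ : ℕ) :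
    D5Model n₁ m₂ m₃ ≃ ZMod (2 ^ (n₁ + 1)) × ZMod (2 ^ (m₂ + 1)) × ZMod (2 ^ (m₃ + 1)) where
  toFun g := (g.t, g.x, g.y)
  invFun p := ⟨p.1, p.2.1, p.2.2⟩
  left_inv _ := rfl
  right_inv _ := rfl

instance : Finite (D5Model n₁ m₂ m₃) := Finite.of_equiv _ (equivProd n₁ m₂ m₃).symm

theorem card_ext : Nat.card (Ext n₁ m₂ m₃ m₄) = 2 ^ (n₁ + m₂ + m₃ + m₄ + 3) := by
  rw [Nat.card_prod, Nat.card_congr (equivProd n₁ m₂ m₃), Nat.card_prod, Nat.card_prod,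
    Nat.card_congr Multiplicative.toAdd, Nat.card_zmod, Nat.card_zmod, Nat.card_zmod, Nat.card_zmod]
  ring

end D5Model

theorem card_rankFour (a b c d : ℕ) : Nat.card (RankFour a b c d) = 2 ^ (a + b + c + d) := by
  rw [Nat.card_prod, Nat.card_prod, Nat.card_prod, Nat.card_congr Multiplicative.toAdd,
    Nat.card_congr Multiplicative.toAdd, Nat.card_congr Multiplicative.toAdd,
    Nat.card_congr Multiplicative.toAdd, Nat.card_zmod, Nat.card_zmod, Nat.card_zmod, Nat.card_zmod]
  ring

/-! ### Counting by cosets of the centre -/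

/-- The elements with prescribed parities of the two middle coordinates. -/
def parityClass (a m₂ m₃ d : ℕ) (i j : ZMod 2) : Set (RankFour a (m₂ + 1) (m₃ + 1) d) :=
  {u | zmodParity m₂ u.2.1.toAdd = i ∧ zmodParity m₃ u.2.2.1.toAdd = j}

/-- Two generators of the same cyclic 2-group are odd powers of each other, and odd powers preserve
parities. -/
theorem zpowers_ne_of_parity {a m₂ m₃ d : ℕ} {i j i' j' : ZMod 2} (h : i ≠ i' ∨ j ≠ j') :
    ∀ u ∈ parityClass a m₂ m₃ d i j, ∀ v ∈ parityClass a m₂ m₃ d i' j',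
      Subgroup.zpowers u ≠ Subgroup.zpowers v := by
  rintro u ⟨hu₂, hu₃⟩ v ⟨hv₂, hv₃⟩ huv
  obtain ⟨r, ⟨s, rfl⟩, rfl⟩ := exists_odd_pow_of_zpowers_eq (rankFour_pow_eq_one
    (k := a + (m₂ + 1) + (m₃ + 1) + d) (by omega) (by omega) (by omega) (by omega) u) huv
  have h2 : (2 : ZMod 2) = 0 := rfl
  rw [Prod.pow_snd, Prod.pow_fst, toAdd_pow, map_nsmul, hu₂, nsmul_eq_mul] at hv₂
  rw [Prod.pow_snd, Prod.pow_snd, Prod.pow_fst, toAdd_pow, map_nsmul, hu₃, nsmul_eq_mul] at hv₃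
  push_cast at hv₂ hv₃
  rw [h2, zero_mul, zero_add, one_mul] at hv₂ hv₃
  exact h.elim (fun h => h hv₂) (fun h => h hv₃)

/-- The parity classes are the four cosets of Z(G)/G' in G/G'. The even class together with one
other class is a subgroup whose cyclic subgroups were counted above, and generators of one cyclic
subgroup never lie in two classes, so counts add. Sums replace differences to avoid truncation. -/
theorem cyclicCount_parity_sum (a m₂ m₃ d : ℕ) :
    cyclicCount (parityClass a m₂ m₃ d 0 0) = rankFourCount a m₂ m₃ d ∧
    cyclicCount (parityClass a m₂ m₃ d 1 0) + rankFourCount a m₂ m₃ d =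
      rankFourCount a (m₂ + 1) m₃ d ∧
    cyclicCount (parityClass a m₂ m₃ d 0 1) + rankFourCount a m₂ m₃ d =
      rankFourCount a m₂ (m₃ + 1) d ∧
    cyclicCount (parityClass a m₂ m₃ d 1 1) + rankFourCount a m₂ m₃ d =
      rankFourCount a (max m₂ m₃ + 1) (min m₂ m₃) d ∧
    rankFourCount a (m₂ + 1) (m₃ + 1) d = rankFourCount a m₂ m₃ d +
      cyclicCount (parityClass a m₂ m₃ d 1 0) + cyclicCount (parityClass a m₂ m₃ d 0 1) +
      cyclicCount (parityClass a m₂ m₃ d 1 1) := by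
  have h0 : cyclicCount (parityClass a m₂ m₃ d 0 0) = rankFourCount a m₂ m₃ d :=
    cyclicCount_parity_both a m₂ m₃ d
  have key : ∀ i j : ZMod 2, (i = 0 ∨ i = 1) ∧ (j = 0 ∨ j = 1) := by decide
  have h01 : (0 : ZMod 2) ≠ 1 := by decide
  refine ⟨h0, ?_, ?_, ?_, ?_⟩
  · rw [← h0, ← cyclicCount_union (zpowers_ne_of_parity (by simp)), ← cyclicCount_parity_right]
    congr 1
    ext u
    have := key (zmodParity m₂ u.2.1.toAdd) 0
    simp only [parityClass, Set.mem_union, Set.mem_ofPred_eq]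
    tauto
  · rw [← h0, ← cyclicCount_union (zpowers_ne_of_parity (by simp)), ← cyclicCount_parity_left]
    congr 1
    ext u
    have := key (zmodParity m₃ u.2.2.1.toAdd) 0
    simp only [parityClass, Set.mem_union, Set.mem_ofPred_eq]
    tauto
  · rw [← h0, ← cyclicCount_union (zpowers_ne_of_parity (by simp)), ← cyclicCount_parity_eq]
    congr 1
    ext u
    have := key (zmodParity m₂ u.2.1.toAdd) (zmodParity m₃ u.2.2.1.toAdd)
    simp only [parityClass, Set.mem_union, Set.mem_ofPred_eq]
    rcases this with ⟨h | h, h' | h'⟩ <;> rw [h, h'] <;> simp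
  · rw [← h0, ← cyclicCount_union (zpowers_ne_of_parity (by simp)), ← cyclicCount_union,
      ← cyclicCount_union, rankFourCount_eq, numCyclicSubgroups_eq_cyclicCount]
    · congr 1
      ext u
      have := key (zmodParity m₂ u.2.1.toAdd) (zmodParity m₃ u.2.2.1.toAdd)
      simp only [parityClass, Set.mem_union, Set.mem_ofPred_eq, Set.mem_univ, true_iff]
      tauto
    · rintro u ((hu | hu) | hu) v hv <;>
        exact zpowers_ne_of_parity (by simp) u hu v hv
    · rintro u (hu | hu) v hv <;>
        exact zpowers_ne_of_parity (by simp) u hu v hv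

/-! ### Maximal ideals of quotients of commutative group algebras -/

section

variable {K L S : Type*} [Field K] [Field L] [Algebra K L] [CommRing S] [Algebra K S]

theorem ker_isMaximal_of_finite [Module.Finite K S] (f : S →ₐ[K] L) :
    (RingHom.ker f).IsMaximal := by
  have : IsArtinianRing S := IsArtinianRing.of_finite K S
  have : (RingHom.ker f).IsPrime := RingHom.ker_isPrime f
  exact Ideal.IsPrime.isMaximal' this

/-- Two homomorphisms with the same kernel are two embeddings of one residue field. Viewing L as an
extension of that field through f, normality of L over K extends the other embedding to an
automorphism. -/
theorem exists_galois_of_ker_eq [Module.Finite K S] [Normal K L] {f g : S →ₐ[K] L}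
    (h : RingHom.ker f = RingHom.ker g) : ∃ σ : L ≃ₐ[K] L, ∀ s, g s = σ (f s) := by
  have := ker_isMaximal_of_finite f
  let : Field (S ⧸ RingHom.ker f) := Ideal.Quotient.field _
  let f' : S ⧸ RingHom.ker f →ₐ[K] L := Ideal.kerLiftAlg f
  let g' : S ⧸ RingHom.ker f →ₐ[K] L :=
    Ideal.Quotient.liftₐ (RingHom.ker f) g fun a ha => by rw [h] at ha; exact ha
  let : Algebra (S ⧸ RingHom.ker f) L := f'.toRingHom.toAlgebra
  have : IsScalarTower K (S ⧸ RingHom.ker f) L :=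
    IsScalarTower.of_algebraMap_eq fun r => (f'.commutes r).symm
  let φ : L →ₐ[K] L := g'.liftNormal L
  have hφ : ∀ s, φ (f' s) = g' s := fun s => g'.liftNormal_commutes L s
  refine ⟨AlgEquiv.ofBijective φ (Algebra.IsAlgebraic.algHom_bijective φ), fun s => ?_⟩
  exact (hφ (Ideal.Quotient.mk _ s)).symm

theorem ker_eq_of_galois {f g : S →ₐ[K] L} {σ : L ≃ₐ[K] L} (h : ∀ s, g s = σ (f s)) :
    RingHom.ker f = RingHom.ker g := by
  ext s
  rw [RingHom.mem_ker, RingHom.mem_ker, h, map_eq_zero_iff σ σ.injective]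

variable {A : Type*} [CommGroup A] {n : ℕ}

/-- The residue field is generated over K by images of elements of A, which are n-th roots of unity,
so it embeds into L, where X^n - 1 splits. -/
theorem exists_ker_eq [NeZero n] [IsCyclotomicExtension {n} K L]
    (hA : ∀ a : A, a ^ n = 1) {h : MonoidAlgebra K A →ₐ[K] S}
    (hh : Function.Surjective h) (M : MaximalSpectrum S) :
    ∃ f : S →ₐ[K] L, RingHom.ker f = M.asIdeal := by
  have := M.isMaximal
  let : Field (S ⧸ M.asIdeal) := Ideal.Quotient.field _
  let mk : S →ₐ[K] S ⧸ M.asIdeal := Ideal.Quotient.mkₐ K _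
  let w : A → S ⧸ M.asIdeal := fun a => mk (h (MonoidAlgebra.of K A a))
  have hw : ∀ a, w a ^ n = 1 := fun a => by
    simp only [w]
    rw [← map_pow, ← map_pow, ← map_pow, hA, map_one, map_one, map_one]
  have htop : IntermediateField.adjoin K (Set.range w) = ⊤ := by
    rw [eq_top_iff]
    rintro s -
    obtain ⟨s, rfl⟩ := Ideal.Quotient.mk_surjective s
    obtain ⟨α, rfl⟩ := hh s
    change mk (h α) ∈ _
    induction α using MonoidAlgebra.induction_on with
    | of a => exact IntermediateField.subset_adjoin K _ ⟨a, rfl⟩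
    | add x y hx hy => rw [map_add, map_add]; exact add_mem hx hy
    | smul r x hx => rw [map_smul, map_smul]; exact IntermediateField.smul_mem _ hx
  have hmonic : (Polynomial.X ^ n - 1 : Polynomial K).Monic :=
    Polynomial.monic_X_pow_sub_C 1 (NeZero.ne n)
  have hroot : ∀ s ∈ Set.range w, Polynomial.aeval s (Polynomial.X ^ n - 1 : Polynomial K) = 0 := by
    rintro _ ⟨a, rfl⟩
    simp [hw]
  obtain ⟨F⟩ : Nonempty (S ⧸ M.asIdeal →ₐ[K] L) := by
    refine IntermediateField.nonempty_algHom_of_adjoin_splits (fun s hs =>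
      ⟨⟨_, hmonic, hroot s hs⟩, ?_⟩) htop
    exact (IsCyclotomicExtension.splits_X_pow_sub_one K L (Set.mem_singleton n)).of_dvd
      (hmonic.map _).ne_zero (Polynomial.map_dvd _ (minpoly.dvd K s (hroot s hs)))
  refine ⟨F.comp mk, ?_⟩
  ext s
  rw [RingHom.mem_ker, AlgHom.comp_apply, map_eq_zero_iff F F.toRingHom.injective]
  exact Ideal.Quotient.eq_zero_iff_mem

/-- Maximal ideals correspond to classes of characters with values in a cyclotomic extension. -/
theorem card_maximalSpectrum [Finite A] [NeZero n] [IsCyclotomicExtension {n} K L]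
    (hA : ∀ a : A, a ^ n = 1) {h : MonoidAlgebra K A →ₐ[K] S} (hh : Function.Surjective h)
    {R : Set ℕ} (hR1 : 1 ∈ R)
    (hR : ∀ σ : L ≃ₐ[K] L, ∃ r ∈ R, ∀ ζ : L, ζ ^ n = 1 → σ ζ = ζ ^ r)
    (hR' : ∀ r ∈ R, ∃ σ : L ≃ₐ[K] L, ∀ ζ : L, ζ ^ n = 1 → σ ζ = ζ ^ r) :
    Nat.card (MaximalSpectrum S) = powClassCount R
      {χ : A →* Lˣ | ∃ f : S →ₐ[K] L, ∀ a, f (h (MonoidAlgebra.of K A a)) = χ a} := by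
  have : Module.Finite K S := Module.Finite.of_surjective h.toLinearMap hh
  have : IsGalois K L := IsCyclotomicExtension.isGalois {n} K L
  let Θ : (S →ₐ[K] L) → (A →* Lˣ) := fun f =>
    (((f.comp h : MonoidAlgebra K A →ₐ[K] L) : MonoidAlgebra K A →* L).comp
      (MonoidAlgebra.of K A)).toHomUnits
  have hΘ : ∀ f a, (Θ f a : L) = f (h (MonoidAlgebra.of K A a)) := fun f a => rfl
  have hpow : ∀ f a, (Θ f a : L) ^ n = 1 := fun f a => by
    rw [hΘ, ← map_pow, ← map_pow, ← map_pow, hA, map_one, map_one, map_one]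
  have hext : ∀ f g : S →ₐ[K] L, (∀ a, (Θ f a : L) = Θ g a) → f = g := by
    intro f g hfg
    have : f.comp h = g.comp h := (MonoidAlgebra.lift K L A).symm.injective (MonoidHom.ext hfg)
    ext s
    obtain ⟨α, rfl⟩ := hh s
    exact DFunLike.congr_fun this α
  let κ : (S →ₐ[K] L) → MaximalSpectrum S := fun f => ⟨RingHom.ker f, ker_isMaximal_of_finite f⟩
  have hκ : Function.Surjective κ := fun M => by
    obtain ⟨f, hf⟩ := exists_ker_eq (L := L) hA hh M
    exact ⟨f, MaximalSpectrum.ext hf⟩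
  have hset : {χ : A →* Lˣ | ∃ f : S →ₐ[K] L, ∀ a, f (h (MonoidAlgebra.of K A a)) = χ a} =
      Set.range Θ := by
    ext χ
    constructor
    · rintro ⟨f, hf⟩
      exact ⟨f, MonoidHom.ext fun a => Units.ext (hf a)⟩
    · rintro ⟨f, rfl⟩
      exact ⟨f, fun a => rfl⟩
  rw [hset, powClassCount, ← Set.image_univ, Set.image_image, ← Set.ncard_univ,
    ← hκ.range_eq, ← Set.image_univ]
  -- Both sides count images of the set of algebra homomorphisms S → L, under the kernel map κ and
  -- under the power class of the character Θ. Equal kernels mean Galois conjugate homomorphisms,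
  -- that is, characters in one power class.
  refine ncard_image_eq_of_forall_iff fun f _ g _ => ?_
  have hstep : ∀ f g : S →ₐ[K] L, κ f = κ g → powClass R (Θ g) ⊆ powClass R (Θ f) := by
    rintro f g hfg _ ⟨r, hr, rfl⟩
    obtain ⟨σ, hσ⟩ := exists_galois_of_ker_eq (congrArg MaximalSpectrum.asIdeal hfg)
    obtain ⟨τ, hτ⟩ := hR' r hr
    obtain ⟨s, hs, hs'⟩ := hR (σ.trans τ)
    refine ⟨s, hs, ?_⟩
    ext a
    change (Θ f a : L) ^ s = (Θ g a : L) ^ r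
    rw [← hs' _ (hpow f a), ← hτ _ (hpow g a), AlgEquiv.trans_apply, hΘ, hΘ, hσ]
  constructor
  · intro hfg
    exact (hstep g f hfg.symm).antisymm (hstep f g hfg)
  · intro hfg
    have : Θ g ∈ powClass R (Θ f) := hfg ▸ self_mem_powClass hR1 _
    obtain ⟨r, hr, hr'⟩ := this
    obtain ⟨σ, hσ⟩ := hR' r hr
    have hg : g = (σ : L →ₐ[K] L).comp f := by
      refine hext _ _ fun a => ?_
      have := hσ _ (hpow f a)
      rw [← hr']
      exact this.symm
    exact MaximalSpectrum.ext (ker_eq_of_galois fun s => by rw [hg]; rfl)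

theorem hasEnoughRootsOfUnity_of_isPrimitiveRoot [NeZero n] {ζ : L} (h : IsPrimitiveRoot ζ n) :
    HasEnoughRootsOfUnity L n :=
  ⟨⟨ζ, h⟩, inferInstance⟩

theorem hasEnoughRootsOfUnity_exponent [Finite A] [NeZero (n : K)] [IsCyclotomicExtension {n} K L]
    (hA : ∀ a : A, a ^ n = 1) : HasEnoughRootsOfUnity L (Monoid.exponent A) := by
  have : NeZero n := .of_neZero_natCast K
  have := hasEnoughRootsOfUnity_of_isPrimitiveRoot (IsCyclotomicExtension.zeta_spec n K L)
  exact HasEnoughRootsOfUnity.of_dvd L (Monoid.exponent_dvd_of_forall_pow_eq_one hA)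

/-- A finite abelian group is isomorphic to its character group when L has enough roots of unity;
power classes only depend on the isomorphism type. -/
theorem powClassCount_dual [Finite A] [HasEnoughRootsOfUnity L (Monoid.exponent A)] (R : Set ℕ) :
    powClassCount R (Set.univ : Set (A →* Lˣ)) = powClassCount R (Set.univ : Set A) := by
  obtain ⟨e⟩ := CommGroup.monoidHom_mulEquiv_of_hasEnoughRootsOfUnity A L
  rw [← powClassCount_image e.toMonoidHom e.injective, Set.image_univ]
  exact congrArg _ e.surjective.range_eq

theorem numCyclicSubgroups_dual [Finite A] [HasEnoughRootsOfUnity L (Monoid.exponent A)] :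
    numCyclicSubgroups (A →* Lˣ) = numCyclicSubgroups A := by
  obtain ⟨e⟩ := CommGroup.monoidHom_mulEquiv_of_hasEnoughRootsOfUnity A L
  exact numCyclicSubgroups_congr e

theorem finite_dual [Finite A] [HasEnoughRootsOfUnity L (Monoid.exponent A)] :
    Finite (A →* Lˣ) := by
  obtain ⟨e⟩ := CommGroup.monoidHom_mulEquiv_of_hasEnoughRootsOfUnity A L
  exact Finite.of_equiv _ e.symm.toEquiv

/-- The characters with `χ z = -1` are counted by comparing the group with its quotient by `z`. -/
theorem cyclicCount_neg_one_add [Finite A] [HasEnoughRootsOfUnity L (Monoid.exponent A)]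
    {A' : Type*} [CommGroup A'] [Finite A'] [HasEnoughRootsOfUnity L (Monoid.exponent A')]
    {ρ : A →* A'} (hρ : Function.Surjective ρ) {z : A} (hker : ∀ a, ρ a = 1 ↔ a = 1 ∨ a = z)
    (hz : z * z = 1) (h2 : (2 : L) ≠ 0) :
    cyclicCount {χ : A →* Lˣ | χ z = -1} + numCyclicSubgroups A' = numCyclicSubgroups A := by
  have := finite_dual (L := L) (A := A)
  have hne : (-1 : Lˣ) ≠ 1 := by
    intro h
    apply h2
    have := congrArg Units.val h
    rw [Units.val_neg, Units.val_one] at this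
    rw [← one_add_one_eq_two]
    nth_rewrite 1 [← this]
    exact neg_add_cancel 1
  -- Characters trivial at z are exactly those pulled back along ρ.
  have hV : numCyclicSubgroups A' = cyclicCount {χ : A →* Lˣ | χ z = 1} := by
    rw [← numCyclicSubgroups_dual (L := L), numCyclicSubgroups_eq_cyclicCount_range
      (MonoidHom.compHom' ρ : (A' →* Lˣ) →* (A →* Lˣ))]
    · congr 1
      ext χ
      constructor
      · rintro ⟨ψ, rfl⟩
        change ψ (ρ z) = 1
        rw [(hker z).2 (Or.inr rfl), map_one]
      · intro hχ
        refine ⟨ρ.liftOfSurjective hρ ⟨χ, fun a ha => ?_⟩, ?_⟩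
        · rcases (hker a).1 ha with rfl | rfl
          · exact map_one χ
          · exact hχ
        · exact MonoidHom.liftOfRightInverse_comp ρ _ (Function.rightInverse_surjInv hρ) ⟨χ, _⟩
    · intro ψ ψ' h
      exact (MonoidHom.cancel_right hρ).1 h
  rw [hV, ← numCyclicSubgroups_dual (A := A) (L := L), numCyclicSubgroups_eq_cyclicCount,
    ← cyclicCount_union]
  · congr 1
    ext χ
    simp only [Set.mem_union, Set.mem_ofPred_eq, Set.mem_univ, iff_true]
    have : (χ z : L) * χ z = 1 := by
      rw [← Units.val_mul, ← map_mul, hz, map_one, Units.val_one]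
    rcases mul_self_eq_one_iff.1 this with h | h
    · exact Or.inr (Units.ext h)
    · exact Or.inl (Units.ext h)
  · intro χ hχ ψ hψ h
    obtain ⟨s, rfl⟩ := Subgroup.mem_zpowers_iff.1 (h ▸ Subgroup.mem_zpowers χ : χ ∈ _)
    apply hne
    rw [← hχ.out, MonoidHom.zpow_apply, hψ.out, one_zpow]

end

/-! ### Galois action on roots of unity -/

/-- Irreducibility of the cyclotomic polynomial makes the Galois group all of the units modulo 2^k,
and k ≠ 0 makes these the odd residues. -/
theorem galois_rat {k : ℕ} (hk : k ≠ 0) {K : Type*} [Field K] [NeZero ((2 ^ k : ℕ) : K)]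
    (hirr : Irreducible (Polynomial.cyclotomic (2 ^ k) K)) :
    (∀ σ : CyclotomicField (2 ^ k) K ≃ₐ[K] CyclotomicField (2 ^ k) K,
      ∃ r ∈ {r | Odd r}, ∀ ζ : CyclotomicField (2 ^ k) K, ζ ^ 2 ^ k = 1 → σ ζ = ζ ^ r) ∧
    ∀ r ∈ {r | Odd r}, ∃ σ : CyclotomicField (2 ^ k) K ≃ₐ[K] CyclotomicField (2 ^ k) K,
      ∀ ζ : CyclotomicField (2 ^ k) K, ζ ^ 2 ^ k = 1 → σ ζ = ζ ^ r := by
  constructor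
  · intro σ
    have hμ := IsCyclotomicExtension.zeta_spec (2 ^ k) K (CyclotomicField (2 ^ k) K)
    obtain ⟨r, -, hr⟩ := hμ.eq_pow_of_pow_eq_one (ξ := σ (IsCyclotomicExtension.zeta (2 ^ k) K _))
      (by rw [← map_pow, hμ.pow_eq_one, map_one])
    have hcop := coprime_of_galois hμ (by positivity) hr.symm
    refine ⟨r, (Nat.coprime_two_right).1 (hcop.coprime_dvd_right (dvd_pow_self 2 hk)),
      fun ζ hζ => ?_⟩
    obtain ⟨i, -, rfl⟩ := hμ.eq_pow_of_pow_eq_one hζ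
    rw [map_pow, ← hr, ← pow_mul, ← pow_mul, mul_comm]
  · intro r hr
    exact exists_galois_of_coprime hirr ((Nat.coprime_two_right.2 hr).pow_right k)

/-- The Galois group is generated by the Frobenius automorphism, so the exponents are the powers of
the order of K. -/
theorem galois_finite {n : ℕ} (K L : Type*) [Field K] [Finite K] [Field L] [Algebra K L]
    [FiniteDimensional K L] :
    (∀ σ : L ≃ₐ[K] L, ∃ r ∈ powersOf (Nat.card K), ∀ ζ : L, ζ ^ n = 1 → σ ζ = ζ ^ r) ∧
    ∀ r ∈ powersOf (Nat.card K), ∃ σ : L ≃ₐ[K] L, ∀ ζ : L, ζ ^ n = 1 → σ ζ = ζ ^ r := by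
  have := Fintype.ofFinite K
  have : Finite L := Module.finite_of_finite K
  have key : ∀ i (ζ : L), (FiniteField.frobeniusAlgEquivOfAlgebraic K L ^ i) ζ =
      ζ ^ Nat.card K ^ i := by
    intro i ζ
    rw [AlgEquiv.coe_pow, FiniteField.coe_frobeniusAlgEquivOfAlgebraic, pow_iterate,
      Nat.card_eq_fintype_card]
  constructor
  · intro σ
    obtain ⟨i, rfl⟩ := (FiniteField.bijective_frobeniusAlgEquivOfAlgebraic_pow K L).2 σ
    exact ⟨_, ⟨i, rfl⟩, fun ζ _ => key i ζ⟩
  · rintro _ ⟨i, rfl⟩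
    exact ⟨_, fun ζ _ => key i ζ⟩

/-! ### Quaternion algebras over commutative rings -/

section

variable {K S : Type*} [Field K] [CommRing S] [Algebra K S]

/-- Coordinates of a quaternion algebra. -/
def quaternionLinearEquiv (K : Type*) {S : Type*} [Field K] [CommRing S] [Algebra K S] (a b : S) :
    ℍ[S, a, b] ≃ₗ[K] S × S × S × S where
  toFun v := (v.re, v.imI, v.imJ, v.imK)
  invFun p := ⟨p.1, p.2.1, p.2.2.1, p.2.2.2⟩
  map_add' _ _ := rfl
  map_smul' _ _ := rfl
  left_inv _ := rfl
  right_inv _ := rfl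

theorem finite_quaternion [Module.Finite K S] (a b : S) : Module.Finite K ℍ[S, a, b] :=
  Module.Finite.equiv (quaternionLinearEquiv K a b).symm

theorem finrank_quaternion [Module.Finite K S] (a b : S) :
    Module.finrank K ℍ[S, a, b] = 4 * Module.finrank K S := by
  rw [(quaternionLinearEquiv K a b).finrank_eq]
  simp only [Module.finrank_prod]
  ring

/-- A quaternion algebra over a product of rings is a product of quaternion algebras. -/
def quaternionPi {ι : Type*} {F : ι → Type*} [∀ i, CommRing (F i)] [∀ i, Algebra K (F i)]
    (e : S ≃ₐ[K] ∀ i, F i) (a b : S) : ℍ[S, a, b] ≃ₐ[K] ∀ i, ℍ[F i, e a i, e b i] :=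
  AlgEquiv.ofLinearEquiv
    { toFun := fun v i => ⟨e v.re i, e v.imI i, e v.imJ i, e v.imK i⟩
      invFun := fun p => ⟨e.symm fun i => (p i).re, e.symm fun i => (p i).imI,
        e.symm fun i => (p i).imJ, e.symm fun i => (p i).imK⟩
      map_add' := fun v w => by
        funext i
        ext <;> simp
      map_smul' := fun r v => by
        funext i
        ext <;> simp
      left_inv := fun v => by
        ext <;> simp
      right_inv := fun p => by
        funext i
        ext <;> simp }
    (by
      funext i
      change (⟨e 1 i, e 0 i, e 0 i, e 0 i⟩ : ℍ[F i, e a i, e b i]) = 1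
      rw [map_one, map_zero]
      rfl)
    (fun v w => by
      funext i
      ext <;> simp)

end

/-- Over a finite field of odd order, every quaternion algebra is split. -/
theorem nonempty_quaternion_algEquiv_matrix {F : Type*} [Field F] [Finite F] (h2 : (2 : F) ≠ 0)
    {a b : F} (ha : a ≠ 0) (hb : b ≠ 0) :
    Nonempty (ℍ[F, a, b] ≃ₐ[F] Matrix (Fin 2) (Fin 2) F) := by
  have := Fintype.ofFinite F
  have hchar : ringChar F ≠ 2 := fun h => h2 (by
    have := ringChar.Nat.cast_ringChar (R := F)
    rw [h] at this
    exact_mod_cast this)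
  -- Over a finite field of odd order the form p² - b r² represents every element. A representation
  -- of a gives a matrix of trace zero with square a that anticommutes with the companion matrix of
  -- X² - b.
  obtain ⟨p, r, hpr⟩ : ∃ p r : F, p * p - b * (r * r) = a := by
    have hdeg : (Polynomial.C (-b) * Polynomial.X ^ 2 - Polynomial.C a : Polynomial F).degree = 2 := by
      rw [Polynomial.degree_sub_C] <;> rw [Polynomial.degree_C_mul_X_pow 2 (neg_ne_zero.2 hb)]
      · rfl
      · exact_mod_cast Nat.zero_lt_two
    obtain ⟨p, r, h⟩ := FiniteField.exists_root_sum_quadratic (R := F)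
      (Polynomial.degree_X_pow 2) hdeg (FiniteField.odd_card_of_char_ne_two hchar)
    refine ⟨p, r, ?_⟩
    simp only [Polynomial.eval_pow, Polynomial.eval_X, Polynomial.eval_sub, Polynomial.eval_mul,
      Polynomial.eval_C] at h
    linear_combination h
  let q : QuaternionAlgebra.Basis (Matrix (Fin 2) (Fin 2) F) a 0 b :=
    { i := !![p, -(b * r); r, -p]
      j := !![0, b; 1, 0]
      k := !![-(b * r), p * b; -p, r * b]
      i_mul_i := by
        ext i j
        fin_cases i <;> fin_cases j <;> simp [Matrix.mul_apply] <;>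
          first | ring1 | linear_combination hpr
      j_mul_j := by
        ext i j
        fin_cases i <;> fin_cases j <;> simp [Matrix.mul_apply]
      i_mul_j := by
        ext i j
        fin_cases i <;> fin_cases j <;> simp [Matrix.mul_apply]
      j_mul_i := by
        ext i j
        fin_cases i <;> fin_cases j <;> simp [Matrix.mul_apply] <;> ring }
  have hinj : Function.Injective q.liftHom.toLinearMap := by
    rw [injective_iff_map_eq_zero]
    intro v hv
    have hv' : algebraMap F _ v.re + v.imI • q.i + v.imJ • q.j + v.imK • q.k = 0 := hv
    have h00 := congrFun (congrFun hv' 0) 0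
    have h01 := congrFun (congrFun hv' 0) 1
    have h10 := congrFun (congrFun hv' 1) 0
    have h11 := congrFun (congrFun hv' 1) 1
    simp [q, Matrix.algebraMap_matrix_apply] at h00 h01 h10 h11
    have e0 : v.re = 0 := by
      apply (mul_eq_zero.1 (_ : 2 * v.re = 0)).resolve_left h2
      linear_combination h00 + h11
    have e2 : v.imJ = 0 := by
      apply (mul_eq_zero.1 (_ : (2 * b) * v.imJ = 0)).resolve_left (mul_ne_zero h2 hb)
      linear_combination h01 + b * h10
    rw [e0] at h00 h11
    rw [e2] at h01 h10
    -- The two remaining linear equations in the coefficients of i and k have determinant -(p² - b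
    -- r²) = -a, which is nonzero.
    have e1 : v.imI = 0 := by
      apply (mul_eq_zero.1 (_ : a * v.imI = 0)).resolve_left ha
      linear_combination p * h00 - b * r * h10 - v.imI * hpr
    have e3 : v.imK = 0 := by
      apply (mul_eq_zero.1 (_ : a * v.imK = 0)).resolve_left ha
      linear_combination r * h00 - p * h10 - v.imK * hpr
    ext <;> assumption
  have hfin := finite_quaternion (K := F) a b
  have hrank : Module.finrank F ℍ[F, a, b] = Module.finrank F (Matrix (Fin 2) (Fin 2) F) := by
    rw [finrank_quaternion, Module.finrank_matrix]
    simp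
  exact ⟨AlgEquiv.ofBijective q.liftHom
    ⟨hinj, (LinearMap.injective_iff_surjective_of_finrank_eq_finrank hrank).1 hinj⟩⟩

/-! ### Counting simple components -/

/-- The central idempotents of a ring. -/
def CentralIdempotent (A : Type*) [Ring A] : Type _ :=
  {e : A // e * e = e ∧ ∀ a, e * a = a * e}

/-- The centre of a simple ring is a field, so its only idempotents are 0 and 1. -/
theorem card_centralIdempotent_of_isSimpleRing (A : Type*) [Ring A] [IsSimpleRing A] :
    Nat.card (CentralIdempotent A) = 2 := by
  have hfield := IsSimpleRing.isField_center A
  have key : ∀ e : CentralIdempotent A, e.1 = 0 ∨ e.1 = 1 := by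
    rintro ⟨e, he, hc⟩
    let e' : Subring.center A := ⟨e, Subring.mem_center_iff.2 fun a => (hc a).symm⟩
    by_cases h0 : e' = 0
    · exact Or.inl (congrArg Subtype.val h0)
    · obtain ⟨f, hf⟩ := hfield.mul_inv_cancel h0
      right
      have hee : e' * e' = e' := Subtype.ext he
      have : e' = 1 := by
        rw [← hf]
        nth_rewrite 2 [← hee]
        rw [mul_assoc, hf, mul_one]
      exact congrArg Subtype.val this
  rw [Nat.card_eq_two_iff]
  refine ⟨⟨0, by simp⟩, ⟨1, by simp⟩, fun h => zero_ne_one (congrArg Subtype.val h), ?_⟩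
  ext e
  refine ⟨fun _ => trivial, fun _ => ?_⟩
  exact (key e).imp Subtype.ext Subtype.ext

/-- Central idempotents of a product. -/
def centralIdempotentPi {ι : Type*} [DecidableEq ι] (B : ι → Type*) [∀ i, Ring (B i)] :
    CentralIdempotent (∀ i, B i) ≃ ∀ i, CentralIdempotent (B i) where
  toFun e i := ⟨e.1 i, congrFun e.2.1 i, fun a => by
    have := congrFun (e.2.2 (Pi.single i a)) i
    simpa using this⟩
  invFun p := ⟨fun i => (p i).1, funext fun i => (p i).2.1, fun a => funext fun i => (p i).2.2 (a i)⟩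
  left_inv _ := rfl
  right_inv _ := rfl

/-- Central idempotents are preserved by isomorphisms. -/
def CentralIdempotent.congr {A B : Type*} [Ring A] [Ring B] (e : A ≃+* B) :
    CentralIdempotent A ≃ CentralIdempotent B :=
  e.toEquiv.subtypeEquiv fun a => by
    constructor
    · rintro ⟨h, hc⟩
      refine ⟨?_, fun b => ?_⟩
      · change e a * e a = e a
        rw [← map_mul, h]
      · obtain ⟨b, rfl⟩ := e.surjective b
        change e a * e b = e b * e a
        rw [← map_mul, hc, map_mul]
    · rintro ⟨h, hc⟩
      refine ⟨e.injective ?_, fun b => e.injective ?_⟩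
      · rw [map_mul]; exact h
      · rw [map_mul, map_mul]; exact hc (e b)

theorem card_centralIdempotent_of_hasSimpleComponents {K : Type v} [Field K] {A : Type u} [Ring A]
    [Algebra K A] {n : ℕ} (h : HasSimpleComponents K A n) :
    Nat.card (CentralIdempotent A) = 2 ^ n := by
  obtain ⟨B, _, _, hB, ⟨e⟩⟩ := h
  rw [Nat.card_congr (CentralIdempotent.congr e.toRingEquiv), Nat.card_congr (centralIdempotentPi B),
    Nat.card_pi]
  simp [card_centralIdempotent_of_isSimpleRing]

/-- The ring has 2^n central idempotents, which determines n. A bound proved for one decomposition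
thus holds for all. -/
theorem HasSimpleComponents.unique {K : Type v} [Field K] {A : Type u} [Ring A]
    [Algebra K A] {n n' : ℕ} (h : HasSimpleComponents K A n) (h' : HasSimpleComponents K A n') :
    n = n' :=
  Nat.pow_right_injective le_rfl ((card_centralIdempotent_of_hasSimpleComponents h).symm.trans
    (card_centralIdempotent_of_hasSimpleComponents h'))

theorem hasSimpleComponents_of_prod {K : Type v} [Field K] {A : Type u} [Ring A] [Algebra K A]
    {n k : ℕ} (B : Fin n → Type u) [rB : ∀ i, Ring (B i)] [aB : ∀ i, Algebra K (B i)]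
    (C : Fin k → Type u) [rC : ∀ j, Ring (C j)] [aC : ∀ j, Algebra K (C j)]
    (hB : ∀ i, IsSimpleRing (B i)) (hC : ∀ j, IsSimpleRing (C j))
    (e : A ≃ₐ[K] (∀ i, B i) × (∀ j, C j)) : HasSimpleComponents K A (n + k) := by
  let rD : ∀ s, Ring (Sum.elim B C s) := fun s => Sum.rec rB rC s
  let aD : ∀ s, Algebra K (Sum.elim B C s) := fun s => Sum.rec aB aC s
  have hD : ∀ s, IsSimpleRing (Sum.elim B C s) := fun s => Sum.rec hB hC s
  let E : ((∀ i, B i) × (∀ j, C j)) ≃ₐ[K] (∀ s, Sum.elim B C s) :=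
    { toFun := fun p s => Sum.rec p.1 p.2 s
      invFun := fun p => (fun i => p (Sum.inl i), fun j => p (Sum.inr j))
      left_inv := fun _ => rfl
      right_inv := fun p => by funext s; cases s <;> rfl
      map_mul' := fun p q => by funext s; cases s <;> rfl
      map_add' := fun p q => by funext s; cases s <;> rfl
      commutes' := fun r => by funext s; cases s <;> rfl }
  exact ⟨fun i => Sum.elim B C (finSumFinEquiv.symm i), fun i => rD _, fun i => aD _, fun i => hD _,
    ⟨(e.trans E).trans (AlgEquiv.piCongrLeft' K (Sum.elim B C) finSumFinEquiv)⟩⟩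

theorem IsSumFieldsSplitQuaternions.hasSimpleComponents {K : Type v} [Field K] {A : Type u} [Ring A]
    [Algebra K A] {n k : ℕ} (h : IsSumFieldsSplitQuaternions K A n k) :
    HasSimpleComponents K A (n + k) := by
  obtain ⟨E, _, _, Z, _, _, a, b, -, hM, ⟨e⟩⟩ := h
  refine hasSimpleComponents_of_prod E (fun j => ℍ[Z j, a j, b j]) (fun i => inferInstance)
    (fun j => ?_) e
  obtain ⟨f⟩ := hM j
  exact IsSimpleRing.of_ringEquiv f.symm.toRingEquiv inferInstance

/-! ### Decomposition of products of reduced algebras and quaternion algebras -/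

theorem exists_algEquiv_pi_field {K : Type v} [Field K] {S : Type u} [CommRing S] [Algebra K S]
    [Module.Finite K S] [IsReduced S] :
    ∃ (E : Fin (Nat.card (MaximalSpectrum S)) → Type u) (_ : ∀ i, Field (E i))
      (_ : ∀ i, Algebra K (E i)), Nonempty (S ≃ₐ[K] ∀ i, E i) := by
  have : IsArtinianRing S := IsArtinianRing.of_finite K S
  have : Finite (MaximalSpectrum S) := inferInstance
  let eq := Finite.equivFin (MaximalSpectrum S)
  exact ⟨fun i => S ⧸ (eq.symm i).asIdeal, fun i => Ideal.Quotient.field _, fun i => inferInstance,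
    ⟨((IsArtinianRing.equivPi S).restrictScalars K).trans
      (AlgEquiv.piCongrLeft' K (fun M : MaximalSpectrum S => S ⧸ M.asIdeal) eq)⟩⟩

section

variable {K : Type v} [Field K] {A T S : Type u} [Ring A] [Algebra K A] [CommRing T] [Algebra K T]
  [CommRing S] [Algebra K S] [Module.Finite K T] [Module.Finite K S] [IsReduced T] [IsReduced S]
  {a b : S}

theorem isSumFieldsQuaternions_of_algEquiv (ha : IsUnit a) (hb : IsUnit b)
    (e : A ≃ₐ[K] T × ℍ[S, a, b]) : IsSumFieldsQuaternions K A (Nat.card (MaximalSpectrum T))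
      (Nat.card (MaximalSpectrum S)) := by
  obtain ⟨E, fE, aE, ⟨eE⟩⟩ := exists_algEquiv_pi_field (K := K) (S := T)
  obtain ⟨Z, fZ, aZ, ⟨eZ⟩⟩ := exists_algEquiv_pi_field (K := K) (S := S)
  refine ⟨E, fE, aE, Z, fZ, aZ, fun j => eZ a j, fun j => eZ b j, fun j => ⟨?_, ?_⟩,
    ⟨e.trans (AlgEquiv.prodCongr eE (quaternionPi eZ a b))⟩⟩
  · exact ((ha.map eZ).map (Pi.evalRingHom Z j)).ne_zero
  · exact ((hb.map eZ).map (Pi.evalRingHom Z j)).ne_zero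

theorem isSumFieldsSplitQuaternions_of_algEquiv [Finite K] (h2 : (2 : K) ≠ 0) (ha : IsUnit a)
    (hb : IsUnit b) (e : A ≃ₐ[K] T × ℍ[S, a, b]) :
    IsSumFieldsSplitQuaternions K A (Nat.card (MaximalSpectrum T))
      (Nat.card (MaximalSpectrum S)) := by
  obtain ⟨E, fE, aE, ⟨eE⟩⟩ := exists_algEquiv_pi_field (K := K) (S := T)
  obtain ⟨Z, fZ, aZ, ⟨eZ⟩⟩ := exists_algEquiv_pi_field (K := K) (S := S)
  have ha' : ∀ j, eZ a j ≠ 0 := fun j => ((ha.map eZ).map (Pi.evalRingHom Z j)).ne_zero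
  have hb' : ∀ j, eZ b j ≠ 0 := fun j => ((hb.map eZ).map (Pi.evalRingHom Z j)).ne_zero
  refine ⟨E, fE, aE, Z, fZ, aZ, fun j => eZ a j, fun j => eZ b j, fun j => ⟨ha' j, hb' j⟩,
    fun j => ?_, ⟨e.trans (AlgEquiv.prodCongr eE (quaternionPi eZ a b))⟩⟩
  have : Finite S := Module.finite_of_finite K
  have : Finite (∀ j, Z j) := Finite.of_equiv S eZ.toEquiv
  have : Finite (Z j) := Finite.of_surjective _ (Function.surjective_eval (β := Z) j)
  refine nonempty_quaternion_algEquiv_matrix (fun h => h2 ?_) (ha' j) (hb' j)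
  apply (algebraMap K (Z j)).injective
  rw [map_ofNat, h, map_zero]

end

/-! ### The minus part of a commutative group algebra -/

/-- The quotient of the group algebra of `C` by the relation `z = -1`. -/
abbrev MinusAlgebra (K : Type*) [Field K] {C : Type*} [CommGroup C] (z : C) : Type _ :=
  MonoidAlgebra K C ⧸ Ideal.span {MonoidAlgebra.of K C z + 1}

section

variable (K : Type*) [Field K] {C : Type*} [CommGroup C]

/-- The projection onto the minus part. -/
noncomputable def minusMk (z : C) : MonoidAlgebra K C →ₐ[K] MinusAlgebra K z :=
  Ideal.Quotient.mkₐ K _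

theorem minusMk_surjective (z : C) : Function.Surjective (minusMk K z) :=
  Ideal.Quotient.mkₐ_surjective K _

theorem minusMk_of_self (z : C) : minusMk K z (MonoidAlgebra.of K C z) = -1 := by
  have h : minusMk K z (MonoidAlgebra.of K C z + 1) = 0 :=
    Ideal.Quotient.eq_zero_iff_mem.2 (Ideal.subset_span rfl)
  rw [map_add, map_one] at h
  exact eq_neg_of_add_eq_zero_left h

instance [Finite C] (z : C) : Module.Finite K (MinusAlgebra K z) :=
  Module.Finite.of_surjective (minusMk K z).toLinearMap (minusMk_surjective K z)

/-- By Maschke's theorem the group algebra is semisimple, hence so is its quotient, and a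
commutative semisimple ring is reduced. -/
theorem isReduced_minusAlgebra [Finite C] [NeZero (Nat.card C : K)] (z : C) :
    IsReduced (MinusAlgebra K z) := by
  have : IsSemisimpleRing (MinusAlgebra K z) :=
    RingHom.isSemisimpleRing_of_surjective (minusMk K z).toRingHom (minusMk_surjective K z)
  infer_instance

theorem finrank_monoidAlgebra (G : Type*) [Monoid G] [Finite G] :
    Module.finrank K (MonoidAlgebra K G) = Nat.card G := by
  have := Fintype.ofFinite G
  rw [Module.finrank_eq_card_basis (MonoidAlgebra.basis G K), Nat.card_eq_fintype_card]

/-- The ideal generated by z + 1 is spanned by the elements c(z + 1), and c and cz give the same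
one, so its dimension is at most half the order of C. This lower bound for the quotient is all that
the dimension count needs. -/
theorem card_le_two_mul_finrank_minusAlgebra [Finite C] {z : C} (hz : z ^ 2 = 1) (hz1 : z ≠ 1) :
    Nat.card C ≤ 2 * Module.finrank K (MinusAlgebra K z) := by
  have := Fintype.ofFinite (C ⧸ Subgroup.zpowers z)
  let g : MonoidAlgebra K C := MonoidAlgebra.of K C z + 1
  let b : C ⧸ Subgroup.zpowers z → MonoidAlgebra K C := fun q => MonoidAlgebra.of K C q.out * g
  have hzg : MonoidAlgebra.of K C z * g = g := by
    change MonoidAlgebra.of K C z * (MonoidAlgebra.of K C z + 1) = MonoidAlgebra.of K C z + 1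
    rw [mul_add, mul_one, ← map_mul, ← pow_two, hz, map_one, add_comm]
  have hwg : ∀ w ∈ Subgroup.zpowers z, MonoidAlgebra.of K C w * g = g := by
    intro w hw
    obtain ⟨n, rfl⟩ := (isOfFinOrder_of_finite z).mem_powers_iff_mem_zpowers.2 hw
    change MonoidAlgebra.of K C (z ^ n) * g = g
    induction n with
    | zero => rw [pow_zero, map_one, one_mul]
    | succ n ih =>
      rw [pow_succ, map_mul, mul_assoc, hzg]
      exact ih (Subgroup.npow_mem_zpowers z n)
  have hker : LinearMap.ker (minusMk K z).toLinearMap ≤ Submodule.span K (Set.range b) := by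
    intro α hα
    have hα' : α ∈ Ideal.span {g} := Ideal.Quotient.eq_zero_iff_mem.1 hα
    obtain ⟨β, rfl⟩ := Ideal.mem_span_singleton'.1 hα'
    clear hα hα'
    induction β using MonoidAlgebra.induction_on with
    | of c =>
      obtain ⟨w, hw⟩ := QuotientGroup.mk_out_eq_mul (Subgroup.zpowers z) c
      have : MonoidAlgebra.of K C c * g = b (c : C ⧸ Subgroup.zpowers z) := by
        simp only [b]
        rw [hw, map_mul, mul_assoc, hwg _ w.2]
      rw [this]
      exact Submodule.subset_span ⟨_, rfl⟩
    | add x y hx hy => rw [add_mul]; exact add_mem hx hy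
    | smul r x hx => rw [smul_mul_assoc]; exact Submodule.smul_mem _ r hx
  have h1 := LinearMap.finrank_range_add_finrank_ker (minusMk K z).toLinearMap
  have hrange : LinearMap.range (minusMk K z).toLinearMap = ⊤ :=
    LinearMap.range_eq_top.2 (minusMk_surjective K z)
  rw [hrange, finrank_top, finrank_monoidAlgebra] at h1
  have h2 := (Submodule.finrank_mono hker).trans (finrank_range_le_card b)
  have h3 := Subgroup.card_eq_card_quotient_mul_card_subgroup (Subgroup.zpowers z)
  rw [Nat.card_zpowers, orderOf_eq_prime hz hz1, Nat.card_eq_fintype_card (α := C ⧸ _)] at h3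
  omega

theorem exists_algHom_minusAlgebra_iff {L : Type*} [Field L] [Algebra K L] {z : C} (χ : C →* Lˣ) :
    (∃ f : MinusAlgebra K z →ₐ[K] L, ∀ c, f (minusMk K z (MonoidAlgebra.of K C c)) = χ c) ↔
      χ z = -1 := by
  constructor
  · rintro ⟨f, hf⟩
    apply Units.ext
    rw [← hf, minusMk_of_self, map_neg, map_one, Units.val_neg, Units.val_one]
  · intro h
    let F : MonoidAlgebra K C →ₐ[K] L := MonoidAlgebra.lift K L C ((Units.coeHom L).comp χ)
    have hF : ∀ c, F (MonoidAlgebra.of K C c) = χ c := fun c => MonoidAlgebra.lift_of _ c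
    refine ⟨Ideal.Quotient.liftₐ _ F fun α hα => ?_, fun c => hF c⟩
    obtain ⟨β, rfl⟩ := Ideal.mem_span_singleton'.1 hα
    rw [map_mul, map_add, hF, h, map_one, Units.val_neg, Units.val_one, neg_add_cancel, mul_zero]

end

/-! ### Decomposition of the group algebra -/

section

variable {K : Type*} [Field K] {G : Type*} [Group G] {S : Type*} [CommRing S] [Algebra K S]
  {a b : S}

theorem inv_two_smul_add_self {M : Type*} [AddCommGroup M] [Module K M] (h2 : (2 : K) ≠ 0) (m : M) :
    (2 : K)⁻¹ • (m + m) = m := by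
  rw [← two_smul K m, smul_smul, inv_mul_cancel₀ h2, one_smul]

theorem lift_abelianization_surjective :
    Function.Surjective (MonoidAlgebra.lift K (MonoidAlgebra K (Abelianization G)) G
      ((MonoidAlgebra.of K (Abelianization G)).comp Abelianization.of)) := by
  intro α
  rw [← AlgHom.mem_range]
  induction α using MonoidAlgebra.induction_on with
  | of c =>
    obtain ⟨g, rfl⟩ := QuotientGroup.mk_surjective c
    exact ⟨MonoidAlgebra.of K G g, MonoidAlgebra.lift_of _ g⟩
  | add x y hx hy => exact add_mem hx hy
  | smul r x hx => exact Subalgebra.smul_mem _ hx r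

theorem lift_quaternion_surjective {h : MonoidAlgebra K (Subgroup.center G) →ₐ[K] S}
    (hh : Function.Surjective h) {φ : G →* ℍ[S, a, b]}
    (hφ : ∀ c : Subgroup.center G, φ c = algebraMap S ℍ[S, a, b] (h (MonoidAlgebra.of K _ c)))
    {x y : G} (hx : φ x = ⟨0, 1, 0, 0⟩) (hy : φ y = ⟨0, 0, 1, 0⟩) :
    Function.Surjective (MonoidAlgebra.lift K ℍ[S, a, b] G φ) := by
  have hof : ∀ g, φ g ∈ (MonoidAlgebra.lift K ℍ[S, a, b] G φ).range := fun g =>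
    ⟨MonoidAlgebra.of K G g, MonoidAlgebra.lift_of _ g⟩
  have hs : ∀ s, algebraMap S ℍ[S, a, b] s ∈ (MonoidAlgebra.lift K ℍ[S, a, b] G φ).range := by
    intro s
    obtain ⟨β, rfl⟩ := hh s
    induction β using MonoidAlgebra.induction_on with
    | of c => rw [← hφ]; exact hof _
    | add x y hx hy => rw [map_add, map_add]; exact add_mem hx hy
    | smul r x hx =>
      rw [map_smul, Algebra.algebraMap_eq_smul_one, smul_assoc, ← Algebra.algebraMap_eq_smul_one]
      exact Subalgebra.smul_mem _ hx r
  intro v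
  rw [← AlgHom.mem_range]
  have hv : v = algebraMap S _ v.re + algebraMap S _ v.imI * φ x + algebraMap S _ v.imJ * φ y +
      algebraMap S _ v.imK * (φ x * φ y) := by
    rw [hx, hy]
    simp only [QuaternionAlgebra.algebraMap_eq]
    ext <;> simp
  rw [hv]
  exact add_mem (add_mem (add_mem (hs _) (mul_mem (hs _) (hof _))) (mul_mem (hs _) (hof _)))
    (mul_mem (hs _) (mul_mem (hof _) (hof _)))

/-- The group algebra of a group with a commutator subgroup of order two, as the product of the
group algebra of the abelianization and a quaternion algebra. -/
theorem nonempty_algEquiv_prod [Finite G] [Module.Finite K S] (h2 : (2 : K) ≠ 0) {z : G}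
    (hab : Abelianization.of z = 1) {φ : G →* ℍ[S, a, b]} (hz : φ z = -1)
    (hφ : Function.Surjective (MonoidAlgebra.lift K ℍ[S, a, b] G φ))
    (hcard : Nat.card G ≤ Nat.card (Abelianization G) + 4 * Module.finrank K S) :
    Nonempty (MonoidAlgebra K G ≃ₐ[K] MonoidAlgebra K (Abelianization G) × ℍ[S, a, b]) := by
  let P := MonoidAlgebra.lift K (MonoidAlgebra K (Abelianization G)) G
      ((MonoidAlgebra.of K (Abelianization G)).comp Abelianization.of)
  let Q := MonoidAlgebra.lift K ℍ[S, a, b] G φ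
  have hPz : P (MonoidAlgebra.of K G z) = 1 := by
    refine (MonoidAlgebra.lift_of _ z).trans ?_
    rw [MonoidHom.comp_apply, hab, map_one]
  have hQz : Q (MonoidAlgebra.of K G z) = -1 := (MonoidAlgebra.lift_of _ z).trans hz
  let Φ : MonoidAlgebra K G →ₐ[K] MonoidAlgebra K (Abelianization G) × ℍ[S, a, b] := P.prod Q
  have hsurj : Function.Surjective Φ := by
    rintro ⟨s, t⟩
    obtain ⟨α, rfl⟩ := lift_abelianization_surjective (K := K) (G := G) s
    obtain ⟨β, rfl⟩ := hφ t
    -- The idempotents (1 ± z)/2 separate the factors, since z maps to 1 in the first and to -1 in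
    -- the second.
    refine ⟨(2 : K)⁻¹ • (α * (1 + MonoidAlgebra.of K G z)) +
      (2 : K)⁻¹ • (β * (1 - MonoidAlgebra.of K G z)), ?_⟩
    refine Prod.ext ?_ ?_
    · change P _ = P α
      rw [map_add, map_smul, map_smul, map_mul, map_mul, map_add, map_sub, hPz, map_one, sub_self,
        mul_zero, smul_zero, add_zero, mul_add, mul_one, inv_two_smul_add_self h2]
    · change Q _ = Q β
      rw [map_add, map_smul, map_smul, map_mul, map_mul, map_add, map_sub, hQz, map_one,
        add_neg_cancel, mul_zero, smul_zero, zero_add, sub_neg_eq_add, mul_add, mul_one,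
        inv_two_smul_add_self h2]
  have hfin := finite_quaternion (K := K) a b
  have : Finite (Abelianization G) := inferInstanceAs (Finite (G ⧸ commutator G))
  have hle := LinearMap.finrank_le_finrank_of_surjective (f := Φ.toLinearMap) hsurj
  -- Surjectivity gives one inequality of dimensions and `hcard` the other, so the surjection is
  -- bijective.
  have hrank : Module.finrank K (MonoidAlgebra K G) =
      Module.finrank K (MonoidAlgebra K (Abelianization G) × ℍ[S, a, b]) := by
    refine le_antisymm ?_ hle
    rw [Module.finrank_prod, finrank_quaternion, finrank_monoidAlgebra, finrank_monoidAlgebra]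
    exact hcard
  exact ⟨AlgEquiv.ofBijective Φ
    ⟨(LinearMap.injective_iff_surjective_of_finrank_eq_finrank hrank
      (f := Φ.toLinearMap)).2 hsurj, hsurj⟩⟩

end

/-! ### Homomorphisms to quaternion algebras -/

section

variable {S : Type*} [CommRing S] (ua ub : Sˣ)

/-- The first standard generator of a quaternion algebra, as a unit. -/
def quaternionUnitI : ℍ[S, (ua : S), (ub : S)]ˣ :=
  ⟨⟨0, 1, 0, 0⟩, ⟨0, (ua⁻¹ : Sˣ), 0, 0⟩, by ext <;> simp, by ext <;> simp⟩

/-- The second standard generator of a quaternion algebra, as a unit. -/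
def quaternionUnitJ : ℍ[S, (ua : S), (ub : S)]ˣ :=
  ⟨⟨0, 0, 1, 0⟩, ⟨0, 0, (ub⁻¹ : Sˣ), 0⟩, by ext <;> simp, by ext <;> simp⟩

theorem coe_quaternionUnitI : (quaternionUnitI ua ub : ℍ[S, (ua : S), (ub : S)]) = ⟨0, 1, 0, 0⟩ :=
  rfl

theorem coe_quaternionUnitJ : (quaternionUnitJ ua ub : ℍ[S, (ua : S), (ub : S)]) = ⟨0, 0, 1, 0⟩ :=
  rfl

end

namespace D5Model

variable {n₁ m₂ m₃ m₄ : ℕ}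

/-- The central generators, as elements of the centre. -/
noncomputable def centralGen (n₁ m₂ m₃ m₄ : ℕ) (t : D5Gen) (ht : t = .t₁ ∨ t = .t₂ ∨ t = .t₃) :
    Subgroup.center (Ext n₁ m₂ m₃ m₄) :=
  ⟨(genImage n₁ m₂ m₃ t, 1), (mem_center_ext_iff _).2 ((mem_center_iff _).1 (genImage_central t ht))⟩

/-- The embedding of the cyclic direct factor into the centre. -/
noncomputable def centralInr (n₁ m₂ m₃ m₄ : ℕ) :
    Multiplicative (ZMod (2 ^ m₄)) →* Subgroup.center (Ext n₁ m₂ m₃ m₄) :=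
  (MonoidHom.inr _ _).codRestrict _ fun _ => (mem_center_ext_iff _).2 ⟨map_zero _, map_zero _⟩

theorem genImage_pow_eq_one {t : D5Gen} {N : ℕ} (h : gen n₁ m₂ m₃ t ^ N = 1) :
    genImage n₁ m₂ m₃ t ^ N = 1 := by
  rw [← ofPresented_of, ← map_pow, h, map_one]

theorem two_dvd_val_of_parity {m : ℕ} {a : ZMod (2 ^ (m + 1))} (h : zmodParity m a = 0) :
    2 ∣ a.val := by
  rw [← ZMod.natCast_zmod_val a, map_natCast] at h
  exact (ZMod.natCast_eq_zero_iff _ _).1 h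

theorem center_eq_mul (c : Subgroup.center (Ext n₁ m₂ m₃ m₄)) :
    ∃ i j k : ℕ, c = centralGen n₁ m₂ m₃ m₄ .t₁ (by simp) ^ i *
      centralGen n₁ m₂ m₃ m₄ .t₂ (by simp) ^ j * centralGen n₁ m₂ m₃ m₄ .t₃ (by simp) ^ k *
      centralInr n₁ m₂ m₃ m₄ c.1.2 := by
  obtain ⟨hx, hy⟩ := (mem_center_ext_iff c.1).1 c.2
  obtain ⟨j, hj⟩ := two_dvd_val_of_parity hx
  obtain ⟨k, hk⟩ := two_dvd_val_of_parity hy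
  refine ⟨c.1.1.t.val, j, k, Subtype.ext (Prod.ext ?_ ?_)⟩
  · change c.1.1 = genImage n₁ m₂ m₃ .t₁ ^ c.1.1.t.val * genImage n₁ m₂ m₃ .t₂ ^ j *
      genImage n₁ m₂ m₃ .t₃ ^ k * 1
    conv_lhs => rw [eq_mul_pow c.1.1]
    rw [hj, hk, pow_mul, pow_mul, mul_one, ← ofPresented_of .x, ← ofPresented_of .y, ← map_pow,
      ← map_pow (ofPresented n₁ m₂ m₃) _ 2, gen_x_sq, gen_y_sq, ofPresented_of, ofPresented_of]
  · change c.1.2 = 1 ^ _ * 1 ^ _ * 1 ^ _ * c.1.2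
    simp

theorem centralGen_pow (n₁ m₂ m₃ m₄ : ℕ) :
    ((centralGen n₁ m₂ m₃ m₄ .t₁ (by simp) ^ 2 ^ n₁ : Subgroup.center (Ext n₁ m₂ m₃ m₄)) :
      Ext n₁ m₂ m₃ m₄) = extZ n₁ m₂ m₃ m₄ := by
  refine Prod.ext ?_ ?_
  · change genImage n₁ m₂ m₃ .t₁ ^ 2 ^ n₁ = _
    rw [pow_eq_of_x _ rfl]
    ext <;> simp [genImage, extZ, zmodHalf_one]
  · change (1 : Multiplicative (ZMod (2 ^ m₄))) ^ _ = 1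
    exact one_pow _

/-- The parameters are forced: a = χ(t₂) and b = χ(t₃) because x² = t₂ and y² = t₃, and ij = -ji
reflects that the commutator goes to -1. The homomorphism is defined through the presentation, so
only the relations have to be checked; the cyclic factor is sent to scalars, which commute with
everything. -/
theorem exists_hom_quaternion {S : Type*} [CommRing S]
    (χ : Subgroup.center (Ext n₁ m₂ m₃ m₄) →* S)
    (hχ : ∀ c : Subgroup.center (Ext n₁ m₂ m₃ m₄), (c : Ext n₁ m₂ m₃ m₄) = extZ n₁ m₂ m₃ m₄ →
      χ c = -1) :
    ∃ a b : S, IsUnit a ∧ IsUnit b ∧ ∃ φ : Ext n₁ m₂ m₃ m₄ →* ℍ[S, a, b],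
      (∀ c : Subgroup.center (Ext n₁ m₂ m₃ m₄), φ c = algebraMap S ℍ[S, a, b] (χ c)) ∧
      φ (⟨0, 1, 0⟩, 1) = ⟨0, 1, 0, 0⟩ ∧ φ (⟨0, 0, 1⟩, 1) = ⟨0, 0, 1, 0⟩ := by
  let T := fun t ht => centralGen n₁ m₂ m₃ m₄ t ht
  let ua : Sˣ := χ.toHomUnits (T .t₂ (by simp))
  let ub : Sˣ := χ.toHomUnits (T .t₃ (by simp))
  refine ⟨ua, ub, ua.isUnit, ub.isUnit, ?_⟩
  let χu : Subgroup.center (Ext n₁ m₂ m₃ m₄) →* ℍ[S, (ua : S), (ub : S)]ˣ :=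
    ((algebraMap S ℍ[S, (ua : S), (ub : S)] : S →* ℍ[S, (ua : S), (ub : S)]).comp χ).toHomUnits
  have hχu : ∀ c, (χu c : ℍ[S, (ua : S), (ub : S)]) = algebraMap S ℍ[S, (ua : S), (ub : S)] (χ c) :=
    fun c => rfl
  have hcomm : ∀ c (u : ℍ[S, (ua : S), (ub : S)]ˣ), χu c * u = u * χu c := fun c u =>
    Units.ext (by rw [Units.val_mul, Units.val_mul, hχu]; exact Algebra.commutes _ _)
  let I := quaternionUnitI ua ub
  let J := quaternionUnitJ ua ub
  have hI : I ^ 2 = χu (T .t₂ (by simp)) := by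
    rw [pow_two]
    apply Units.ext
    rw [hχu, QuaternionAlgebra.algebraMap_eq, Units.val_mul, coe_quaternionUnitI]
    change _ = (⟨(ua : S), 0, 0, 0⟩ : ℍ[S, (ua : S), (ub : S)])
    ext <;> simp
  have hJ : J ^ 2 = χu (T .t₃ (by simp)) := by
    rw [pow_two]
    apply Units.ext
    rw [hχu, QuaternionAlgebra.algebraMap_eq, Units.val_mul, coe_quaternionUnitJ]
    change _ = (⟨(ub : S), 0, 0, 0⟩ : ℍ[S, (ua : S), (ub : S)])
    ext <;> simp
  have hIJ : I⁻¹ * J⁻¹ * I * J = χu (T .t₁ (by simp)) ^ 2 ^ n₁ := by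
    have h1 : (χu (T .t₁ (by simp) ^ 2 ^ n₁) : ℍ[S, (ua : S), (ub : S)]) = -1 := by
      rw [hχu, hχ _ (centralGen_pow n₁ m₂ m₃ m₄), map_neg, map_one]
    rw [← map_pow, mul_assoc, ← mul_inv_rev, inv_mul_eq_iff_eq_mul]
    apply Units.ext
    rw [Units.val_mul _ (χu _), h1, Units.val_mul, Units.val_mul, coe_quaternionUnitI,
      coe_quaternionUnitJ]
    ext <;> simp
  let gens : D5Gen → ℍ[S, (ua : S), (ub : S)]ˣ := fun g => match g with
    | .x => I
    | .y => J
    | .t₁ => χu (T .t₁ (by simp))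
    | .t₂ => χu (T .t₂ (by simp))
    | .t₃ => χu (T .t₃ (by simp))
  have hpow : ∀ t ht N, gen n₁ m₂ m₃ t ^ N = 1 → χu (T t ht) ^ N = 1 := by
    intro t ht N h
    rw [← map_pow]
    convert map_one χu
    exact Subtype.ext (Prod.ext (genImage_pow_eq_one h) (one_pow N))
  have hrel : ∀ r ∈ d5Rels (n₁ + 1) m₂ m₃, FreeGroup.lift gens r = 1 := by
    have hc : ∀ c g, FreeGroup.lift gens c = 1 ∨ (∃ d, FreeGroup.lift gens c = χu d) →
        FreeGroup.lift gens (c * FreeGroup.of g * c⁻¹ * (FreeGroup.of g)⁻¹) = 1 := by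
      rintro c g (h | ⟨d, h⟩)
      · simp [h]
      · rw [map_mul, map_mul, map_mul, map_inv, map_inv, h, hcomm, mul_inv_cancel_right,
          mul_inv_cancel]
    rintro r (hr | ⟨t, ht, g, rfl⟩)
    · simp only [Set.mem_insert_iff, Set.mem_singleton_iff] at hr
      rcases hr with rfl | rfl | rfl | rfl | rfl | rfl
      · rw [map_pow, FreeGroup.lift_apply_of]
        exact hpow .t₁ (by simp) _ (gen_t₁_pow n₁ m₂ m₃)
      · rw [map_pow, FreeGroup.lift_apply_of]
        exact hpow .t₂ (by simp) _ (gen_t₂_pow n₁ m₂ m₃)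
      · rw [map_pow, FreeGroup.lift_apply_of]
        exact hpow .t₃ (by simp) _ (gen_t₃_pow n₁ m₂ m₃)
      · rw [map_mul, map_inv, map_pow, FreeGroup.lift_apply_of, FreeGroup.lift_apply_of,
          mul_inv_eq_one]
        exact hI
      · rw [map_mul, map_inv, map_pow, FreeGroup.lift_apply_of, FreeGroup.lift_apply_of,
          mul_inv_eq_one]
        exact hJ
      · simp only [map_mul, map_inv, map_pow, FreeGroup.lift_apply_of]
        rw [mul_inv_eq_one]
        exact hIJ
    · simp only [Set.mem_insert_iff, Set.mem_singleton_iff] at ht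
      rcases ht with rfl | rfl | rfl
      · exact hc _ g (Or.inr ⟨_, FreeGroup.lift_apply_of⟩)
      · exact hc _ g (Or.inr ⟨_, FreeGroup.lift_apply_of⟩)
      · exact hc _ g (Or.inr ⟨_, FreeGroup.lift_apply_of⟩)
  let φ₁ : D5Model n₁ m₂ m₃ →* ℍ[S, (ua : S), (ub : S)]ˣ :=
    (PresentedGroup.toGroup hrel).comp (presentedEquiv n₁ m₂ m₃).symm.toMonoidHom
  have hφ₁ : ∀ g, φ₁ (genImage n₁ m₂ m₃ g) = gens g := by
    intro g
    change PresentedGroup.toGroup hrel ((presentedEquiv n₁ m₂ m₃).symm _) = _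
    rw [← presentedEquiv_of, MulEquiv.symm_apply_apply, PresentedGroup.toGroup.of]
  let φ₄ : Multiplicative (ZMod (2 ^ m₄)) →* ℍ[S, (ua : S), (ub : S)]ˣ :=
    χu.comp (centralInr n₁ m₂ m₃ m₄)
  let φu : Ext n₁ m₂ m₃ m₄ →* ℍ[S, (ua : S), (ub : S)]ˣ :=
    φ₁.noncommCoprod φ₄ fun g d => (hcomm _ _).symm
  have hφu : ∀ g d, φu (g, d) = φ₁ g * φ₄ d := fun g d => rfl
  refine ⟨(Units.coeHom _).comp φu, fun c => ?_, ?_, ?_⟩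
  · change (φu c : ℍ[S, (ua : S), (ub : S)]) = _
    rw [← hχu]
    congr 1
    have hg : ∀ t ht, φu (T t ht) = χu (T t ht) := by
      intro t ht
      change φu (genImage n₁ m₂ m₃ t, 1) = _
      rw [hφu, hφ₁, map_one, mul_one]
      rcases ht with rfl | rfl | rfl <;> rfl
    have hd : ∀ d, φu (centralInr n₁ m₂ m₃ m₄ d) = χu (centralInr n₁ m₂ m₃ m₄ d) := by
      intro d
      change φu (1, d) = _
      rw [hφu, map_one, one_mul]
      rfl
    obtain ⟨i, j, k, h⟩ := center_eq_mul c
    rw [h]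
    simp only [Subgroup.coe_mul, Subgroup.coe_pow, map_mul, map_pow, hd]
    rw [hg, hg, hg]
  · change (φu (genImage n₁ m₂ m₃ .x, 1) : ℍ[S, (ua : S), (ub : S)]) = _
    rw [hφu, hφ₁, map_one, mul_one]
    rfl
  · change (φu (genImage n₁ m₂ m₃ .y, 1) : ℍ[S, (ua : S), (ub : S)]) = _
    rw [hφu, hφ₁, map_one, mul_one]
    rfl

end D5Model

/-! ### Groups isomorphic to the model -/

namespace D5Model

section

variable {G : Type u} [Group G] {n₁ m₂ m₃ m₄ : ℕ} (Ψ : G ≃* Ext n₁ m₂ m₃ m₄)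

/-- The nontrivial commutator. -/
noncomputable def commZ : G := Ψ.symm (extZ n₁ m₂ m₃ m₄)

/-- The projection onto the abelianization. -/
noncomputable def toAb : G →* RankFour n₁ (m₂ + 1) (m₃ + 1) m₄ :=
  (toRankFour n₁ m₂ m₃ m₄).comp Ψ.toMonoidHom

theorem toAb_surjective : Function.Surjective (toAb Ψ) :=
  (toRankFour_surjective m₄).comp Ψ.surjective

theorem toAb_eq_one_iff (g : G) : toAb Ψ g = 1 ↔ g = 1 ∨ g = commZ Ψ := by
  refine (toRankFour_eq_one_iff m₄ (Ψ g)).trans (or_congr ?_ ?_)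
  · exact map_eq_one_iff Ψ Ψ.injective
  · exact (MulEquiv.eq_symm_apply Ψ).symm

theorem commZ_mem_commutator : commZ Ψ ∈ commutator G := by
  rw [commZ, extZ_eq, map_mul, map_mul, map_mul, map_inv, map_inv]
  generalize Ψ.symm _ = x
  generalize Ψ.symm _ = y
  have h := Subgroup.commutator_mem_commutator (Subgroup.mem_top x⁻¹) (Subgroup.mem_top y⁻¹)
  rwa [commutatorElement_def, inv_inv, inv_inv] at h

theorem mem_center_iff_map {g : G} :
    g ∈ Subgroup.center G ↔ Ψ g ∈ Subgroup.center (Ext n₁ m₂ m₃ m₄) := by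
  simp only [Subgroup.mem_center_iff]
  refine ⟨fun h e => ?_, fun h e => ?_⟩
  · obtain ⟨e, rfl⟩ := Ψ.surjective e
    rw [← map_mul, ← map_mul, h]
  · apply Ψ.injective
    rw [map_mul, map_mul, h]

theorem commZ_mem_center : commZ Ψ ∈ Subgroup.center G := by
  rw [mem_center_iff_map Ψ, commZ, MulEquiv.apply_symm_apply, mem_center_ext_iff]
  exact ⟨map_zero _, map_zero _⟩

theorem commZ_ne_one : commZ Ψ ≠ 1 := fun h =>
  extZ_ne_one m₄ ((MulEquiv.symm_apply_eq Ψ).1 h |>.trans (map_one Ψ))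

theorem mem_center_iff_toAb (g : G) :
    g ∈ Subgroup.center G ↔ toAb Ψ g ∈ parityClass n₁ m₂ m₃ m₄ 0 0 := by
  rw [mem_center_iff_map Ψ, mem_center_ext_iff]
  rfl

/-- The abelianization, as a product of cyclic groups. -/
noncomputable def abEquiv : Abelianization G ≃* RankFour n₁ (m₂ + 1) (m₃ + 1) m₄ :=
  abelianizationEquiv (toAb_surjective Ψ) (toAb_eq_one_iff Ψ) (commZ_mem_commutator Ψ)

/-- The centre, as a product of cyclic groups. -/
noncomputable def centerIso : Subgroup.center G ≃* RankFour (n₁ + 1) m₂ m₃ m₄ :=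
  (Subgroup.centerCongr Ψ).trans (centerEquiv n₁ m₂ m₃ m₄).symm

/-- The nontrivial commutator, as an element of the centre. -/
noncomputable def centerZ : Subgroup.center G := ⟨commZ Ψ, commZ_mem_center Ψ⟩

theorem centerZ_ne_one : centerZ Ψ ≠ 1 := fun h => commZ_ne_one Ψ (congrArg Subtype.val h)

theorem centerIso_centerZ :
    centerIso Ψ (centerZ Ψ) = (Multiplicative.ofAdd (zmodHalf n₁ 1), 1, 1, 1) := by
  change (centerEquiv n₁ m₂ m₃ m₄).symm _ = _
  rw [MulEquiv.symm_apply_eq]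
  apply Subtype.ext
  rw [coe_centerEquiv]
  change Ψ (Ψ.symm (extZ n₁ m₂ m₃ m₄)) = _
  rw [MulEquiv.apply_symm_apply]
  refine Prod.ext ?_ rfl
  change D5Model.mk _ _ _ = D5Model.mk _ _ _
  congr 1
  · exact (map_zero _).symm
  · exact (map_zero _).symm

theorem centerZ_sq : centerZ Ψ ^ 2 = 1 := by
  apply (centerIso Ψ).injective
  rw [map_pow, centerIso_centerZ, (centerIso Ψ).map_one]
  have h : 2 • zmodHalf n₁ 1 = 0 := by
    rw [← map_nsmul]
    exact (zmodHalf n₁).map_zero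
  exact Prod.ext (congrArg Multiplicative.ofAdd h)
    (Prod.ext (one_pow 2) (Prod.ext (one_pow 2) (one_pow 2)))

end

section

variable {G : Type u} [Group G] {n₁ m₂ m₃ m₄ : ℕ}

theorem card_eq (Ψ : G ≃* Ext n₁ m₂ m₃ m₄) : Nat.card G = 2 ^ (n₁ + m₂ + m₃ + m₄ + 3) :=
  (Nat.card_congr Ψ.toEquiv).trans card_ext

theorem card_abelianization (Ψ : G ≃* Ext n₁ m₂ m₃ m₄) :
    Nat.card (Abelianization G) = 2 ^ (n₁ + m₂ + m₃ + m₄ + 2) := by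
  rw [Nat.card_congr (abEquiv Ψ).toEquiv, card_rankFour]
  congr 1
  omega

theorem card_center (Ψ : G ≃* Ext n₁ m₂ m₃ m₄) :
    Nat.card (Subgroup.center G) = 2 ^ (n₁ + m₂ + m₃ + m₄ + 1) := by
  rw [Nat.card_congr (centerIso Ψ).toEquiv, card_rankFour]
  congr 1
  omega

theorem pow_eq_one (Ψ : G ≃* Ext n₁ m₂ m₃ m₄) (g : G) : g ^ 2 ^ (n₁ + m₂ + m₃ + m₄ + 3) = 1 := by
  rw [← card_eq Ψ]
  exact pow_card_eq_one'

theorem center_pow_eq_one (Ψ : G ≃* Ext n₁ m₂ m₃ m₄) (c : Subgroup.center G) :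
    c ^ 2 ^ (n₁ + m₂ + m₃ + m₄ + 3) = 1 :=
  Subtype.ext (pow_eq_one Ψ c.1)

theorem abelianization_pow_eq_one (Ψ : G ≃* Ext n₁ m₂ m₃ m₄) (a : Abelianization G) :
    a ^ 2 ^ (n₁ + m₂ + m₃ + m₄ + 3) = 1 := by
  obtain ⟨g, rfl⟩ := QuotientGroup.mk_surjective a
  exact congrArg Abelianization.of (pow_eq_one Ψ g)

theorem dual_pow_eq_one (Ψ : G ≃* Ext n₁ m₂ m₃ m₄) {A : Type*} [CommGroup A]
    (χ : Subgroup.center G →* A) : χ ^ 2 ^ (n₁ + m₂ + m₃ + m₄ + 3) = 1 := by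
  ext c
  rw [MonoidHom.pow_apply, ← map_pow, center_pow_eq_one Ψ, map_one, MonoidHom.one_apply]

theorem exists_exponent_eq (Ψ : G ≃* Ext n₁ m₂ m₃ m₄) : ∃ j, Monoid.exponent G = 2 ^ (j + 1) := by
  obtain ⟨j, -, hj⟩ := (Nat.dvd_prime_pow Nat.prime_two).1
    (Monoid.exponent_dvd_of_forall_pow_eq_one (pow_eq_one Ψ))
  cases j with
  | zero =>
    have h := Monoid.pow_exponent_eq_one (commZ Ψ)
    rw [hj, pow_zero, pow_one] at h
    exact absurd h (commZ_ne_one Ψ)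
  | succ j => exact ⟨j, hj⟩

theorem parityClass_mul {a d : ℕ} {i j i' j' : ZMod 2} {u v : RankFour a (m₂ + 1) (m₃ + 1) d}
    (hu : u ∈ parityClass a m₂ m₃ d i j) (hv : v ∈ parityClass a m₂ m₃ d i' j') :
    u * v ∈ parityClass a m₂ m₃ d (i + i') (j + j') := by
  obtain ⟨rfl, rfl⟩ := hu
  obtain ⟨rfl, rfl⟩ := hv
  exact ⟨map_add _ _ _, map_add _ _ _⟩

theorem parityClass_inv {a d : ℕ} {i j : ZMod 2} {u : RankFour a (m₂ + 1) (m₃ + 1) d}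
    (hu : u ∈ parityClass a m₂ m₃ d i j) : u⁻¹ ∈ parityClass a m₂ m₃ d (-i) (-j) := by
  obtain ⟨rfl, rfl⟩ := hu
  exact ⟨map_neg _ _, map_neg _ _⟩

/-- The centre is the preimage of the even parity class, so the coset Z(G)w maps onto the whole
parity class of the image of w. -/
theorem numKClassesInvolving_eq (Ψ : G ≃* Ext n₁ m₂ m₃ m₄) {w : G} {i j : ZMod 2}
    (hw : toAb Ψ w ∈ parityClass n₁ m₂ m₃ m₄ i j) (hij : i ≠ 0 ∨ j ≠ 0) :
    numKClassesInvolving ℚ w = cyclicCount (parityClass n₁ m₂ m₃ m₄ i j) := by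
  obtain ⟨e, he⟩ := exists_exponent_eq Ψ
  rw [numKClassesInvolving_rat (toAb_surjective Ψ) (toAb_eq_one_iff Ψ) (pow_eq_one Ψ) he]
  · congr 1
    ext u
    constructor
    · rintro ⟨_, ⟨a, ha, rfl⟩, rfl⟩
      have h := parityClass_mul ((mem_center_iff_toAb Ψ a).1 ha) hw
      rwa [zero_add, zero_add, ← map_mul] at h
    · intro hu
      obtain ⟨g, rfl⟩ := toAb_surjective Ψ u
      refine ⟨g, ⟨g * w⁻¹, (mem_center_iff_toAb Ψ _).2 ?_, (inv_mul_cancel_right g w).symm⟩, rfl⟩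
      have h := parityClass_mul hu (parityClass_inv hw)
      rwa [add_neg_cancel, add_neg_cancel, ← map_inv, ← map_mul] at h
  · rw [mem_center_iff_toAb Ψ]
    obtain ⟨rfl, rfl⟩ := hw
    rintro ⟨h, h'⟩
    exact hij.elim (fun g => g h) (fun g => g h')

end

/-! ### The group algebra -/

section

open scoped IsMulCommutative

variable {G : Type u} [Group G] {n₁ m₂ m₃ m₄ : ℕ}

section

variable (Ψ : G ≃* Ext n₁ m₂ m₃ m₄)

theorem exists_algEquiv (K : Type v) [Field K] (h2 : (2 : K) ≠ 0) :
    ∃ a b : MinusAlgebra K (centerZ Ψ), IsUnit a ∧ IsUnit b ∧ Nonempty (MonoidAlgebra K G ≃ₐ[K]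
      MonoidAlgebra K (Abelianization G) × ℍ[MinusAlgebra K (centerZ Ψ), a, b]) := by
  have hG : Finite G := Finite.of_equiv _ Ψ.symm.toEquiv
  let χ : Subgroup.center G →* MinusAlgebra K (centerZ Ψ) :=
    (minusMk K (centerZ Ψ) : MonoidAlgebra K (Subgroup.center G) →* _).comp
      (MonoidAlgebra.of K (Subgroup.center G))
  obtain ⟨a, b, ha, hb, φ, hφ, hx, hy⟩ := exists_hom_quaternion
    (χ.comp (Subgroup.centerCongr Ψ).symm.toMonoidHom) (fun c hc => by
      have h : (Subgroup.centerCongr Ψ).symm c = centerZ Ψ := by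
        rw [MulEquiv.symm_apply_eq]
        refine Subtype.ext (hc.trans ?_)
        exact (Ψ.apply_symm_apply _).symm
      change χ ((Subgroup.centerCongr Ψ).symm c) = -1
      rw [h]
      exact minusMk_of_self K _)
  have hc : ∀ c : Subgroup.center G, φ.comp Ψ.toMonoidHom c =
      algebraMap _ _ (minusMk K (centerZ Ψ) (MonoidAlgebra.of K _ c)) := by
    intro c
    refine (hφ (Subgroup.centerCongr Ψ c)).trans ?_
    change algebraMap _ _ (χ ((Subgroup.centerCongr Ψ).symm (Subgroup.centerCongr Ψ c))) = _
    rw [MulEquiv.symm_apply_apply]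
    rfl
  refine ⟨a, b, ha, hb, nonempty_algEquiv_prod h2 (z := commZ Ψ) (φ := φ.comp Ψ.toMonoidHom)
    ?_ ?_ ?_ ?_⟩
  · rw [abelianization_of_eq_one_iff (toAb_eq_one_iff Ψ) (commZ_mem_commutator Ψ)]
    exact Or.inr rfl
  · refine (hc (centerZ Ψ)).trans ?_
    rw [minusMk_of_self, map_neg, map_one]
  · refine lift_quaternion_surjective (minusMk_surjective K (centerZ Ψ)) hc
      (x := Ψ.symm (⟨0, 1, 0⟩, 1)) (y := Ψ.symm (⟨0, 0, 1⟩, 1)) ?_ ?_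
    · exact (congrArg φ (Ψ.apply_symm_apply _)).trans hx
    · exact (congrArg φ (Ψ.apply_symm_apply _)).trans hy
  -- With s = n₁ + m₂ + m₃ + m₄ the orders of G, G/G' and Z(G) are 8·2^s, 4·2^s and 2·2^s. So the
  -- minus part has dimension at least 2^s, and 8 = 4 + 4·1 is the required bound.
  · have h := card_le_two_mul_finrank_minusAlgebra K (centerZ_sq Ψ) (centerZ_ne_one Ψ)
    rw [card_center Ψ] at h
    rw [card_eq Ψ, card_abelianization Ψ]
    rw [pow_succ] at h
    rw [pow_add 2 (n₁ + m₂ + m₃ + m₄) 3, pow_add 2 (n₁ + m₂ + m₃ + m₄) 2]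
    omega

/-- The commutator z = t₁^(2^n₁) is a fourth power in the centre once n₁ ≥ 2. Consequently
characters with χ(z) = -1 have order at least 8, and the quaternion part needs no correction term.
-/
theorem apply_centerZ_eq_one {A : Type*} [CommGroup A] (χ : Subgroup.center G →* A) (hn : 2 ≤ n₁)
    (h : χ ^ 4 = 1) : χ (centerZ Ψ) = 1 := by
  obtain ⟨k, rfl⟩ := Nat.exists_eq_add_of_le hn
  have hz : centerZ Ψ = (((centerIso Ψ).symm (Multiplicative.ofAdd 1, 1, 1, 1)) ^ 2 ^ k) ^ 4 := by
    apply (centerIso Ψ).injective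
    rw [centerIso_centerZ, map_pow, map_pow, MulEquiv.apply_symm_apply, ← pow_mul]
    refine Prod.ext (congrArg Multiplicative.ofAdd (?_ : _ = (2 ^ k * 4) • (1 : ZMod _)))
      (Prod.ext (one_pow _).symm (Prod.ext (one_pow _).symm (one_pow _).symm))
    rw [zmodHalf_one, nsmul_eq_mul, mul_one]
    push_cast
    ring
  rw [hz, map_pow, ← MonoidHom.pow_apply, h, MonoidHom.one_apply]

/-- Killing the nontrivial commutator in the centre. -/
noncomputable def centerQuot : Subgroup.center G →* RankFour n₁ m₂ m₃ m₄ :=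
  (rankFourMap (ZMod.castHom (pow_dvd_pow 2 (Nat.le_succ n₁)) (ZMod (2 ^ n₁))).toAddMonoidHom
    (AddMonoidHom.id _) (AddMonoidHom.id _) (AddMonoidHom.id _)).comp (centerIso Ψ).toMonoidHom

theorem centerQuot_surjective : Function.Surjective (centerQuot Ψ) := by
  rw [centerQuot, MonoidHom.coe_comp]
  refine Function.Surjective.comp (fun u => ?_) (centerIso Ψ).surjective
  obtain ⟨a, ha⟩ := ZMod.castHom_surjective (pow_dvd_pow 2 (Nat.le_succ n₁)) u.1.toAdd
  exact ⟨(Multiplicative.ofAdd a, u.2.1, u.2.2.1, u.2.2.2),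
    Prod.ext (congrArg Multiplicative.ofAdd ha) rfl⟩

theorem centerQuot_eq_one_iff (c : Subgroup.center G) :
    centerQuot Ψ c = 1 ↔ c = 1 ∨ c = centerZ Ψ := by
  rw [← (centerIso Ψ).injective.eq_iff (a := c) (b := 1),
    ← (centerIso Ψ).injective.eq_iff (a := c) (b := centerZ Ψ), centerIso_centerZ,
    (centerIso Ψ).map_one]
  change rankFourMap _ _ _ _ (centerIso Ψ c) = 1 ↔ _
  generalize centerIso Ψ c = u
  obtain ⟨u₁, u₂, u₃, u₄⟩ := u
  constructor
  · intro h
    obtain ⟨b, hb⟩ := (castHom_eq_zero_iff u₁.toAdd).1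
      (congrArg (fun v : RankFour n₁ m₂ m₃ m₄ => v.1.toAdd) h)
    have h' := congrArg Prod.snd h
    change (u₂, u₃, u₄) = 1 at h'
    rw [h']
    have hb2 : b = 0 ∨ b = 1 := (by decide : ∀ b : ZMod 2, b = 0 ∨ b = 1) b
    rcases hb2 with rfl | rfl
    · exact Or.inl (Prod.ext (congrArg Multiplicative.ofAdd (hb.symm.trans (map_zero _))) rfl)
    · exact Or.inr (Prod.ext (congrArg Multiplicative.ofAdd hb.symm) rfl)
  · rintro (h | h)
    · rw [h, map_one]
    · rw [h]
      exact Prod.ext (congrArg Multiplicative.ofAdd (castHom_zmodHalf 1)) rfl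

end

section Count

variable {K : Type v} [Field K] (L : Type*) [Field L] [Algebra K L]
  [IsCyclotomicExtension {2 ^ (n₁ + m₂ + m₃ + m₄ + 3)} K L]

theorem card_maximalSpectrum_abelianization (Ψ : G ≃* Ext n₁ m₂ m₃ m₄) (h2 : (2 : K) ≠ 0)
    {R : Set ℕ} (hR1 : 1 ∈ R)
    (hR : ∀ σ : L ≃ₐ[K] L, ∃ r ∈ R,
      ∀ ζ : L, ζ ^ 2 ^ (n₁ + m₂ + m₃ + m₄ + 3) = 1 → σ ζ = ζ ^ r)
    (hR' : ∀ r ∈ R, ∃ σ : L ≃ₐ[K] L,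
      ∀ ζ : L, ζ ^ 2 ^ (n₁ + m₂ + m₃ + m₄ + 3) = 1 → σ ζ = ζ ^ r) :
    Nat.card (MaximalSpectrum (MonoidAlgebra K (Abelianization G))) =
      powClassCount R (Set.univ : Set (Abelianization G)) := by
  have : Finite G := Finite.of_equiv _ Ψ.symm.toEquiv
  have : Finite (Abelianization G) := inferInstanceAs (Finite (G ⧸ commutator G))
  have : NeZero ((2 ^ (n₁ + m₂ + m₃ + m₄ + 3) : ℕ) : K) := ⟨by
    rw [Nat.cast_pow, Nat.cast_ofNat]; exact pow_ne_zero _ h2⟩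
  have hA := abelianization_pow_eq_one Ψ
  have := hasEnoughRootsOfUnity_exponent (K := K) (L := L) hA
  rw [card_maximalSpectrum (L := L) hA (h := AlgHom.id K _) Function.surjective_id hR1 hR hR',
    ← powClassCount_dual (L := L)]
  congr 1
  refine Set.eq_univ_of_forall fun χ => ?_
  exact ⟨MonoidAlgebra.lift K L _ ((Units.coeHom L).comp χ), fun a => MonoidAlgebra.lift_of _ a⟩

theorem card_maximalSpectrum_minusAlgebra (Ψ : G ≃* Ext n₁ m₂ m₃ m₄) {R : Set ℕ} (hR1 : 1 ∈ R)
    (hR : ∀ σ : L ≃ₐ[K] L, ∃ r ∈ R,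
      ∀ ζ : L, ζ ^ 2 ^ (n₁ + m₂ + m₃ + m₄ + 3) = 1 → σ ζ = ζ ^ r)
    (hR' : ∀ r ∈ R, ∃ σ : L ≃ₐ[K] L,
      ∀ ζ : L, ζ ^ 2 ^ (n₁ + m₂ + m₃ + m₄ + 3) = 1 → σ ζ = ζ ^ r) :
    Nat.card (MaximalSpectrum (MinusAlgebra K (centerZ Ψ))) =
      powClassCount R {χ : Subgroup.center G →* Lˣ | χ (centerZ Ψ) = -1} := by
  have : Finite G := Finite.of_equiv _ Ψ.symm.toEquiv
  rw [card_maximalSpectrum (L := L) (center_pow_eq_one Ψ)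
    (minusMk_surjective K (centerZ Ψ)) hR1 hR hR']
  congr 1
  ext χ
  exact exists_algHom_minusAlgebra_iff K χ

theorem cyclicCount_minus_add (Ψ : G ≃* Ext n₁ m₂ m₃ m₄) (h2 : (2 : K) ≠ 0) :
    cyclicCount {χ : Subgroup.center G →* Lˣ | χ (centerZ Ψ) = -1} + rankFourCount n₁ m₂ m₃ m₄ =
      rankFourCount (n₁ + 1) m₂ m₃ m₄ := by
  have : Finite G := Finite.of_equiv _ Ψ.symm.toEquiv
  have : NeZero ((2 ^ (n₁ + m₂ + m₃ + m₄ + 3) : ℕ) : K) := ⟨by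
    rw [Nat.cast_pow, Nat.cast_ofNat]; exact pow_ne_zero _ h2⟩
  have : HasEnoughRootsOfUnity L (Monoid.exponent (Subgroup.center G)) :=
    hasEnoughRootsOfUnity_exponent (K := K) (center_pow_eq_one Ψ)
  have : HasEnoughRootsOfUnity L (Monoid.exponent (RankFour n₁ m₂ m₃ m₄)) :=
    hasEnoughRootsOfUnity_exponent (K := K) (n := 2 ^ (n₁ + m₂ + m₃ + m₄ + 3))
      fun u => rankFour_pow_eq_one (by omega) (by omega) (by omega) (by omega) u
  have h2L : (2 : L) ≠ 0 := by
    rw [← map_ofNat (algebraMap K L) 2]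
    exact (map_ne_zero _).2 h2
  have h := cyclicCount_neg_one_add (L := L) (centerQuot_surjective Ψ) (centerQuot_eq_one_iff Ψ)
    ((pow_two _).symm.trans (centerZ_sq Ψ)) h2L
  rw [rankFourCount_eq, rankFourCount_eq, ← numCyclicSubgroups_congr (centerIso Ψ)]
  exact h

end Count

section Decomposition

variable {K : Type v} [Field K]

theorem isReduced_abelianization (Ψ : G ≃* Ext n₁ m₂ m₃ m₄) (h2 : (2 : K) ≠ 0) :
    IsReduced (MonoidAlgebra K (Abelianization G)) := by
  have : Finite G := Finite.of_equiv _ Ψ.symm.toEquiv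
  have : Finite (Abelianization G) := inferInstanceAs (Finite (G ⧸ commutator G))
  have : NeZero (Nat.card (Abelianization G) : K) := ⟨by
    rw [card_abelianization Ψ, Nat.cast_pow, Nat.cast_ofNat]; exact pow_ne_zero _ h2⟩
  infer_instance

theorem isReduced_minusAlgebra_center (Ψ : G ≃* Ext n₁ m₂ m₃ m₄) (h2 : (2 : K) ≠ 0) :
    IsReduced (MinusAlgebra K (centerZ Ψ)) := by
  have : Finite G := Finite.of_equiv _ Ψ.symm.toEquiv
  have : NeZero (Nat.card (Subgroup.center G) : K) := ⟨by
    rw [card_center Ψ, Nat.cast_pow, Nat.cast_ofNat]; exact pow_ne_zero _ h2⟩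
  exact isReduced_minusAlgebra K _

theorem isSumFieldsQuaternions_of_irreducible (Ψ : G ≃* Ext n₁ m₂ m₃ m₄) (h2 : (2 : K) ≠ 0)
    (hirr : Irreducible (Polynomial.cyclotomic (2 ^ (n₁ + m₂ + m₃ + m₄ + 3)) K)) {M : ℕ}
    (hM : M + rankFourCount n₁ m₂ m₃ m₄ = rankFourCount (n₁ + 1) m₂ m₃ m₄) :
    IsSumFieldsQuaternions K (MonoidAlgebra K G) (numCyclicSubgroups (Abelianization G)) M := by
  have : Finite G := Finite.of_equiv _ Ψ.symm.toEquiv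
  have : Finite (Abelianization G) := inferInstanceAs (Finite (G ⧸ commutator G))
  have : NeZero ((2 ^ (n₁ + m₂ + m₃ + m₄ + 3) : ℕ) : K) := ⟨by
    rw [Nat.cast_pow, Nat.cast_ofNat]; exact pow_ne_zero _ h2⟩
  have := isReduced_abelianization Ψ h2
  have := isReduced_minusAlgebra_center Ψ h2
  obtain ⟨hR, hR'⟩ := galois_rat (Nat.succ_ne_zero _) hirr
  obtain ⟨a, b, ha, hb, ⟨e⟩⟩ := exists_algEquiv Ψ K h2
  have h := isSumFieldsQuaternions_of_algEquiv ha hb e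
  rw [card_maximalSpectrum_abelianization (CyclotomicField _ K) Ψ h2 odd_one hR hR',
    card_maximalSpectrum_minusAlgebra (CyclotomicField _ K) Ψ odd_one hR hR',
    powClassCount_odd (k := n₁ + m₂ + m₃ + m₄ + 3), powClassCount_odd (k := n₁ + m₂ + m₃ + m₄ + 3),
    ← numCyclicSubgroups_eq_cyclicCount] at h
  · have h' := cyclicCount_minus_add (K := K)
      (CyclotomicField (2 ^ (n₁ + m₂ + m₃ + m₄ + 3)) K) Ψ h2
    rwa [Nat.add_right_cancel (h'.trans hM.symm)] at h
  · exact fun χ _ => dual_pow_eq_one Ψ χ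
  · exact fun a _ => abelianization_pow_eq_one Ψ a

/-- The factors of G/G' coming from x and y have order 2^(m₂+1) and 2^(m₃+1), which is why 1
suffices as a lower bound for m₂ and m₃. -/
theorem cyclicCount_abelianization_pow_four (Ψ : G ≃* Ext n₁ m₂ m₃ m₄) (hn : 2 ≤ n₁) (h₂ : 1 ≤ m₂)
    (h₃ : 1 ≤ m₃) (h₄ : 2 ≤ m₄) : cyclicCount {a : Abelianization G | a ^ 4 = 1} = 136 := by
  rw [← cyclicCount_rankFour_pow_four hn (by omega : 2 ≤ m₂ + 1) (by omega : 2 ≤ m₃ + 1) h₄,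
    ← cyclicCount_image (abEquiv Ψ).toMonoidHom (abEquiv Ψ).injective]
  congr 1
  ext u
  constructor
  · rintro ⟨a, ha, rfl⟩
    exact (map_pow (abEquiv Ψ) a 4).symm.trans ((congrArg _ ha).trans (map_one _))
  · intro hu
    refine ⟨(abEquiv Ψ).symm u, ?_, (abEquiv Ψ).apply_symm_apply u⟩
    exact (map_pow (abEquiv Ψ).symm u 4).symm.trans ((congrArg _ hu).trans (map_one _))

/-- Here n and k are the numbers of orbits under powers of q on G/G' and on the characters of the
centre with χ(z) = -1. Only the first involves elements of order at most 4, whence the asymmetric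
136. -/
theorem exists_isSumFieldsSplitQuaternions [Finite K] (hK : Odd (Nat.card K))
    (Ψ : G ≃* Ext n₁ m₂ m₃ m₄) (hn : 2 ≤ n₁) (h₂ : 1 ≤ m₂) (h₃ : 1 ≤ m₃) (h₄ : 2 ≤ m₄) {M : ℕ}
    (hM : M + rankFourCount n₁ m₂ m₃ m₄ = rankFourCount (n₁ + 1) m₂ m₃ m₄) :
    ∃ n k, IsSumFieldsSplitQuaternions K (MonoidAlgebra K G) n k ∧
      2 * numCyclicSubgroups (Abelianization G) ≤ n + 136 ∧ 2 * M ≤ k ∧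
      (Nat.card K % 8 = 3 → 2 * numCyclicSubgroups (Abelianization G) = n + 136 ∧ 2 * M = k) := by
  have h2 : (2 : K) ≠ 0 := by
    have := Fintype.ofFinite K
    rw [Nat.card_eq_fintype_card] at hK
    exact Ring.two_ne_zero fun h => Nat.not_even_iff_odd.2 hK
      (Nat.even_iff.2 (FiniteField.even_card_of_char_two h))
  have : Finite G := Finite.of_equiv _ Ψ.symm.toEquiv
  have : Finite (Abelianization G) := inferInstanceAs (Finite (G ⧸ commutator G))
  have : NeZero ((2 ^ (n₁ + m₂ + m₃ + m₄ + 3) : ℕ) : K) := ⟨by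
    rw [Nat.cast_pow, Nat.cast_ofNat]; exact pow_ne_zero _ h2⟩
  have := isReduced_abelianization Ψ h2
  have := isReduced_minusAlgebra_center Ψ h2
  let L := CyclotomicField (2 ^ (n₁ + m₂ + m₃ + m₄ + 3)) K
  have : FiniteDimensional K L :=
    IsCyclotomicExtension.finiteDimensional {2 ^ (n₁ + m₂ + m₃ + m₄ + 3)} K L
  obtain ⟨hR, hR'⟩ := galois_finite (n := 2 ^ (n₁ + m₂ + m₃ + m₄ + 3)) K L
  obtain ⟨a, b, ha, hb, ⟨e⟩⟩ := exists_algEquiv Ψ K h2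
  have h := isSumFieldsSplitQuaternions_of_algEquiv h2 ha hb e
  rw [card_maximalSpectrum_abelianization L Ψ h2 (one_mem_powersOf _) hR hR',
    card_maximalSpectrum_minusAlgebra L Ψ (one_mem_powersOf _) hR hR'] at h
  have hM' := Nat.add_right_cancel ((cyclicCount_minus_add (K := K) L Ψ h2).trans hM.symm)
  have : HasEnoughRootsOfUnity L (Monoid.exponent (Subgroup.center G)) :=
    hasEnoughRootsOfUnity_exponent (K := K) (center_pow_eq_one Ψ)
  have : Finite (Subgroup.center G →* Lˣ) := finite_dual
  have h4 := cyclicCount_abelianization_pow_four Ψ hn h₂ h₃ h₄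
  have hle : 2 * M ≤ powClassCount (powersOf (Nat.card K))
      {χ : Subgroup.center G →* Lˣ | χ (centerZ Ψ) = -1} := by
    rw [← hM']
    -- The set is stable under odd powers because (-1)^r = -1, and its members have order divisible
    -- by 8 because a character of order dividing 4 is trivial at z, while 1 ≠ -1 in L.
    refine two_mul_cyclicCount_le hK (fun χ _ => dual_pow_eq_one Ψ χ) (fun χ hc r hr => ?_)
      fun χ hc => ?_
    · change (χ ^ r) _ = -1
      rw [MonoidHom.pow_apply, hc, hr.neg_one_pow]
    · refine eight_dvd_orderOf (dual_pow_eq_one Ψ χ) fun h => ?_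
      have h1 := (apply_centerZ_eq_one Ψ χ hn h).symm.trans hc
      have h2L : (2 : L) ≠ 0 := by
        rw [← map_ofNat (algebraMap K L) 2]
        exact (map_ne_zero _).2 h2
      have h3 : (1 : L) = -1 := congrArg Units.val h1
      exact h2L (by linear_combination h3)
  refine ⟨_, _, h, ?_, hle, fun hq => ⟨?_, le_antisymm hle ?_⟩⟩
  · rw [← h4]
    exact two_mul_numCyclicSubgroups_le hK (abelianization_pow_eq_one Ψ)
  · rw [← h4]
    exact two_mul_numCyclicSubgroups_eq hq (abelianization_pow_eq_one Ψ)
  · rw [← hM']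
    exact le_two_mul_cyclicCount hq fun χ _ => dual_pow_eq_one Ψ χ

end Decomposition

end

end D5Model

/-! ### Assembly of the main theorem -/

theorem rankFourCount_le_succ (a b c d : ℕ) :
    rankFourCount a b c d ≤ rankFourCount (a + 1) b c d := by
  rw [rankFourCount_eq, rankFourCount_eq, numCyclicSubgroups_eq_cyclicCount_range
    (rankFourMap (zmodIncl (Nat.le_succ a)) (AddMonoidHom.id _) (AddMonoidHom.id _)
      (AddMonoidHom.id _)) (rankFourMap_injective (zmodIncl_injective _) Function.injective_id
        Function.injective_id Function.injective_id), numCyclicSubgroups_eq_cyclicCount]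
  exact Set.ncard_le_ncard (Set.image_mono (Set.subset_univ _)) (Set.toFinite _)

theorem mainTheorem6 (m₁ m₂ m₃ m₄ : ℕ) (hm₁ : 3 ≤ m₁) (hm₂ : 3 ≤ m₂) (hm₃ : 3 ≤ m₃) (hm₄ : 3 ≤ m₄)
    {G₀ : Type u} [Group G₀] (e : D5Group m₁ m₂ m₃ ≃* G₀)
    {G : Type u} [Group G] (f : G₀ × Multiplicative (ZMod (2 ^ m₄)) ≃* G)
    (x y : G) (hx : x = f (e (PresentedGroup.of D5Gen.x), 1))
    (hy : y = f (e (PresentedGroup.of D5Gen.y), 1))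
    (N₀ N₁ N₂ N₃ N₄ N : ℕ)
    (hN₀ : N₀ = numCyclicSubgroups (Abelianization G))
    (hN₁ : N₁ = numCyclicSubgroups (Subgroup.center G))
    (hN₂ : N₂ = numKClassesInvolving ℚ x)
    (hN₃ : N₃ = numKClassesInvolving ℚ y)
    (hN₄ : N₄ = numKClassesInvolving ℚ (x * y))
    (hN : N = N₁ + N₂ + N₃ + N₄) :
    -- the numbers in terms of cyclic subgroups of products of four cyclic groups
    (N₀ = rankFourCount (m₁ - 1) (m₂ + 1) (m₃ + 1) m₄ ∧
      N₁ = rankFourCount m₁ m₂ m₃ m₄ ∧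
      N₂ + rankFourCount (m₁ - 1) m₂ m₃ m₄ = rankFourCount (m₁ - 1) (m₂ + 1) m₃ m₄ ∧
      N₃ + rankFourCount (m₁ - 1) m₂ m₃ m₄ = rankFourCount (m₁ - 1) m₂ (m₃ + 1) m₄ ∧
      N₄ + rankFourCount (m₁ - 1) m₂ m₃ m₄ =
        rankFourCount (m₁ - 1) (max m₂ m₃ + 1) (min m₂ m₃) m₄) ∧
    -- the subtractions below do not truncate
    N₀ ≤ N ∧ 136 ≤ 2 * N₀ ∧
    IsSumFieldsQuaternions ℚ (MonoidAlgebra ℚ G) N₀ (N - N₀) ∧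
    (∀ (K : Type v) [Field K] [Finite K], Odd (Nat.card K) →
      (∃ n, HasSimpleComponents K (MonoidAlgebra K G) n) ∧
      (∀ n, HasSimpleComponents K (MonoidAlgebra K G) n → 2 * N - 136 ≤ n) ∧
      (Nat.card K % 8 = 3 →
        HasSimpleComponents K (MonoidAlgebra K G) (2 * N - 136) ∧
        IsSumFieldsSplitQuaternions K (MonoidAlgebra K G) (2 * N₀ - 136) (2 * (N - N₀)))) := by
  obtain ⟨n₁, rfl⟩ : ∃ n, m₁ = n + 1 := ⟨m₁ - 1, by omega⟩
  let Ψ : G ≃* D5Model.Ext n₁ m₂ m₃ m₄ := f.symm.trans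
    (MulEquiv.prodCongr (e.symm.trans (D5Model.presentedEquiv n₁ m₂ m₃)) (MulEquiv.refl _))
  have hgen : ∀ g, Ψ (f (e (PresentedGroup.of g), 1)) = (D5Model.genImage n₁ m₂ m₃ g, 1) := by
    intro g
    change ((D5Model.presentedEquiv n₁ m₂ m₃) (e.symm (f.symm (f _)).1), (f.symm (f _)).2) = _
    rw [MulEquiv.symm_apply_apply, MulEquiv.symm_apply_apply, D5Model.presentedEquiv_of]
  have hx' : D5Model.toAb Ψ x ∈ parityClass n₁ m₂ m₃ m₄ 1 0 := by
    rw [hx]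
    change D5Model.toRankFour n₁ m₂ m₃ m₄ (Ψ _) ∈ _
    rw [hgen]
    exact ⟨map_one _, map_zero _⟩
  have hy' : D5Model.toAb Ψ y ∈ parityClass n₁ m₂ m₃ m₄ 0 1 := by
    rw [hy]
    change D5Model.toRankFour n₁ m₂ m₃ m₄ (Ψ _) ∈ _
    rw [hgen]
    exact ⟨map_zero _, map_one _⟩
  have hxy' : D5Model.toAb Ψ (x * y) ∈ parityClass n₁ m₂ m₃ m₄ 1 1 := by
    rw [map_mul]
    exact D5Model.parityClass_mul hx' hy'
  rw [D5Model.numKClassesInvolving_eq Ψ hx' (Or.inl one_ne_zero)] at hN₂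
  rw [D5Model.numKClassesInvolving_eq Ψ hy' (Or.inr one_ne_zero)] at hN₃
  rw [D5Model.numKClassesInvolving_eq Ψ hxy' (Or.inl one_ne_zero)] at hN₄
  have hN₀' : N₀ = rankFourCount n₁ (m₂ + 1) (m₃ + 1) m₄ :=
    hN₀.trans (numCyclicSubgroups_congr (D5Model.abEquiv Ψ))
  have hN₁' : N₁ = rankFourCount (n₁ + 1) m₂ m₃ m₄ :=
    hN₁.trans (numCyclicSubgroups_congr (D5Model.centerIso Ψ))
  obtain ⟨-, h₂, h₃, h₄, h₀⟩ := cyclicCount_parity_sum n₁ m₂ m₃ m₄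
  rw [← hN₂] at h₂ h₀
  rw [← hN₃] at h₃ h₀
  rw [← hN₄] at h₄ h₀
  -- This inequality amounts to N₀ ≤ N, so that N - N₀ is a genuine difference.
  have hle : rankFourCount n₁ m₂ m₃ m₄ ≤ N₁ := by
    rw [hN₁']
    exact rankFourCount_le_succ n₁ m₂ m₃ m₄
  -- The terms N₂, N₃, N₄ occur in both N and N₀ and cancel, leaving N₁ minus the number of cyclic
  -- subgroups of Z(G)/G'.
  have hM : (N - N₀) + rankFourCount n₁ m₂ m₃ m₄ = rankFourCount (n₁ + 1) m₂ m₃ m₄ := by omega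
  have h136 : 136 ≤ N₀ := by
    have : Finite G := Finite.of_equiv _ Ψ.symm.toEquiv
    have : Finite (Abelianization G) := inferInstanceAs (Finite (G ⧸ commutator G))
    rw [hN₀, numCyclicSubgroups_eq_cyclicCount, ← D5Model.cyclicCount_abelianization_pow_four Ψ
      (by omega) (by omega) (by omega) (by omega)]
    exact Set.ncard_le_ncard (Set.image_mono (Set.subset_univ _)) (Set.toFinite _)
  have hfin : ∀ (K : Type v) [Field K] [Finite K], Odd (Nat.card K) →
      ∃ n k, IsSumFieldsSplitQuaternions K (MonoidAlgebra K G) n k ∧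
        2 * N₀ ≤ n + 136 ∧ 2 * (N - N₀) ≤ k ∧
        (Nat.card K % 8 = 3 → 2 * N₀ = n + 136 ∧ 2 * (N - N₀) = k) := fun K _ _ hK => by
    rw [hN₀] at hM ⊢
    exact D5Model.exists_isSumFieldsSplitQuaternions hK Ψ (by omega) (by omega) (by omega)
      (by omega) hM
  refine ⟨⟨hN₀', hN₁', h₂, h₃, h₄⟩, by omega, by omega, ?_, fun K _ _ hK => ?_⟩
  · have h := D5Model.isSumFieldsQuaternions_of_irreducible (K := ℚ) Ψ two_ne_zero
      (Polynomial.cyclotomic.irreducible_rat (Nat.two_pow_pos _)) hM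
    rwa [← hN₀] at h
  · obtain ⟨n, k, h, hn, hk, heq⟩ := hfin K hK
    refine ⟨⟨_, h.hasSimpleComponents⟩, fun n' h' => ?_, fun hq => ?_⟩
    -- An arbitrary decomposition has as many components as the explicit one, namely n + k, to which
    -- the two lower bounds apply.
    · have := h'.unique h.hasSimpleComponents
      omega
    · obtain ⟨hn, hk⟩ := heq hq
      have hn' : n = 2 * N₀ - 136 := by omega
      rw [hn', ← hk] at h
      have h' := h.hasSimpleComponents
      have hsum : 2 * N₀ - 136 + 2 * (N - N₀) = 2 * N - 136 := by omega
      rw [hsum] at h'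
      exact ⟨h', h⟩
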